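/- Let $\mu$ be Lebesgue measure on $[0,1)$ and $\oplus$ addition modulo $1$. For irrational $\alpha\in[0,1)$ put, for $x\in[0,1)$ and $k\in\mathbb Z$, $$\varrho_k(x)=1+\#\{0\le i<k: x\oplus i\alpha\in[0,\tfrac12)\}-\#\{0\le i<k: x\oplus i\alpha\in[\tfrac12,1)\}\quad(k\ge 0),$$ $$\varrho_k(x)=1-\#\{k\le i<0: x\oplus i\alpha\in[0,\tfrac12)\}+\#\{k\le i<0: x\oplus i\alpha\in[\tfrac12,1)\}\quad(k<0),$$ and let $h(x,y)=\varrho_k(x)$ if $y=x\oplus k\alpha$ for some $k\in\mathbb Z$, and $h(x,y)=+\infty$ otherwise. For $\tau:[0,1)\to\mathbb Z$ let $T^{(\tau)}(x)=x\oplus\tau(x)\alpha$, let $\Gamma_\tau$ be the graph of $T^{(\tau)}$ and $\pi_\tau=(\mathrm{id},T^{(\tau)})_\#\mu$; $\Gamma_0,\Gamma_1,\pi_0,\pi_1$ are the cases of constant $\tau=0,1$. Let $c=h_+$ on $\Gamma_0\cup\Gamma_1\cup\Gamma_\tau$ and $c=+\infty$ elsewhere on $[0,1)^2$. For a transport plan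 $\pi\in\Pi(\mu,\mu)$ with $\int c\,d\pi<\infty$ let $D^{(\pi)}=\lim_{\varepsilon\downarrow0}\sup\{\int\varphi\,d\mu+\int\psi\,d\mu:\ \varphi,\psi\in L^1(\mu),\ \int(\varphi\oplus\psi-c)_+\,d\pi\le\varepsilon\}$, where $(\varphi\oplus\psi)(x,y)=\varphi(x)+\psi(y)$, and let $L^1_S(\pi)$ be the closed linear span in $L^1(\pi)$ of the functions $\varphi\oplus\psi$ with $\varphi,\psi\in L^1(\mu)$. A dual optimizer is an $\hat h\in L^1_S(\pi)^{**}\subseteq L^1(\pi)^{**}=L^\infty(\pi)^*$ such that $\hat h\le c$ and $\langle\hat h,1\rangle=D^{(\pi)}$. An $\hat h^s\in L^1(\pi)^{**}$ is purely singular if for every $\varepsilon>0$ there is a set $A$ with $\pi(A)<\varepsilon$ such that $\hat h^s$ vanishes on all $f\in L^\infty(\pi)$ with $f=0$ on $A$. Every $\hat h\in L^1(\pi)^{**}$ is uniquely $\hat h=\hat h^r+\hat h^s$ with regular part $\hat h^r\in L^1(\pi)$ and purely singular part $\hat h^s$. **Claim.** There are an irrational $\alpha\in[0,1)$ and a Borel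 map $\tau:[0,1)\to\mathbb Z$ such that, with $\pi=(\pi_0+\pi_1+\pi_\tau)/3$: (i) $T^{(0)},T^{(1)},T^{(\tau)}$ are $\mu$-preserving bijections of $[0,1)$, so that $\pi_0,\pi_1,\pi_\tau\in\Pi(\mu,\mu)$; moreover $\int c\,d\pi<\infty$ and $h\in L^1(\pi)$. (ii) $\pi_0$ and $\pi_1$ are optimal transport plans for $c$, and $\pi_\tau$ is not; in fact $\langle c,\pi_0\rangle=\langle c,\pi_1\rangle=1$ while $\langle c,\pi_\tau\rangle\ge\langle h,\pi_\tau\rangle>1$. (iii) There are bounded Borel functions $\varphi_n,\psi_n$ on $[0,1)$ with $\varphi_n(x)+\psi_n(y)\le c(x,y)$ for all $x,y$, with $\int\varphi_n\,d\mu+\int\psi_n\,d\mu\to1$, and with $\varphi_n(x)+\psi_n(y)\to h(x,y)$ for $\pi$-almost all $(x,y)$. (iv) Dual optimizers $\hat h\in L^1(\pi)^{**}$ exist, and every dual optimizer has regular part $\hat h^r=h$ $\pi$-a.s. and a non-zero singular part $\hat h^s$ of total mass $\langle h,\pi_\tau\rangle-1$ relative to $\pi_\tau$, namely $\langle\hat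 h^s,\tfrac{d\pi_\tau}{d\pi}\rangle=-(\langle h,\pi_\tau\rangle-1)$; in terms of the norm relative to $\pi$, $\|\hat h^s\|_{L^1(\pi)^{**}}=\tfrac13(\langle h,\pi_\tau\rangle-1)>0$. The finitely additive measure $\hat h^s$ is supported by $\Gamma_\tau$, and $\langle\hat h^s,\mathbf 1_{\Gamma_0}+\mathbf 1_{\Gamma_1}\rangle=0$. -/

import Mathlib

open MeasureTheory Filter Topology
open scoped ENNReal

noncomputable section

namespace SingularDual

/-! ### Optimal transport with a general cost, and relaxed dual optimizers -/

section General

variable {X Y : Type*} [MeasurableSpace X] [MeasurableSpace Y]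

/-- `π` is a transport plan between `μ` and `ν`. -/
def IsTransportPlan (μ : Measure X) (ν : Measure Y) (π : Measure (X × Y)) : Prop :=
  π.map Prod.fst = μ ∧ π.map Prod.snd = ν

/-- `π` is an optimal transport plan for the cost `c`. -/
def IsOptimalPlan (c : X → Y → ℝ≥0∞) (μ : Measure X) (ν : Measure Y)
    (π : Measure (X × Y)) : Prop :=
  IsTransportPlan μ ν π ∧
    ∀ π' : Measure (X × Y), IsTransportPlan μ ν π' →
      ∫⁻ p, c p.1 p.2 ∂π ≤ ∫⁻ p, c p.1 p.2 ∂π'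

/-- `D^(π, ε)`: the supremum of `∫ φ dμ + ∫ ψ dν` over integrable `φ`, `ψ` such that
`∫ (φ ⊕ ψ - c)₊ dπ ≤ ε`. -/
def dualValueEps (c : X → Y → ℝ≥0∞) (μ : Measure X) (ν : Measure Y) (π : Measure (X × Y))
    (ε : ℝ) : EReal :=
  sSup {v : EReal | ∃ (φ : X → ℝ) (ψ : Y → ℝ), Integrable φ μ ∧ Integrable ψ ν ∧
    ∫⁻ p, (((φ p.1 + ψ p.2 : ℝ) : EReal) - ((c p.1 p.2 : ℝ≥0∞) : EReal)).toENNReal ∂π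
      ≤ ENNReal.ofReal ε ∧
    v = ((∫ x, φ x ∂μ + ∫ y, ψ y ∂ν : ℝ) : EReal)}

/-- `D^(π)`, the limit of `D^(π, ε)` as `ε` decreases to `0`. Since `D^(π, ε)` is monotone in `ε`,
the limit is the infimum. -/
def dualValue (c : X → Y → ℝ≥0∞) (μ : Measure X) (ν : Measure Y) (π : Measure (X × Y)) : EReal :=
  ⨅ ε : ℝ, ⨅ _ : 0 < ε, dualValueEps c μ ν π ε

/-- `L¹_S(π)`: the closed linear span in `L¹(π)` of the functions `φ ⊕ ψ` with `φ ∈ L¹(μ)` and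
`ψ ∈ L¹(ν)`. -/
def sumSpace (μ : Measure X) (ν : Measure Y) (π : Measure (X × Y)) : Submodule ℝ (Lp ℝ 1 π) :=
  (Submodule.span ℝ {g : Lp ℝ 1 π | ∃ (φ : X → ℝ) (ψ : Y → ℝ), Integrable φ μ ∧ Integrable ψ ν ∧
    g =ᵐ[π] fun p => φ p.1 + ψ p.2}).topologicalClosure

end General

section Bidual

variable {Z : Type*} [MeasurableSpace Z]

/-- The bidual `L¹(π)** = L^∞(π)*` of `L¹(π)`, for a finite measure `π`. -/
abbrev L1Bidual (π : Measure Z) : Type _ := StrongDual ℝ (Lp ℝ ∞ π)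

/-- `ξ ∈ L¹(π)**` is purely singular: for every `ε > 0` there is a set `A` with `π(A) < ε` outside
of which `ξ` vanishes. -/
def PurelySingular {π : Measure Z} (ξ : L1Bidual π) : Prop :=
  ∀ ε : ℝ≥0∞, 0 < ε → ∃ A : Set Z, MeasurableSet A ∧ π A < ε ∧
    ∀ f : Lp ℝ ∞ π, (∀ᵐ z ∂π, z ∈ A → f z = 0) → ξ f = 0

/-- `ξ = r + s` with regular part `r ∈ L¹(π)` and purely singular part `s`. -/
def IsDecomposition {π : Measure Z} (ξ : L1Bidual π) (r : Lp ℝ 1 π) (s : L1Bidual π) : Prop :=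
  PurelySingular s ∧ ∀ f : Lp ℝ ∞ π, ξ f = (∫ z, r z * f z ∂π) + s f

/-- `ξ`, as a finitely additive measure, is supported by the set `A`. -/
def SupportedBy {π : Measure Z} (ξ : L1Bidual π) (A : Set Z) : Prop :=
  ∀ f : Lp ℝ ∞ π, (∀ᵐ z ∂π, z ∈ A → f z = 0) → ξ f = 0

/-- The function `g` is (a representative of an element) in `L^∞(π)`, and `⟨ξ, g⟩ = a`. -/
def HasPairing {π : Measure Z} (ξ : L1Bidual π) (g : Z → ℝ) (a : ℝ) : Prop :=
  ∃ f : Lp ℝ ∞ π, f =ᵐ[π] g ∧ ξ f = a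

end Bidual

/-- `ξ ∈ L¹(π)**` is a dual optimizer with respect to the transport plan `π`: it lies in
`L¹_S(π)**`, viewed as the bi-annihilator of `L¹_S(π)` in `L¹(π)**`, it satisfies `ξ ≤ c`, and
`⟨ξ, π⟩ = D^(π)`, where `π` is identified with its density `1` with respect to itself. -/
structure IsDualOptimizer {X Y : Type*} [MeasurableSpace X] [MeasurableSpace Y]
    (c : X → Y → ℝ≥0∞) (μ : Measure X) (ν : Measure Y) (π : Measure (X × Y))
    (ξ : L1Bidual π) : Prop where
  mem_bidual : ∀ f : Lp ℝ ∞ π, (∀ g ∈ sumSpace μ ν π, ∫ p, g p * f p ∂π = 0) → ξ f = 0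
  le_cost : ∀ f : Lp ℝ ∞ π, 0 ≤ f →
    ((ξ f : ℝ) : EReal) ≤ ((∫⁻ p, ENNReal.ofReal (f p) * c p.1 p.2 ∂π : ℝ≥0∞) : EReal)
  value : ∃ a : ℝ, HasPairing ξ (fun _ => 1) a ∧ (a : EReal) = dualValue c μ ν π

/-! ### The cost on the unit interval -/

/-- The interval `[0,1)`. -/
abbrev I : Type := Set.Ico (0 : ℝ) 1

/-- Lebesgue measure `μ` on `[0,1)`. -/
def leb : Measure I := (volume : Measure ℝ).comap Subtype.val

/-- `x ⊕ kα`, addition modulo `1`. -/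
def rot (α : ℝ) (k : ℤ) (x : I) : I :=
  ⟨Int.fract ((x : ℝ) + k * α), Int.fract_nonneg _, Int.fract_lt_one _⟩

/-- `ϱ_k(x)`: one plus the number of visits to `[0,1/2)` minus the number of visits to `[1/2,1)` of
`x ⊕ iα`, `0 ≤ i < k`; for negative `k` the visits at the times `k ≤ i < 0` count with the opposite
sign. -/
def rho (α : ℝ) (k : ℤ) (x : I) : ℤ :=
  if 0 ≤ k then
    1 + (((Finset.Ico 0 k).filter fun i => (rot α i x : ℝ) < 1 / 2).card : ℤ)
      - (((Finset.Ico 0 k).filter fun i => 1 / 2 ≤ (rot α i x : ℝ)).card : ℤ)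
  else
    1 - (((Finset.Ico k 0).filter fun i => (rot α i x : ℝ) < 1 / 2).card : ℤ)
      + (((Finset.Ico k 0).filter fun i => 1 / 2 ≤ (rot α i x : ℝ)).card : ℤ)

open Classical in
/-- `h(x, y) = ϱ_k(x)` if `y = x ⊕ kα` with `k ∈ ℤ` (for irrational `α` this `k` is unique), and
`h(x, y) = ∞` if there is no such `k`. -/
def h (α : ℝ) (x y : I) : EReal :=
  if hk : ∃ k : ℤ, y = rot α k x then (((rho α hk.choose x : ℤ) : ℝ) : EReal) else ⊤

/-- The map `T^(τ)(x) = x ⊕ τ(x)α`; for constant `τ = k` it is the rotation by `kα`. -/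
def T (α : ℝ) (τ : I → ℤ) (x : I) : I := rot α (τ x) x

/-- The graph `Γ_τ` of `T^(τ)`. -/
def graph (α : ℝ) (τ : I → ℤ) : Set (I × I) := {p | p.2 = T α τ p.1}

/-- The transport plan `π_τ = (id, T^(τ))_# μ`. -/
def plan (α : ℝ) (τ : I → ℤ) : Measure (I × I) :=
  leb.map fun x => (x, T α τ x)

open Classical in
/-- The cost: the positive part of `h` on `Γ_0 ∪ Γ_1 ∪ Γ_τ`, and `∞` elsewhere. -/
def cost (α : ℝ) (τ : I → ℤ) (x y : I) : ℝ≥0∞ :=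
  if (x, y) ∈ graph α (fun _ => 0) ∪ graph α (fun _ => 1) ∪ graph α τ then
    (h α x y).toENNReal
  else ⊤

/-- The reference plan `π = (π_0 + π_1 + π_τ) / 3`. -/
def refPlan (α : ℝ) (τ : I → ℤ) : Measure (I × I) :=
  (3 : ℝ≥0∞)⁻¹ • (plan α (fun _ => 0) + plan α (fun _ => 1) + plan α τ)

end SingularDual

end

/-! At order n the rotation by `angle`, the sum of the 1 / `den n`, is compared with the rational
rotation by `num n` / `den n`. For the latter the sign function is the coboundary of an integer
potential `pot n`. Off the thin margins `bad n`, the quantity ϱ_k(x) - 1 is therefore the drop of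
`pot n` from x to x ⊕ kα for all 0 ≤ k ≤ 2 `den n`. The denominators grow so fast that the measure
of the margins beats the bound 2 ^ n of the potentials. Inside a piece l of order n, the next
potential runs uniformly through the values `pot n l - pot n j`. Hence `pot n` has a centred
binomial law with 2 ^ (n + 1) trials: symmetric, unimodal, with atoms of size at most 2 ^ (-n/2).

The map T^(τ) is a limit of permutations of pieces that starts with the translation by 1/2. Of the
four initial pieces, this loses potential 2 on piece 0, gains 2 on piece 2 and changes nothing
elsewhere. The gain on piece 2 is removed by refinement. In a residual piece, where the potential is
negative, the refined values are distributed symmetrically about a negative number, so each positive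
value w can be matched with a value -w (`exists_piece_matching`). The matching followed by the half
turn preserves the potential. The unmatched pieces keep the half turn and carry the whole sum of the
potential, but the largest atom controls their number, so their measure tends to zero
(`tendsto_card_residual`). In the limit ϱ_τ - 1 is 2 on piece 0 and 0 elsewhere, up to small margin
errors, so its integral is positive, although φ - φ ∘ T^(τ) has integral zero for every bounded
measurable φ. The compensating negative mass sits on the vanishing residual sets and becomes the
singular part. Since its sign is negative, it does not spoil admissibility: φ_n ⊕ (1 - φ_n), with
φ_n the potential of order n, exceeds the cost only by an amount tending to 0 in L¹.

A weak-star cluster point of the corrected functions is a dual optimizer. For an arbitrary optimizer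
ξ consider ξ - h. On Γ_0 and Γ_1, where c = h, the bound ξ ≤ c and the prescribed total force it to
vanish. A point of Γ_τ with τ = k is an alternating sum of points of Γ_1 and Γ_0 along an orbit, and
both ξ and h respect this identity, so ξ - h vanishes on {τ = k} for every k. It is thus carried by
{τ > K} for every K, hence purely singular, and its mass is determined by ⟨ξ, π_τ⟩ = 1. -/

noncomputable section

namespace SingularDual

/-! ### The rational approximations and their potentials -/

/-- The denominator of the `n`-th rational approximation. -/
def den (n : ℕ) : ℤ := 4 ^ 8 ^ n

/-- The quotient of two consecutive denominators. -/
def ratio (n : ℕ) : ℤ := den n ^ 7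

/-- The numerator of the `n`-th rational approximation. -/
def num : ℕ → ℤ
  | 0 => 1
  | n + 1 => num n * ratio n + 1

/-- The sign of the piece with index `l` modulo `den n`: positive on the first half. -/
def sgn (n : ℕ) (l : ℤ) : ℤ := if l % den n < den n / 2 then 1 else -1

/-- The potential whose coboundary under the `n`-th rational rotation is `sgn n`. -/
def pot : ℕ → ℤ → ℤ
  | 0 => fun l => if l % 4 = 0 then 1 else if l % 4 = 2 then -1 else 0
  | n + 1 => fun i => pot n (i / ratio n) - pot n (i / ratio n - num n * i)

lemma den_pos (n : ℕ) : 0 < den n := by unfold den; positivity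

lemma ratio_pos (n : ℕ) : 0 < ratio n := pow_pos (den_pos n) 7

lemma den_succ (n : ℕ) : den (n + 1) = den n * ratio n := by
  unfold den ratio den
  rw [← pow_succ', ← pow_mul]
  congr 1

lemma den_zero : den 0 = 4 := rfl

lemma four_dvd_den (n : ℕ) : 4 ∣ den n := dvd_pow_self _ (by positivity)

lemma four_le_den (n : ℕ) : 4 ≤ den n := Int.le_of_dvd (den_pos n) (four_dvd_den n)

lemma den_dvd_ratio (n : ℕ) : den n ∣ ratio n := dvd_pow_self _ (by norm_num)

lemma two_mul_half_den (n : ℕ) : 2 * (den n / 2) = den n := by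
  have := four_dvd_den n
  omega

/-- `num (n + 1)` is 1 modulo `ratio n`, hence prime to `ratio n` and to its divisor `den n`. -/
lemma num_coprime (n : ℕ) : IsCoprime (num n) (den n) := by
  induction n with
  | zero => exact isCoprime_one_left
  | succ n _ =>
    have h : IsCoprime (num n * ratio n + 1) (ratio n) :=
      ⟨1, -num n, by ring⟩
    rw [den_succ]
    exact (h.of_isCoprime_of_dvd_right (den_dvd_ratio n)).mul_right h

/-- By induction: adding a multiple of `den (n + 1)` to the argument changes both arguments of `pot
n` in the recursion by multiples of `den n`. -/
lemma pot_congr (n : ℕ) {a b : ℤ} (hab : den n ∣ a - b) : pot n a = pot n b := by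
  induction n generalizing a b with
  | zero =>
    have : a % 4 = b % 4 := by rw [den_zero] at hab; omega
    simp [pot, this]
  | succ n ih =>
    obtain ⟨c, hc⟩ := hab
    have ha : a = b + ratio n * (den n * c) := by rw [den_succ] at hc; linarith
    have hm := (ratio_pos n).ne'
    have h1 : a / ratio n = b / ratio n + den n * c := by
      rw [ha, Int.add_mul_ediv_left _ _ hm]
    simp only [pot]
    rw [ih (a := a / ratio n) (b := b / ratio n) ⟨c, by rw [h1]; ring⟩,
      ih (a := a / ratio n - num n * a) (b := b / ratio n - num n * b)
        ⟨c - num n * ratio n * c, by rw [h1, ha]; ring⟩]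

lemma pot_emod (n : ℕ) (a : ℤ) : pot n (a % den n) = pot n a :=
  pot_congr n Int.dvd_emod_sub_self

lemma piece_div (n : ℕ) (l : ℤ) {a : ℤ} (h0 : 0 ≤ a) (h1 : a < ratio n) :
    (l * ratio n + a) / ratio n = l := by
  rw [add_comm, Int.add_mul_ediv_right _ _ (ratio_pos n).ne', Int.ediv_eq_zero_of_lt h0 h1,
    zero_add]

lemma piece_mod (n : ℕ) (l : ℤ) {a : ℤ} (h0 : 0 ≤ a) (h1 : a < ratio n) :
    (l * ratio n + a) % ratio n = a := by
  rw [add_comm, Int.add_mul_emod_self_right, Int.emod_eq_of_lt h0 h1]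

lemma exists_piece (n : ℕ) (i : ℤ) :
    ∃ l a, 0 ≤ a ∧ a < ratio n ∧ i = l * ratio n + a :=
  ⟨i / ratio n, i % ratio n, Int.emod_nonneg _ (ratio_pos n).ne',
    Int.emod_lt_of_pos _ (ratio_pos n), by rw [mul_comm]; exact (Int.mul_ediv_add_emod _ _).symm⟩

/-- The recursion in piece coordinates; the contribution of `l * ratio n` to the second argument
drops out because `den n` divides `ratio n`. -/
lemma pot_piece (n : ℕ) (l : ℤ) {a : ℤ} (h0 : 0 ≤ a) (h1 : a < ratio n) :
    pot (n + 1) (l * ratio n + a) = pot n l - pot n (l - num n * a) := by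
  simp only [pot]
  rw [piece_div n l h0 h1]
  congr 1
  obtain ⟨c, hc⟩ := den_dvd_ratio n
  exact pot_congr n ⟨-(num n * l * c), by rw [hc]; ring⟩

lemma piece_emod_den (n : ℕ) (l : ℤ) {a : ℤ} (h0 : 0 ≤ a) (h1 : a < ratio n) :
    (l * ratio n + a) % den (n + 1) = (l % den n) * ratio n + a := by
  have hl := Int.emod_add_mul_ediv l (den n)
  have hr0 := Int.emod_nonneg l (den_pos n).ne'
  have hr1 := Int.emod_lt_of_pos l (den_pos n)
  set r := l % den n
  set c := l / den n
  have : l * ratio n + a = (r * ratio n + a) + den (n + 1) * c := by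
    rw [den_succ, ← hl]; ring
  rw [this, Int.add_mul_emod_self_left, Int.emod_eq_of_lt]
  · have := mul_nonneg hr0 (ratio_pos n).le
    linarith
  · rw [den_succ]
    nlinarith [ratio_pos n]

lemma half_den_succ (n : ℕ) : den (n + 1) / 2 = den n / 2 * ratio n := by
  have h := two_mul_half_den n
  rw [den_succ]
  apply Int.ediv_eq_of_eq_mul_right (by norm_num)
  rw [← mul_assoc, h]

lemma sgn_piece (n : ℕ) (l : ℤ) {a : ℤ} (h0 : 0 ≤ a) (h1 : a < ratio n) :
    sgn (n + 1) (l * ratio n + a) = sgn n l := by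
  unfold sgn
  rw [piece_emod_den n l h0 h1, half_den_succ]
  have hm := ratio_pos n
  have : (l % den n * ratio n + a < den n / 2 * ratio n) ↔ l % den n < den n / 2 := by
    constructor
    · intro h
      by_contra! h'
      nlinarith [mul_le_mul_of_nonneg_right h' hm.le]
    · intro h
      have h' : l % den n + 1 ≤ den n / 2 := h
      nlinarith [mul_le_mul_of_nonneg_right h' hm.le]
  simp only [this]

/-- A step of the rotation of order n + 1 moves by `num n` pieces and one subpiece. This leaves the
second argument `l - num n * a` fixed, so only the first term of the recursion changes, and it does
so by the coboundary of order n. -/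
lemma pot_sub_pot_add_num (n : ℕ) (l : ℤ) : pot n l - pot n (l + num n) = sgn n l := by
  induction n generalizing l with
  | zero =>
    simp only [pot, num, sgn, den_zero]
    have h : l % 4 = 0 ∨ l % 4 = 1 ∨ l % 4 = 2 ∨ l % 4 = 3 := by omega
    rcases h with h | h | h | h
    · have : (l + 1) % 4 = 1 := by omega
      simp [h, this]
    · have : (l + 1) % 4 = 2 := by omega
      simp [h, this]
    · have : (l + 1) % 4 = 3 := by omega
      simp [h, this]
    · have : (l + 1) % 4 = 0 := by omega
      simp [h, this]
  | succ n ih =>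
    obtain ⟨l, a, h0, h1, rfl⟩ := exists_piece n l
    rw [sgn_piece n l h0 h1, pot_piece n l h0 h1, num]
    obtain ⟨c, hc⟩ := den_dvd_ratio n
    rcases lt_or_ge (a + 1) (ratio n) with h | h
    · have e : l * ratio n + a + (num n * ratio n + 1)
        = (l + num n) * ratio n + (a + 1) := by ring
      rw [e, pot_piece n _ (by linarith) h, ← ih l,
        show l + num n - num n * (a + 1) = l - num n * a by ring]
      ring
    · have ha : a = ratio n - 1 := by omega
      have e : l * ratio n + a + (num n * ratio n + 1)
        = (l + num n + 1) * ratio n + 0 := by rw [ha]; ring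
      rw [e, pot_piece n _ le_rfl (ratio_pos n), mul_zero, sub_zero, sub_self, sub_zero,
        ← ih l, pot_congr n (a := l - num n * a) (b := l + num n)]
      exact ⟨-(num n * c), by rw [ha, hc]; ring⟩

/-- Both arguments in the recursion are shifted by half a period. This antisymmetry makes the law of
the potential symmetric, and it lets a half turn undo the sign change of the matching. -/
lemma pot_add_half (n : ℕ) (l : ℤ) : pot n (l + den n / 2) = -pot n l := by
  induction n generalizing l with
  | zero =>
    simp only [pot, den_zero]
    split_ifs <;> omega
  | succ n ih =>
    obtain ⟨l, a, h0, h1, rfl⟩ := exists_piece n l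
    rw [half_den_succ, show l * ratio n + a + den n / 2 * ratio n
        = (l + den n / 2) * ratio n + a by ring, pot_piece n _ h0 h1, pot_piece n _ h0 h1,
      show l + den n / 2 - num n * a = l - num n * a + den n / 2 by ring, ih, ih]
    ring

lemma abs_pot_le (n : ℕ) (l : ℤ) : |pot n l| ≤ 2 ^ n := by
  induction n generalizing l with
  | zero =>
    simp only [pot]
    split_ifs <;> simp
  | succ n ih =>
    simp only [pot]
    have h1 := ih (l / ratio n)
    have h2 := ih (l / ratio n - num n * l)
    rw [pow_succ]
    exact (abs_sub _ _).trans (by linarith)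

/-! ### The distribution of the potentials -/

lemma image_affine_emod (n : ℕ) (l : ℤ) :
    (Finset.Ico 0 (den n)).image (fun a => (l - num n * a) % den n) = Finset.Ico 0 (den n) := by
  apply Finset.eq_of_subset_of_card_le
  · intro x hx
    obtain ⟨a, -, rfl⟩ := Finset.mem_image.1 hx
    exact Finset.mem_Ico.2 ⟨Int.emod_nonneg _ (den_pos n).ne', Int.emod_lt_of_pos _ (den_pos n)⟩
  · rw [Finset.card_image_of_injOn]
    intro a ha b hb hab
    simp only [Finset.coe_Ico, Set.mem_Ico] at ha hb
    have h : den n ∣ num n * (b - a) := by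
      have := Int.ModEq.dvd (show _ ≡ _ [ZMOD den n] from hab.symm)
      rwa [show l - num n * a - (l - num n * b) = num n * (b - a) by ring] at this
    have h2 : den n ∣ b - a := (num_coprime n).symm.dvd_of_dvd_mul_left h
    have := Int.eq_zero_of_abs_lt_dvd h2 (by rw [abs_lt]; constructor <;> linarith)
    linarith

lemma sum_affine {M : Type*} [AddCommMonoid M] (n : ℕ) (l : ℤ) (F : ℤ → M)
    (hF : ∀ a b, den n ∣ a - b → F a = F b) :
    ∑ a ∈ Finset.Ico 0 (den n), F (l - num n * a) = ∑ j ∈ Finset.Ico 0 (den n), F j := by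
  conv_rhs => rw [← image_affine_emod n l]
  rw [Finset.sum_image]
  · exact Finset.sum_congr rfl fun a _ => (hF _ _ Int.dvd_emod_sub_self).symm
  · rw [← Finset.card_image_iff, image_affine_emod]

lemma sum_periodic {M : Type*} [AddCommMonoid M] {q : ℤ} (hq : 0 < q) (F : ℤ → M)
    (hF : ∀ a, F (a + q) = F a) (r : ℕ) :
    ∑ a ∈ Finset.Ico 0 (q * r), F a = r • ∑ a ∈ Finset.Ico 0 q, F a := by
  have hF' : ∀ (k : ℕ) a, F (a + q * k) = F a := by
    intro k
    induction k with
    | zero => simp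
    | succ k ih => intro a; rw [← ih a, ← hF (a + q * k)]; congr 1; push_cast; ring
  induction r with
  | zero => simp
  | succ r ih =>
    have h0 : 0 ≤ q * r := by positivity
    rw [add_smul, one_smul, ← ih, Nat.cast_succ, mul_add, mul_one,
      ← Finset.Ico_union_Ico_eq_Ico h0 (by linarith : q * (r : ℤ) ≤ q * r + q),
      Finset.sum_union (Finset.Ico_disjoint_Ico_consecutive _ _ _)]
    congr 1
    have h : Finset.Ico (q * (r : ℤ)) (q * r + q)
        = (Finset.Ico 0 q).image (fun x => x + q * (r : ℤ)) := by
      rw [Finset.image_add_right_Ico]; congr 1 <;> ring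
    rw [h, Finset.sum_image (fun a _ b _ hab => by simpa using hab)]
    exact Finset.sum_congr rfl fun a _ => hF' r a

lemma sum_pieces {M : Type*} [AddCommMonoid M] (n : ℕ) (F : ℤ → M) :
    ∑ i ∈ Finset.Ico 0 (den (n + 1)), F i
      = ∑ l ∈ Finset.Ico 0 (den n), ∑ a ∈ Finset.Ico 0 (ratio n), F (l * ratio n + a) := by
  have hm := ratio_pos n
  rw [← Finset.sum_product']
  refine Finset.sum_nbij' (fun i => (i / ratio n, i % ratio n))
    (fun x => x.1 * ratio n + x.2) ?_ ?_ ?_ ?_ ?_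
  · intro i hi
    rw [Finset.mem_Ico, den_succ] at hi
    simp only [Finset.mem_product, Finset.mem_Ico]
    exact ⟨⟨Int.ediv_nonneg hi.1 hm.le, Int.ediv_lt_of_lt_mul hm hi.2⟩,
      Int.emod_nonneg _ hm.ne', Int.emod_lt_of_pos _ hm⟩
  · rintro ⟨l, a⟩ h
    simp only [Finset.mem_product, Finset.mem_Ico] at h ⊢
    rw [den_succ]
    constructor <;> nlinarith
  · intro i _
    simp only
    rw [mul_comm]
    exact Int.mul_ediv_add_emod _ _
  · rintro ⟨l, a⟩ h
    simp only [Finset.mem_product, Finset.mem_Ico] at h ⊢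
    rw [piece_div n l h.2.1 h.2.2, piece_mod n l h.2.1 h.2.2]
  · intro i _
    congr 1
    rw [mul_comm]
    exact (Int.mul_ediv_add_emod _ _).symm

/-- The number of full periods of length `den n` in `ratio n`. -/
def mult (n : ℕ) : ℕ := (4 ^ 8 ^ n) ^ 6

lemma ratio_eq (n : ℕ) : ratio n = den n * mult n := by
  unfold ratio den mult
  push_cast
  ring

/-- A piece has `mult n` full periods, and over each period `l - num n * a` meets every residue once
because `num n` is a unit modulo `den n`. So the law of the new potential within a piece is a
shifted copy of the reflected old law. -/
lemma sum_pot_piece {M : Type*} [AddCommMonoid M] (n : ℕ) (l : ℤ) (F : ℤ → M) :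
    ∑ a ∈ Finset.Ico 0 (ratio n), F (pot (n + 1) (l * ratio n + a))
      = mult n • ∑ j ∈ Finset.Ico 0 (den n), F (pot n l - pot n j) := by
  have h1 : ∑ a ∈ Finset.Ico 0 (ratio n), F (pot (n + 1) (l * ratio n + a))
      = ∑ a ∈ Finset.Ico 0 (ratio n), F (pot n l - pot n (l - num n * a)) := by
    refine Finset.sum_congr rfl fun a ha => ?_
    rw [Finset.mem_Ico] at ha
    rw [pot_piece n l ha.1 ha.2]
  rw [h1, ratio_eq, sum_periodic (den_pos n)]
  · congr 1
    exact sum_affine n l (fun j => F (pot n l - pot n j))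
      fun a b hab => by rw [pot_congr n hab]
  · intro a
    rw [pot_congr n (a := l - num n * (a + den n)) (b := l - num n * a)]
    exact ⟨-num n, by ring⟩

lemma sum_neg_pot {M : Type*} [AddCommMonoid M] (n : ℕ) (F : ℤ → M) :
    ∑ j ∈ Finset.Ico 0 (den n), F (-pot n j) = ∑ j ∈ Finset.Ico 0 (den n), F (pot n j) := by
  have h := two_mul_half_den n
  have h4 := four_le_den n
  refine Finset.sum_nbij' (fun j => (j + den n / 2) % den n) (fun j => (j + den n / 2) % den n)
    ?_ ?_ ?_ ?_ ?_
  · intro j _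
    exact Finset.mem_Ico.2 ⟨Int.emod_nonneg _ (den_pos n).ne', Int.emod_lt_of_pos _ (den_pos n)⟩
  · intro j _
    exact Finset.mem_Ico.2 ⟨Int.emod_nonneg _ (den_pos n).ne', Int.emod_lt_of_pos _ (den_pos n)⟩
  · intro j hj
    rw [Finset.mem_Ico] at hj
    rw [Int.emod_add_emod, add_assoc, ← two_mul, h, Int.add_emod_right,
      Int.emod_eq_of_lt hj.1 hj.2]
  · intro j hj
    rw [Finset.mem_Ico] at hj
    rw [Int.emod_add_emod, add_assoc, ← two_mul, h, Int.add_emod_right,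
      Int.emod_eq_of_lt hj.1 hj.2]
  · intro j _
    rw [pot_emod, pot_add_half]

open Polynomial in
/-- The generating polynomial of the potential is a multiple of a power of `1 + X`. -/
lemma exists_genPoly (n : ℕ) : ∃ c : ℕ, c * 2 ^ 2 ^ (n + 1) = den n ∧
    ∑ j ∈ Finset.Ico 0 (den n), (X : ℕ[X]) ^ (pot n j + 2 ^ n).toNat
      = c • (1 + X) ^ 2 ^ (n + 1) := by
  induction n with
  | zero =>
    refine ⟨1, by simp [den_zero], ?_⟩
    rw [den_zero, show Finset.Ico (0 : ℤ) 4 = {0, 1, 2, 3} by rfl]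
    simp [pot]
    ring
  | succ n ih =>
    obtain ⟨c, hc, ih⟩ := ih
    refine ⟨mult n * c ^ 2, ?_, ?_⟩
    · rw [den_succ, ratio_eq, pow_succ 2 (n + 1), pow_mul, ← hc]
      push_cast
      ring
    · rw [sum_pieces]
      -- The exponent splits into two nonnegative ones, so the double sum factorises. By symmetry
      -- both factors are the old generating polynomial, which is thereby squared.
      have h : ∀ l j, (X : ℕ[X]) ^ (pot n l - pot n j + 2 ^ (n + 1)).toNat
          = X ^ (pot n l + 2 ^ n).toNat * X ^ (-pot n j + 2 ^ n).toNat := by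
        intro l j
        have h1 := abs_le.1 (abs_pot_le n l)
        have h2 := abs_le.1 (abs_pot_le n j)
        rw [← pow_add, ← Int.toNat_add (by linarith) (by linarith)]
        congr 2
        ring
      rw [Finset.sum_congr rfl fun l _ => sum_pot_piece n l
        (fun v => (X : ℕ[X]) ^ (v + 2 ^ (n + 1)).toNat)]
      simp_rw [h, ← Finset.mul_sum]
      rw [sum_neg_pot n (fun v => (X : ℕ[X]) ^ (v + 2 ^ n).toNat), ih, ← Finset.smul_sum,
        ← Finset.sum_mul, ih, pow_succ 2 (n + 1), pow_mul, smul_mul_smul_comm, smul_smul, sq, sq]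

/-- The number of pieces on which the potential takes the value `v`. -/
def level (n : ℕ) (v : ℤ) : ℕ := ((Finset.Ico 0 (den n)).filter fun j => pot n j = v).card

lemma level_neg (n : ℕ) (v : ℤ) : level n (-v) = level n v := by
  have := sum_neg_pot n (fun u => if u = v then 1 else 0)
  unfold level
  rw [Finset.card_filter, Finset.card_filter, ← this]
  simp_rw [neg_eq_iff_eq_neg]

lemma choose_antitone_right (M : ℕ) {i j : ℕ} (hij : i ≤ j) :
    (2 * M).choose (M + j) ≤ (2 * M).choose (M + i) := by
  induction j, hij using Nat.le_induction with
  | base => exact le_rfl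
  | succ j _ ih =>
    refine le_trans ?_ ih
    rcases lt_or_ge j M with h | h
    · rw [← Nat.choose_symm (by omega : M + (j + 1) ≤ 2 * M),
        ← Nat.choose_symm (by omega : M + j ≤ 2 * M),
        show 2 * M - (M + j) = 2 * M - (M + (j + 1)) + 1 by omega]
      exact Nat.choose_le_succ_of_lt_half_left (by omega)
    · rw [Nat.choose_eq_zero_of_lt (by omega)]
      exact Nat.zero_le _

lemma exists_level_eq (n : ℕ) : ∃ c : ℕ, c * 4 ^ 2 ^ n = den n ∧
    ∀ v : ℕ, level n v = c * (2 * 2 ^ n).choose (2 ^ n + v) := by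
  obtain ⟨c, hc, h⟩ := exists_genPoly n
  refine ⟨c, ?_, fun v => ?_⟩
  · rw [← hc, pow_succ 2 n, mul_comm (2 ^ n) 2, pow_mul]; norm_num
  · have := congrArg (fun P => Polynomial.coeff P (2 ^ n + v)) h
    simp only [Polynomial.finsetSum_coeff, Polynomial.coeff_X_pow, Polynomial.coeff_smul,
      smul_eq_mul, Polynomial.coeff_one_add_X_pow, Nat.cast_id] at this
    rw [pow_succ, mul_comm (2 ^ n) 2] at this
    rw [← this, level, Finset.card_filter]
    refine Finset.sum_congr rfl fun j _ => ?_
    have h1 := abs_le.1 (abs_pot_le n j)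
    have h2 : ((2 ^ n : ℕ) : ℤ) = 2 ^ n := by push_cast; rfl
    congr 1
    rw [eq_iff_iff]
    omega

/-- Symmetry reduces this to nonnegative values, where the counts are multiples of binomial
coefficients right of the centre. This unimodality makes the matching possible. -/
lemma level_le_of_abs_le (n : ℕ) {u v : ℤ} (h : |u| ≤ |v|) : level n v ≤ level n u := by
  have hl : ∀ v, level n v = level n (v.natAbs : ℤ) := by
    intro v
    rcases Int.natAbs_eq v with h | h
    · rw [← h]
    · conv_lhs => rw [h, level_neg]
  obtain ⟨c, -, hc⟩ := exists_level_eq n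
  rw [Int.abs_eq_natAbs, Int.abs_eq_natAbs] at h
  rw [hl u, hl v, hc, hc]
  exact Nat.mul_le_mul_left _ (choose_antitone_right _ (by omega))

/-- The factor `2 * k + 1` makes the induction close, by (2k + 1)(2k + 3) ≤ 4(k + 1)². -/
lemma centralBinom_sq_le (k : ℕ) : k.centralBinom ^ 2 * (2 * k + 1) ≤ 16 ^ k := by
  induction k with
  | zero => simp
  | succ k ih =>
    have h := Nat.succ_mul_centralBinom_succ k
    have h2 : (k + 1) ^ 2 * ((k + 1).centralBinom ^ 2 * (2 * (k + 1) + 1))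
        ≤ (k + 1) ^ 2 * 16 ^ (k + 1) := by
      calc (k + 1) ^ 2 * ((k + 1).centralBinom ^ 2 * (2 * (k + 1) + 1))
          = ((k + 1) * (k + 1).centralBinom) ^ 2 * (2 * k + 3) := by ring
        _ = 4 * (2 * k + 1) * (2 * k + 3) * (k.centralBinom ^ 2 * (2 * k + 1)) := by
            rw [h]; ring
        _ ≤ 4 * (2 * k + 1) * (2 * k + 3) * 16 ^ k := Nat.mul_le_mul_left _ ih
        _ ≤ (16 * (k + 1) ^ 2) * 16 ^ k := Nat.mul_le_mul_right _ (by nlinarith)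
        _ = (k + 1) ^ 2 * 16 ^ (k + 1) := by ring
    exact Nat.le_of_mul_le_mul_left h2 (by positivity)

/-- The largest atom of the law is at most 2 ^ (-n/2); this decay makes the residual sets
negligible. -/
lemma level_zero_sq_le (n : ℕ) : (level n 0 : ℝ) ^ 2 * 2 ^ n ≤ (den n : ℝ) ^ 2 := by
  obtain ⟨c, hc, h⟩ := exists_level_eq n
  have h0 := h 0
  have h1 := centralBinom_sq_le (2 ^ n)
  rw [Nat.centralBinom] at h1
  have h2 : level n 0 ^ 2 * 2 ^ n ≤ (c * 4 ^ 2 ^ n) ^ 2 := by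
    rw [Nat.cast_zero, add_zero] at h0
    rw [h0, mul_pow, mul_pow, ← pow_mul, mul_comm (2 ^ n) 2, pow_mul, mul_assoc]
    refine Nat.mul_le_mul_left _ ?_
    calc _ ≤ (2 * 2 ^ n).choose (2 ^ n) ^ 2 * (2 * 2 ^ n + 1) := 
          Nat.mul_le_mul_left _ (by omega)
      _ ≤ _ := by simpa using h1
  rw [← hc]
  exact_mod_cast h2

/-! ### Matching opposite values -/

/-- If every positive value `w` of `v` is taken at most as often as `-w`, then the positive values
can be matched with opposite negative ones; the unmatched points carry negative values. -/
lemma exists_matching (S : Finset ℤ) (v : ℤ → ℤ)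
    (hv : ∀ w > 0, (S.filter fun a => v a = w).card ≤ (S.filter fun a => v a = -w).card) :
    ∃ (R : Finset ℤ) (f : ℤ → ℤ), R ⊆ S ∧ (∀ a ∈ S, f a ∈ S) ∧ Set.InjOn f S ∧
      (∀ a ∈ R, v a < 0 ∧ f a = a) ∧ (∀ a ∈ S, a ∉ R → v (f a) = -v a) ∧
      ∑ a ∈ R, v a = ∑ a ∈ S, v a ∧
      R.card + (S.filter fun a => 0 < v a).card = (S.filter fun a => v a < 0).card := by
  classical
  have he : ∀ w, ∃ e : ℤ → ℤ, 0 < w →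
      (∀ a ∈ S, v a = w → e a ∈ S ∧ v (e a) = -w) ∧
      ∀ a ∈ S, v a = w → ∀ b ∈ S, v b = w → e a = e b → a = b := by
    intro w
    by_cases hw : 0 < w
    · obtain ⟨g⟩ := Function.Embedding.nonempty_of_card_le
        (α := S.filter fun a => v a = w) (β := S.filter fun a => v a = -w)
        (by simpa using hv w hw)
      refine ⟨fun a => if h : a ∈ S.filter fun a => v a = w then g ⟨a, h⟩ else 0,
        fun _ => ⟨fun a ha hva => ?_, fun a ha hva b hb hvb hab => ?_⟩⟩
      · have h : a ∈ S.filter fun a => v a = w := Finset.mem_filter.2 ⟨ha, hva⟩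
        simp only [h, dif_pos]
        exact Finset.mem_filter.1 (g ⟨a, h⟩).2
      · have h : a ∈ S.filter fun a => v a = w := Finset.mem_filter.2 ⟨ha, hva⟩
        have h' : b ∈ S.filter fun a => v a = w := Finset.mem_filter.2 ⟨hb, hvb⟩
        simp only [h, h', dif_pos] at hab
        simpa using g.injective (Subtype.ext hab)
    · exact ⟨id, fun h => absurd h hw⟩
  choose e he using he
  set P := S.filter fun a => 0 < v a with hP
  set j : ℤ → ℤ := fun a => e (v a) a with hj
  have hPm : ∀ a, a ∈ P ↔ a ∈ S ∧ 0 < v a := fun a => Finset.mem_filter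
  have hjS : ∀ a ∈ P, j a ∈ S ∧ v (j a) = -v a := fun a ha =>
    (he (v a) ((hPm a).1 ha).2).1 a ((hPm a).1 ha).1 rfl
  have hji : Set.InjOn j P := by
    intro a ha b hb hab
    have h1 := (hjS a ha).2
    have h2 := (hjS b hb).2
    have h3 : v b = v a := by rw [hab] at h1; linarith
    refine (he (v a) ((hPm a).1 ha).2).2 a ((hPm a).1 ha).1 rfl b ((hPm b).1 hb).1 h3 ?_
    simp only [hj] at hab
    rw [hab, h3]
  set J := P.image j with hJ
  have hJm : ∀ a, a ∈ J ↔ ∃ b ∈ P, j b = a := fun a => Finset.mem_image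
  have hJneg : ∀ a ∈ J, a ∈ S ∧ v a < 0 := by
    intro a ha
    obtain ⟨b, hb, rfl⟩ := (hJm a).1 ha
    have := (hPm b).1 hb
    exact ⟨(hjS b hb).1, by rw [(hjS b hb).2]; linarith⟩
  -- The matching is the involution exchanging each a in P with j a in J and fixing all other
  -- points. A fixed point outside the unmatched set R carries the value 0.
  set f : ℤ → ℤ := fun a => if a ∈ P then j a else if a ∈ J then Function.invFunOn j P a else a
    with hf
  have hinv : ∀ a ∈ J, Function.invFunOn j P a ∈ P ∧ j (Function.invFunOn j P a) = a := by
    intro a ha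
    have := (hJm a).1 ha
    exact ⟨Function.invFunOn_mem this, Function.invFunOn_eq this⟩
  have hPJ : ∀ a ∈ J, a ∉ P := fun a ha h => by
    have h1 := (hJneg a ha).2
    have h2 := ((hPm a).1 h).2
    linarith
  have hfP : ∀ a ∈ P, f a = j a := fun a ha => if_pos ha
  have hfJ : ∀ a ∈ J, f a = Function.invFunOn j P a := fun a ha => by
    simp only [hf, if_neg (hPJ a ha), if_pos ha]
  have hfo : ∀ a, a ∉ P → a ∉ J → f a = a := fun a h1 h2 => by
    simp only [hf, if_neg h1, if_neg h2]
  have hff : ∀ a, f (f a) = a := by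
    intro a
    by_cases h1 : a ∈ P
    · have h2 : j a ∈ J := Finset.mem_image_of_mem _ h1
      rw [hfP a h1, hfJ _ h2]
      exact hji (hinv _ h2).1 h1 (hinv _ h2).2
    · by_cases h2 : a ∈ J
      · rw [hfJ a h2, hfP _ (hinv a h2).1, (hinv a h2).2]
      · rw [hfo a h1 h2, hfo a h1 h2]
  have hfS : ∀ a ∈ S, f a ∈ S := by
    intro a ha
    by_cases h1 : a ∈ P
    · rw [hfP a h1]; exact (hjS a h1).1
    · by_cases h2 : a ∈ J
      · rw [hfJ a h2]; exact ((hPm _).1 (hinv a h2).1).1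
      · rwa [hfo a h1 h2]
  set R := S.filter fun a => v a < 0 ∧ a ∉ J with hR
  have hRm : ∀ a, a ∈ R ↔ a ∈ S ∧ v a < 0 ∧ a ∉ J := fun a => Finset.mem_filter
  have hvf : ∀ a ∈ S, a ∉ R → v (f a) = -v a := by
    intro a ha haR
    by_cases h1 : a ∈ P
    · rw [hfP a h1]; exact (hjS a h1).2
    · by_cases h2 : a ∈ J
      · rw [hfJ a h2]
        have h3 := hjS _ (hinv a h2).1
        rw [(hinv a h2).2] at h3
        linarith [h3.2]
      · rw [hfo a h1 h2]
        have h3 : ¬ v a < 0 := fun h => haR ((hRm a).2 ⟨ha, h, h2⟩)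
        have h4 : ¬ 0 < v a := fun h => h1 ((hPm a).2 ⟨ha, h⟩)
        omega
  have hfR : ∀ a ∈ R, f a = a := by
    intro a ha
    rw [hRm] at ha
    exact hfo a (fun h => by have := ((hPm a).1 h).2; linarith [ha.2.1]) ha.2.2
  refine ⟨R, f, Finset.filter_subset _ _, hfS, ?_, fun a ha => ⟨((hRm a).1 ha).2.1, hfR a ha⟩,
    hvf, ?_, ?_⟩
  · intro a _ b _ hab
    rw [← hff a, hab, hff]
  · rw [← Finset.sum_sdiff (Finset.filter_subset _ S : R ⊆ S)]
    -- Matched points cancel in pairs, so R carries the whole sum.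
    have : ∑ a ∈ S \ R, v a = 0 := by
      refine Finset.sum_involution (fun a _ => f a) ?_ ?_ ?_ ?_
      · intro a ha
        rw [Finset.mem_sdiff] at ha
        rw [hvf a ha.1 ha.2]; ring
      · intro a ha h0 h
        rw [Finset.mem_sdiff] at ha
        have := hvf a ha.1 ha.2
        rw [h] at this
        omega
      · intro a ha
        rw [Finset.mem_sdiff] at ha ⊢
        refine ⟨hfS a ha.1, fun h => ha.2 ?_⟩
        rw [← hff a, hfR _ h]
        exact h
      · intro a _
        exact hff a
    rw [this, zero_add]
  · rw [← Finset.card_image_of_injOn hji, ← hJ, ← Finset.card_union_of_disjoint]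
    · congr 1
      ext a
      rw [Finset.mem_union, hRm, Finset.mem_filter]
      constructor
      · rintro (h | h)
        · exact ⟨h.1, h.2.1⟩
        · exact hJneg a h
      · intro h
        by_cases h2 : a ∈ J
        · exact Or.inr h2
        · exact Or.inl ⟨h.1, h.2, h2⟩
    · rw [Finset.disjoint_left]
      intro a ha
      exact ((hRm a).1 ha).2.2

/-- An injective self-map of a subset of a finite set extends to an injective self-map. -/
lemma exists_injOn_extension (S t : Finset ℤ) (ht : t ⊆ S) (f : ℤ → ℤ)
    (hf : ∀ a ∈ t, f a ∈ S) (hfi : Set.InjOn f t) :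
    ∃ g : ℤ → ℤ, (∀ a ∈ S, g a ∈ S) ∧ Set.InjOn g S ∧ ∀ a ∈ t, g a = f a := by
  classical
  obtain ⟨g, hg⟩ := Set.MapsTo.exists_equiv_extend_of_card_eq (α := S) (t := S)
    (by simp) (s := {a : S | (a : ℤ) ∈ t}) (f := fun a => f a)
    (fun a ha => hf a ha) (fun a ha b hb hab => Subtype.ext (hfi ha hb hab))
  refine ⟨fun a => if h : a ∈ S then g ⟨a, h⟩ else a, fun a ha => ?_, fun a ha b hb hab => ?_,
    fun a ha => ?_⟩
  · simp only [ha, dif_pos]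
    exact (g ⟨a, ha⟩).2
  · have ha' : a ∈ S := ha
    have hb' : b ∈ S := hb
    simp only [ha', hb', dif_pos] at hab
    simpa using g.injective (Subtype.ext hab)
  · simp only [ht ha, dif_pos]
    exact hg ⟨a, ht ha⟩ ha

/-- Every residue can be reached by a number of rotation steps from any prescribed window of length
`den n`. -/
lemma exists_steps (n : ℕ) (i j : ℤ) :
    ∃ k, 2 ≤ k ∧ k ≤ den n + 1 ∧ (i + num n * k) % den n = j % den n := by
  obtain ⟨a, b, hab⟩ := num_coprime n
  have hq := den_pos n
  -- Here a inverts `num n` modulo `den n`. Reducing after subtracting 2, then adding 2 back, puts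
  -- the number of steps into [2, `den n` + 1]; shifts of at least 2 keep Γ_τ disjoint from Γ_0 and
  -- Γ_1.
  set k := (j - i) * a - 2 with hk
  have h0 := Int.emod_nonneg k hq.ne'
  have h1 := Int.emod_lt_of_pos k hq
  refine ⟨2 + k % den n, by linarith, by linarith, ?_⟩
  apply Int.ModEq.symm
  rw [Int.modEq_iff_dvd]
  have h2 : den n ∣ k % den n - k := Int.dvd_emod_sub_self
  obtain ⟨c, hc⟩ := h2
  refine ⟨num n * c - b * (j - i), ?_⟩
  have : k % den n = k + den n * c := by linarith
  rw [this, hk]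
  linear_combination (j - i) * hab

/-! ### Permutations of the pieces and their refinement -/

/-- The pieces of order `n` are permuted by moving the piece `l` by `κ l` steps of the rational
rotation. On the residual set `U` this is the translation by one half, which increases the
potential. -/
structure IsPieceMap (n : ℕ) (κ : ℤ → ℤ) (U : Finset ℤ) : Prop where
  shift_mem : ∀ l ∈ Finset.Ico 0 (den n), 2 ≤ κ l ∧ κ l ≤ den n + 1
  inj : Set.InjOn (fun l => (l + num n * κ l) % den n) (Finset.Ico 0 (den n))
  sub : U ⊆ Finset.Ico 0 (den n)
  half : ∀ l ∈ U, (l + num n * κ l) % den n = (l + den n / 2) % den n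
  neg : ∀ l ∈ U, pot n l < 0

/-- A refinement of a piece map agrees with it away from the margins of the pieces, and outside of
its residual set it preserves the potential on the old residual pieces. -/
structure Refines (n : ℕ) (κ : ℤ → ℤ) (U : Finset ℤ) (κ' : ℤ → ℤ) (U' : Finset ℤ) : Prop where
  nested : ∀ i ∈ U', i / ratio n ∈ U
  core : ∀ i ∈ Finset.Ico 0 (den (n + 1)), i / ratio n ∉ U → i % ratio n < ratio n - 4 * den n →
    κ' i = κ (i / ratio n)
  pot_eq : ∀ i ∈ Finset.Ico 0 (den (n + 1)), i / ratio n ∈ U → i ∉ U' →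
    pot (n + 1) (i + num (n + 1) * κ' i) = pot (n + 1) i
  half : ∀ i ∈ Finset.Ico 0 (den (n + 1)), i / ratio n ∈ U → i ∉ U' →
    (i + num (n + 1) * κ' i) % den (n + 1) / ratio n = (i / ratio n + den n / 2) % den n
  sum_pot : ∑ i ∈ U', pot (n + 1) i = ratio n * ∑ l ∈ U, pot n l
  card_le : (U'.card : ℤ) ≤ mult n * level n 0 * (-2 * ∑ l ∈ U, pot n l)

lemma card_filter_pot_piece (n : ℕ) (l : ℤ) (P : ℤ → Prop) [DecidablePred P] :
    ((Finset.Ico 0 (ratio n)).filter fun a => P (pot (n + 1) (l * ratio n + a))).card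
      = mult n * ((Finset.Ico 0 (den n)).filter fun j => P (pot n l - pot n j)).card := by
  rw [Finset.card_filter, Finset.card_filter, sum_pot_piece n l (fun v => if P v then 1 else 0),
    smul_eq_mul]

lemma sum_pot_eq_zero (n : ℕ) : ∑ j ∈ Finset.Ico 0 (den n), pot n j = 0 := by
  have := sum_neg_pot n (fun v => v)
  rw [Finset.sum_neg_distrib] at this
  linarith

/-- By symmetry there are as many values below -a as above a. For a > 0 the excess consists of the
2a values in (-a, a], each taken at most as often as 0. -/
lemma card_filter_lt_le (n : ℕ) (a : ℤ) :
    ((Finset.Ico 0 (den n)).filter fun j => -a < pot n j).card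
      ≤ ((Finset.Ico 0 (den n)).filter fun j => pot n j < -a).card
        + level n 0 * (2 * a).toNat := by
  have h1 : ((Finset.Ico 0 (den n)).filter fun j => pot n j < -a).card
      = ((Finset.Ico 0 (den n)).filter fun j => a < pot n j).card := by
    have := sum_neg_pot n (fun u => if a < u then 1 else 0)
    rw [Finset.card_filter, Finset.card_filter, ← this]
    refine Finset.sum_congr rfl fun j _ => ?_
    congr 1
    rw [eq_iff_iff]
    omega
  have h2 : ((Finset.Ico 0 (den n)).filter fun j => -a < pot n j)
      ⊆ ((Finset.Ico 0 (den n)).filter fun j => a < pot n j) ∪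
        (Finset.Ioc (-a) a).biUnion fun v => (Finset.Ico 0 (den n)).filter fun j => pot n j = v := by
    intro j hj
    rw [Finset.mem_filter] at hj
    simp only [Finset.mem_union, Finset.mem_filter, Finset.mem_biUnion, Finset.mem_Ioc]
    by_cases h : a < pot n j
    · exact Or.inl ⟨hj.1, h⟩
    · exact Or.inr ⟨pot n j, ⟨hj.2, by omega⟩, hj.1, rfl⟩
  rw [h1]
  refine (Finset.card_le_card h2).trans ((Finset.card_union_le _ _).trans ?_)
  gcongr
  refine Finset.card_biUnion_le.trans ?_
  refine (Finset.sum_le_card_nsmul _ _ (level n 0) fun v _ => ?_).trans ?_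
  · exact level_le_of_abs_le n (by simp)
  · rw [Int.card_Ioc, smul_eq_mul, mul_comm, show a - -a = 2 * a by ring]

/-- The values w and -w of the refined potential come from `pot n j = pot n l - w` and `pot n l +
w`. As `pot n l` is negative, the former is farther from 0 for w > 0, so unimodality supplies the
hypothesis of `exists_matching`. The mean of `pot n` is zero, which gives the sum; the unmatched
points number the negative minus the positive values. -/
lemma exists_piece_matching (n : ℕ) (l : ℤ) (hl : pot n l < 0) :
    ∃ (R : Finset ℤ) (f : ℤ → ℤ), R ⊆ Finset.Ico 0 (ratio n) ∧
      (∀ a ∈ Finset.Ico 0 (ratio n), f a ∈ Finset.Ico 0 (ratio n)) ∧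
      Set.InjOn f (Finset.Ico 0 (ratio n)) ∧
      (∀ a ∈ R, pot (n + 1) (l * ratio n + a) < 0 ∧ f a = a) ∧
      (∀ a ∈ Finset.Ico 0 (ratio n), a ∉ R →
        pot (n + 1) (l * ratio n + f a) = -pot (n + 1) (l * ratio n + a)) ∧
      ∑ a ∈ R, pot (n + 1) (l * ratio n + a) = ratio n * pot n l ∧
      (R.card : ℤ) ≤ mult n * level n 0 * (-2 * pot n l) := by
  obtain ⟨R, f, h1, h2, h3, h4, h5, h6, h7⟩ := exists_matching (Finset.Ico 0 (ratio n))
    (fun a => pot (n + 1) (l * ratio n + a)) (by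
      intro w hw
      rw [card_filter_pot_piece n l (fun v => v = w), card_filter_pot_piece n l (fun v => v = -w)]
      refine Nat.mul_le_mul_left _ ?_
      have e1 : ∀ u, ((Finset.Ico 0 (den n)).filter fun j => pot n l - pot n j = u).card
          = level n (pot n l - u) := by
        intro u
        unfold level
        congr 1
        refine Finset.filter_congr fun j _ => ?_
        omega
      rw [e1, e1]
      refine level_le_of_abs_le n ?_
      rw [abs_of_neg (by omega : pot n l - w < 0), abs_le]
      omega)
  refine ⟨R, f, h1, h2, h3, h4, h5, ?_, ?_⟩
  · rw [h6, sum_pot_piece n l (fun v => v), Finset.sum_sub_distrib, sum_pot_eq_zero, sub_zero,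
      Finset.sum_const, Int.card_Ico, ratio_eq, nsmul_eq_mul, nsmul_eq_mul, sub_zero,
      Int.toNat_of_nonneg (den_pos n).le]
    ring
  · rw [card_filter_pot_piece n l (fun v => 0 < v), card_filter_pot_piece n l (fun v => v < 0)] at h7
    have h8 := card_filter_lt_le n (-pot n l)
    simp only [neg_neg] at h8
    have e1 : ((Finset.Ico 0 (den n)).filter fun j => pot n l - pot n j < 0)
        = (Finset.Ico 0 (den n)).filter fun j => pot n l < pot n j :=
      Finset.filter_congr fun j _ => by omega
    have e2 : ((Finset.Ico 0 (den n)).filter fun j => 0 < pot n l - pot n j)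
        = (Finset.Ico 0 (den n)).filter fun j => pot n j < pot n l :=
      Finset.filter_congr fun j _ => by omega
    rw [e1, e2] at h7
    have h9 := Nat.mul_le_mul_left (mult n) h8
    have h10 : R.card ≤ mult n * (level n 0 * (2 * -pot n l).toNat) := by
      rw [mul_add] at h9
      omega
    have h11 : ((2 * -pot n l).toNat : ℤ) = -2 * pot n l := by
      rw [Int.toNat_of_nonneg (by omega)]; ring
    calc (R.card : ℤ) ≤ ((mult n * (level n 0 * (2 * -pot n l).toNat) : ℕ) : ℤ) := by
          exact_mod_cast h10
      _ = _ := by rw [Nat.cast_mul, Nat.cast_mul, h11]; ring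

lemma sum_union_pieces (n : ℕ) (U : Finset ℤ) (hU : U ⊆ Finset.Ico 0 (den n)) (R : ℤ → Finset ℤ)
    (hR : ∀ l ∈ U, R l ⊆ Finset.Ico 0 (ratio n)) (F : ℤ → ℤ) :
    ∑ i ∈ (Finset.Ico 0 (den (n + 1))).filter
        (fun i => i / ratio n ∈ U ∧ i % ratio n ∈ R (i / ratio n)), F i
      = ∑ l ∈ U, ∑ a ∈ R l, F (l * ratio n + a) := by
  rw [Finset.sum_filter, sum_pieces, ← Finset.sum_subset hU]
  · refine Finset.sum_congr rfl fun l hl => ?_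
    rw [← Finset.sum_subset (hR l hl)]
    · refine Finset.sum_congr rfl fun a ha => ?_
      have := Finset.mem_Ico.1 (hR l hl ha)
      rw [piece_div n l this.1 this.2, piece_mod n l this.1 this.2, if_pos ⟨hl, ha⟩]
    · intro a ha haR
      have := Finset.mem_Ico.1 ha
      rw [piece_div n l this.1 this.2, piece_mod n l this.1 this.2, if_neg fun h => haR h.2]
  · intro l _ hl
    refine Finset.sum_eq_zero fun a ha => ?_
    have := Finset.mem_Ico.1 ha
    rw [piece_div n l this.1 this.2, if_neg fun h => hl h.1]

lemma div_ratio_mem (n : ℕ) {i : ℤ} (hi : i ∈ Finset.Ico 0 (den (n + 1))) :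
    i / ratio n ∈ Finset.Ico 0 (den n) := by
  rw [Finset.mem_Ico, den_succ] at hi
  exact Finset.mem_Ico.2 ⟨Int.ediv_nonneg hi.1 (ratio_pos n).le,
    Int.ediv_lt_of_lt_mul (ratio_pos n) hi.2⟩

lemma piece_mem (n : ℕ) {l a : ℤ} (hl : l ∈ Finset.Ico 0 (den n))
    (ha : a ∈ Finset.Ico 0 (ratio n)) : l * ratio n + a ∈ Finset.Ico 0 (den (n + 1)) := by
  rw [Finset.mem_Ico] at hl ha ⊢
  rw [den_succ]
  constructor <;> nlinarith

lemma emod_den_mem (n : ℕ) (l : ℤ) : l % den n ∈ Finset.Ico 0 (den n) :=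
  Finset.mem_Ico.2 ⟨Int.emod_nonneg _ (den_pos n).ne', Int.emod_lt_of_pos _ (den_pos n)⟩

/-- Subpieces outside U and away from the margins (the set C) keep the old shift. Subpieces of U
(the set D) follow the half turn composed with the matching of their piece. The remaining ones, in
the margins, only have to complete an injective map; any completion will do, realised by
`exists_steps`. -/
lemma IsPieceMap.exists_refines {n : ℕ} {κ : ℤ → ℤ} {U : Finset ℤ} (h : IsPieceMap n κ U) :
    ∃ κ' U', IsPieceMap (n + 1) κ' U' ∧ Refines n κ U κ' U' := by
  classical
  have hm := ratio_pos n
  have hq := den_pos n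
  choose! R f hRsub hfmem hfinj hfR hfneg hsum hcard using
    fun l (hl : l ∈ U) => exists_piece_matching n l (h.neg l hl)
  set U' := (Finset.Ico 0 (den (n + 1))).filter
    (fun i => i / ratio n ∈ U ∧ i % ratio n ∈ R (i / ratio n)) with hU'
  set C := (Finset.Ico 0 (den (n + 1))).filter
    (fun i => i / ratio n ∉ U ∧ i % ratio n < ratio n - 4 * den n) with hC
  set D := (Finset.Ico 0 (den (n + 1))).filter (fun i => i / ratio n ∈ U) with hD
  -- The prescribed target of a subpiece: the image of its piece under the old map, together with
  -- the new offset in that piece.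
  set F : ℤ → ℤ := fun i => (i / ratio n + num n * κ (i / ratio n)) % den n * ratio n +
    if i / ratio n ∈ U then f (i / ratio n) (i % ratio n) else i % ratio n + κ (i / ratio n)
    with hF
  have hmod : ∀ i, i % ratio n ∈ Finset.Ico 0 (ratio n) := fun i =>
    Finset.mem_Ico.2 ⟨Int.emod_nonneg _ hm.ne', Int.emod_lt_of_pos _ hm⟩
  have hoff : ∀ i ∈ C ∪ D, (if i / ratio n ∈ U then f (i / ratio n) (i % ratio n)
      else i % ratio n + κ (i / ratio n)) ∈ Finset.Ico 0 (ratio n) := by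
    intro i hi
    by_cases hiU : i / ratio n ∈ U
    · rw [if_pos hiU]
      exact hfmem _ hiU _ (hmod i)
    · rw [if_neg hiU]
      rcases Finset.mem_union.1 hi with hi | hi
      · have hi' := Finset.mem_filter.1 hi
        -- The shift is at most `den n + 1`, less than the margin `4 * den n`, so the offset does
        -- not overflow the piece.
        have h1 := h.shift_mem _ (div_ratio_mem n hi'.1)
        have h2 := Finset.mem_Ico.1 (hmod i)
        have h4 := four_le_den n
        rw [Finset.mem_Ico]
        constructor <;> linarith [hi'.2.2]
      · exact absurd (Finset.mem_filter.1 hi).2 hiU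
  have hCD : C ∪ D ⊆ Finset.Ico 0 (den (n + 1)) :=
    Finset.union_subset (Finset.filter_subset _ _) (Finset.filter_subset _ _)
  have hFdiv : ∀ i ∈ C ∪ D, F i / ratio n = (i / ratio n + num n * κ (i / ratio n)) % den n :=
    fun i hi => by
      have := Finset.mem_Ico.1 (hoff i hi)
      exact piece_div n _ this.1 this.2
  have hFmod : ∀ i ∈ C ∪ D, F i % ratio n = if i / ratio n ∈ U
      then f (i / ratio n) (i % ratio n) else i % ratio n + κ (i / ratio n) :=
    fun i hi => by
      have := Finset.mem_Ico.1 (hoff i hi)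
      exact piece_mod n _ this.1 this.2
  have hFmem : ∀ i ∈ C ∪ D, F i ∈ Finset.Ico 0 (den (n + 1)) := fun i hi =>
    piece_mem n (emod_den_mem n _) (hoff i hi)
  have hFinj : Set.InjOn F (C ∪ D : Finset ℤ) := by
    intro i hi j hj hij
    have hi : i ∈ C ∪ D := hi
    have hj : j ∈ C ∪ D := hj
    have h1 := hFdiv i hi
    rw [hij, hFdiv j hj] at h1
    have h2 : j / ratio n = i / ratio n :=
      h.inj (div_ratio_mem n (hCD hj)) (div_ratio_mem n (hCD hi)) h1
    have h3 := hFmod i hi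
    rw [hij, hFmod j hj, h2] at h3
    have h4 : j % ratio n = i % ratio n := by
      by_cases hiU : i / ratio n ∈ U
      · rw [if_pos hiU, if_pos hiU] at h3
        exact hfinj _ hiU (hmod j) (hmod i) h3
      · rw [if_neg hiU, if_neg hiU] at h3
        linarith
    rw [← Int.mul_ediv_add_emod i (ratio n), ← h2, ← h4, Int.mul_ediv_add_emod]
  obtain ⟨g, hgmem, hginj, hgF⟩ := exists_injOn_extension _ _ hCD F hFmem hFinj
  choose k hk2 hkle hkmod using fun i => exists_steps (n + 1) i (g i)
  set κ' : ℤ → ℤ := fun i => if i ∈ C then κ (i / ratio n) else k i with hκ'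
  have hκC : ∀ i ∈ C, κ' i = κ (i / ratio n) := fun i hi => if_pos hi
  have hκg : ∀ i ∈ Finset.Ico 0 (den (n + 1)), (i + num (n + 1) * κ' i) % den (n + 1) = g i := by
    intro i hi
    have hgi := Finset.mem_Ico.1 (hgmem i hi)
    by_cases hiC : i ∈ C
    · have hi' : i ∈ C ∪ D := Finset.mem_union_left _ hiC
      have hiU := (Finset.mem_filter.1 hiC).2.1
      rw [hκC i hiC, hgF i hi', num]
      have hof := hoff i hi'
      rw [if_neg hiU, Finset.mem_Ico] at hof
      have e : i + (num n * ratio n + 1) * κ (i / ratio n)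
          = (i / ratio n + num n * κ (i / ratio n)) * ratio n
            + (i % ratio n + κ (i / ratio n)) := by
        have := Int.mul_ediv_add_emod i (ratio n)
        linear_combination -this
      rw [e, piece_emod_den n _ hof.1 hof.2]
      simp only [hF, if_neg hiU]
    · simp only [hκ', if_neg hiC]
      rw [hkmod, Int.emod_eq_of_lt hgi.1 hgi.2]
  have hgD : ∀ i ∈ D, g i = (i / ratio n + den n / 2) % den n * ratio n
      + f (i / ratio n) (i % ratio n) := by
    intro i hi
    have hiU := (Finset.mem_filter.1 hi).2
    rw [hgF i (Finset.mem_union_right _ hi)]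
    simp only [hF, if_pos hiU]
    rw [h.half _ hiU]
  have hUR : ∀ i ∈ U', i ∈ D ∧ i % ratio n ∈ R (i / ratio n) := fun i hi => by
    have := Finset.mem_filter.1 hi
    exact ⟨Finset.mem_filter.2 ⟨this.1, this.2.1⟩, this.2.2⟩
  have hdm : ∀ i, i / ratio n * ratio n + i % ratio n = i := fun i => by
    rw [mul_comm]; exact Int.mul_ediv_add_emod _ _
  refine ⟨κ', U', ⟨?_, ?_, Finset.filter_subset _ _, ?_, ?_⟩, ⟨?_, ?_, ?_, ?_, ?_, ?_⟩⟩
  · intro i hi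
    by_cases hiC : i ∈ C
    · rw [hκC i hiC]
      have := h.shift_mem _ (div_ratio_mem n hi)
      have h1 : den n ≤ den (n + 1) := by
        rw [den_succ]; nlinarith
      exact ⟨this.1, by linarith⟩
    · simp only [hκ', if_neg hiC]
      exact ⟨hk2 i, hkle i⟩
  · intro i hi j hj hij
    simp only at hij
    rw [hκg i hi, hκg j hj] at hij
    exact hginj hi hj hij
  · intro i hi
    obtain ⟨hiD, hiR⟩ := hUR i hi
    have hiD' := Finset.mem_filter.1 hiD
    have hme := Finset.mem_Ico.1 (hmod i)
    rw [hκg i hiD'.1, hgD i hiD, (hfR _ hiD'.2 _ hiR).2, half_den_succ]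
    conv_rhs => rw [← hdm i]
    rw [show i / ratio n * ratio n + i % ratio n + den n / 2 * ratio n
      = (i / ratio n + den n / 2) * ratio n + i % ratio n by ring, piece_emod_den n _ hme.1 hme.2]
  · intro i hi
    obtain ⟨hiD, hiR⟩ := hUR i hi
    have := (hfR _ (Finset.mem_filter.1 hiD).2 _ hiR).1
    rwa [hdm] at this
  · intro i hi
    exact (Finset.mem_filter.1 hi).2.1
  · intro i hi hiU hlt
    exact hκC i (Finset.mem_filter.2 ⟨hi, hiU, hlt⟩)
  · intro i hi hiU hiU'
    have hiD : i ∈ D := Finset.mem_filter.2 ⟨hi, hiU⟩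
    have hiR : i % ratio n ∉ R (i / ratio n) := fun h => hiU' (Finset.mem_filter.2 ⟨hi, hiU, h⟩)
    have hfm := Finset.mem_Ico.1 (hfmem _ hiU _ (hmod i))
    -- The half turn and the matching each reverse the sign of the potential; together they preserve
    -- it.
    rw [← pot_emod, hκg i hi, hgD i hiD, ← piece_emod_den n _ hfm.1 hfm.2, pot_emod,
      show (i / ratio n + den n / 2) * ratio n + f (i / ratio n) (i % ratio n)
        = i / ratio n * ratio n + f (i / ratio n) (i % ratio n) + den n / 2 * ratio n by ring,
      ← half_den_succ, pot_add_half, hfneg _ hiU _ (hmod i) hiR, neg_neg, hdm]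
  · intro i hi hiU hiU'
    have hiD : i ∈ D := Finset.mem_filter.2 ⟨hi, hiU⟩
    have hfm := Finset.mem_Ico.1 (hfmem _ hiU _ (hmod i))
    rw [hκg i hi, hgD i hiD, piece_div n _ hfm.1 hfm.2]
  · rw [hU', sum_union_pieces n U h.sub R hRsub, Finset.mul_sum]
    exact Finset.sum_congr rfl hsum
  · have : (U'.card : ℤ) = ∑ l ∈ U, ((R l).card : ℤ) := by
      rw [Finset.card_eq_sum_ones, Nat.cast_sum, hU']
      rw [sum_union_pieces n U h.sub R hRsub]
      simp
    rw [this, Finset.mul_sum, Finset.mul_sum]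
    exact Finset.sum_le_sum hcard

/-- The translation by one half, with the pieces of negative potential as residual set. -/
lemma isPieceMap_zero : IsPieceMap 0 (fun _ => 2) {2} where
  shift_mem := by
    intro l _
    rw [den_zero]
    norm_num
  inj := by
    intro a ha b hb hab
    simp only [den_zero, Finset.coe_Ico, Set.mem_Ico, num] at ha hb hab
    omega
  sub := by
    intro l hl
    rw [Finset.mem_singleton.1 hl, den_zero]
    decide
  half := by
    intro l _
    rw [den_zero, num]
    rfl
  neg := by
    intro l hl
    rw [Finset.mem_singleton.1 hl]
    decide

/-- A refining sequence of piece maps. -/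
lemma exists_pieceMaps : ∃ (κ : ℕ → ℤ → ℤ) (U : ℕ → Finset ℤ), κ 0 = (fun _ => 2) ∧ U 0 = {2} ∧
    (∀ n, IsPieceMap n (κ n) (U n)) ∧ ∀ n, Refines n (κ n) (U n) (κ (n + 1)) (U (n + 1)) := by
  choose! κ' U' h1 h2 using fun (n : ℕ) (κ : ℤ → ℤ) (U : Finset ℤ) (h : IsPieceMap n κ U) =>
    h.exists_refines
  let s : ℕ → (ℤ → ℤ) × Finset ℤ := fun n => Nat.rec ((fun _ => 2), {2})
    (fun n p => (κ' n p.1 p.2, U' n p.1 p.2)) n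
  have hs : ∀ n, IsPieceMap n (s n).1 (s n).2 := by
    intro n
    induction n with
    | zero => exact isPieceMap_zero
    | succ n ih => exact h1 n _ _ ih
  exact ⟨fun n => (s n).1, fun n => (s n).2, rfl, rfl, hs, fun n => h2 n _ _ (hs n)⟩

/-- The residual sets of a refining sequence become negligible. -/
lemma tendsto_card_residual {κ : ℕ → ℤ → ℤ} {U : ℕ → Finset ℤ} (h0 : U 0 = {2})
    (h : ∀ n, Refines n (κ n) (U n) (κ (n + 1)) (U (n + 1))) :
    Tendsto (fun n => ((U n).card : ℝ) / den n) atTop (𝓝 0) := by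
  -- The potential summed over the residual set and divided by `den n` stays equal to -1/4: this
  -- mass does not shrink with its support.
  have hsum : ∀ n, 4 * ∑ l ∈ U n, pot n l = -den n := by
    intro n
    induction n with
    | zero => rw [h0, Finset.sum_singleton]; decide
    | succ n ih => rw [(h n).sum_pot, den_succ, mul_left_comm, ih]; ring
  rw [← tendsto_add_atTop_iff_nat 1]
  have hlim : Tendsto (fun n : ℕ => ((Real.sqrt 2)⁻¹) ^ n) atTop (𝓝 0) := by
    apply tendsto_pow_atTop_nhds_zero_of_lt_one (by positivity)
    rw [inv_lt_one_iff₀]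
    right
    rw [Real.lt_sqrt] <;> norm_num
  refine squeeze_zero (fun n => ?_) (fun n => ?_) hlim
  · have := den_pos (n + 1)
    positivity
  · have hq : (0 : ℝ) < den n := by exact_mod_cast den_pos n
    have hM : (0 : ℝ) < mult n := by
      have := ratio_pos n
      rw [ratio_eq] at this
      have := pos_of_mul_pos_right this (den_pos n).le
      exact_mod_cast this
    have h1 : (2 : ℝ) * (U (n + 1)).card ≤ mult n * level n 0 * den n := by
      have := (h n).card_le
      have h3 := hsum n
      have h2 : (2 : ℤ) * (U (n + 1)).card ≤ mult n * level n 0 * den n := by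
        calc (2 : ℤ) * (U (n + 1)).card
            ≤ 2 * (mult n * level n 0 * (-2 * ∑ l ∈ U n, pot n l)) := by linarith
          _ = -(mult n * level n 0 * (4 * ∑ l ∈ U n, pot n l)) := by ring
          _ = mult n * level n 0 * den n := by rw [h3]; ring
      exact_mod_cast h2
    have h4 : (level n 0 : ℝ) ≤ den n * (Real.sqrt 2)⁻¹ ^ n := by
      have := level_zero_sq_le n
      refine (sq_le_sq₀ (by positivity) (by positivity)).1 ?_
      rw [mul_pow, ← pow_mul, mul_comm n 2, pow_mul, inv_pow, Real.sq_sqrt (by norm_num), inv_pow,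
        ← div_eq_mul_inv, le_div_iff₀ (by positivity)]
      exact this
    rw [den_succ, ratio_eq, div_le_iff₀ (by push_cast; positivity)]
    push_cast
    have h5 := mul_le_mul_of_nonneg_left h4 (mul_pos hM hq).le
    have h6 : (0 : ℝ) ≤ (Real.sqrt 2)⁻¹ ^ n * (den n * (den n * mult n)) := by positivity
    nlinarith

/-! ### Rotations of the unit interval -/

lemma rot_val (α : ℝ) (k : ℤ) (x : I) : (rot α k x : ℝ) = Int.fract ((x : ℝ) + k * α) := rfl

lemma rot_zero (α : ℝ) (x : I) : rot α 0 x = x := by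
  apply Subtype.ext
  rw [rot_val, Int.cast_zero, zero_mul, add_zero, Int.fract_eq_self.2 x.2]

lemma rot_rot (α : ℝ) (j k : ℤ) (x : I) : rot α j (rot α k x) = rot α (j + k) x := by
  apply Subtype.ext
  rw [rot_val, rot_val, rot_val, Int.fract_eq_fract]
  refine ⟨-⌊(x : ℝ) + k * α⌋, ?_⟩
  rw [Int.fract]
  push_cast
  ring

lemma rot_neg_rot (α : ℝ) (k : ℤ) (x : I) : rot α (-k) (rot α k x) = x := by
  rw [rot_rot, neg_add_cancel, rot_zero]

lemma rot_rot_neg (α : ℝ) (k : ℤ) (x : I) : rot α k (rot α (-k) x) = x := by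
  rw [rot_rot, add_neg_cancel, rot_zero]

lemma rot_bijective (α : ℝ) (k : ℤ) : Function.Bijective (rot α k) :=
  ⟨Function.LeftInverse.injective (rot_neg_rot α k),
    Function.RightInverse.surjective (rot_rot_neg α k)⟩

lemma rot_eq_rot_iff {α : ℝ} (hα : Irrational α) {j k : ℤ} {x : I} :
    rot α j x = rot α k x ↔ j = k := by
  refine ⟨fun h => ?_, fun h => by rw [h]⟩
  have h1 := congrArg Subtype.val h
  rw [rot_val, rot_val, Int.fract_eq_fract] at h1
  obtain ⟨z, hz⟩ := h1
  by_contra hjk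
  have h2 : ((j - k : ℤ) : ℝ) * α = z := by push_cast; linarith
  exact ((hα.intCast_mul (sub_ne_zero.2 hjk)).ne_int z) h2

lemma measurable_T (α : ℝ) {τ : I → ℤ} (hτ : Measurable τ) : Measurable (T α τ) := by
  apply Measurable.subtype_mk
  exact measurable_fract.comp (measurable_subtype_coe.add
    ((measurable_from_top.comp hτ : Measurable fun x => ((τ x : ℤ) : ℝ)).mul_const α))

lemma measurable_rot (α : ℝ) (k : ℤ) : Measurable (rot α k) :=
  measurable_T α (τ := fun _ => k) measurable_const

lemma map_coe_leb : leb.map ((↑) : I → ℝ) = volume.restrict (Set.Ico 0 1) := by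
  rw [leb, (MeasurableEmbedding.subtype_coe measurableSet_Ico).map_comap, Subtype.range_coe]

lemma leb_preimage_coe {s : Set ℝ} (hs : MeasurableSet s) :
    leb ((↑) ⁻¹' s : Set I) = volume (s ∩ Set.Ico 0 1) := by
  rw [← Measure.map_apply measurable_subtype_coe hs, map_coe_leb, Measure.restrict_apply hs]

instance : IsProbabilityMeasure leb :=
  ⟨by simpa using leb_preimage_coe MeasurableSet.univ⟩

instance : StandardBorelSpace I := measurableSet_Ico.standardBorel

/-- Transferred from translation invariance on the circle: the quotient map embeds [0,1) measurably,
carries `leb` to Haar measure and intertwines the rotation with a translation. -/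
lemma measurePreserving_rot (α : ℝ) (k : ℤ) : MeasurePreserving (rot α k) leb leb := by
  refine ⟨measurable_rot α k, ?_⟩
  set p : I → UnitAddCircle := fun x => ((x : ℝ) : UnitAddCircle) with hp
  have hpm : Measurable p := AddCircle.measurable_mk'.comp measurable_subtype_coe
  have hpp : leb.map p = volume := by
    have h1 := (UnitAddCircle.measurePreserving_mk 0).map_eq
    rw [zero_add, ← restrict_Ico_eq_restrict_Ioc, ← map_coe_leb,
      Measure.map_map AddCircle.measurable_mk' measurable_subtype_coe] at h1
    exact h1
  have hpi : Function.Injective p := by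
    intro x y hxy
    have h1 := (AddCircle.coe_eq_coe_iff_of_mem_Ico (p := (1 : ℝ)) (a := 0)
      (by simp) (by simp)).1 hxy
    exact Subtype.ext h1
  have hpe : MeasurableEmbedding p := hpm.measurableEmbedding hpi
  have hcomp : p ∘ rot α k = (fun z => z + ((k * α : ℝ) : UnitAddCircle)) ∘ p := by
    funext x
    simp only [Function.comp, hp, rot_val]
    rw [← AddCircle.coe_add, Int.fract]
    rw [AddCircle.coe_sub]
    have : ((⌊(x : ℝ) + k * α⌋ : ℝ) : UnitAddCircle) = 0 := by
      rw [AddCircle.coe_eq_zero_iff]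
      exact ⟨⌊(x : ℝ) + k * α⌋, by simp⟩
    rw [this, sub_zero]
  have hmap : (leb.map (rot α k)).map p = leb.map p := by
    rw [Measure.map_map hpm (measurable_rot α k), hcomp,
      ← Measure.map_map (measurable_add_const _) hpm, hpp]
    exact (measurePreserving_add_right volume _).map_eq
  have := congrArg (fun m => Measure.comap p m) hmap
  simpa [hpe.comap_map] using this

lemma rot_image (α : ℝ) (k : ℤ) (s : Set I) : rot α k '' s = rot α (-k) ⁻¹' s :=
  congrFun (Set.image_eq_preimage_of_inverse (rot_neg_rot α k) (rot_rot_neg α k)) s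

lemma leb_rot_preimage (α : ℝ) (k : ℤ) {s : Set I} (hs : MeasurableSet s) :
    leb (rot α k ⁻¹' s) = leb s :=
  (measurePreserving_rot α k).measure_preimage hs.nullMeasurableSet

lemma T_image_eq_iUnion (α : ℝ) (τ : I → ℤ) (E : Set I) :
    T α τ '' E = ⋃ k : ℤ, rot α k '' (E ∩ τ ⁻¹' {k}) := by
  ext y
  simp only [Set.mem_image, Set.mem_iUnion, Set.mem_inter_iff, Set.mem_preimage,
    Set.mem_singleton_iff]
  constructor
  · rintro ⟨x, hx, rfl⟩
    exact ⟨τ x, x, ⟨hx, rfl⟩, rfl⟩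
  · rintro ⟨k, x, ⟨hx, rfl⟩, rfl⟩
    exact ⟨x, hx, rfl⟩

/-- The map is a rotation on each of the countably many level sets of `τ`, and injectivity makes
their images disjoint. -/
lemma leb_T_image {α : ℝ} {τ : I → ℤ} (hτ : Measurable τ) {E : Set I} (hE : MeasurableSet E)
    (hinj : Set.InjOn (T α τ) E) :
    MeasurableSet (T α τ '' E) ∧ leb (T α τ '' E) = leb E := by
  have hm : ∀ k : ℤ, MeasurableSet (E ∩ τ ⁻¹' {k}) := fun k =>
    hE.inter (hτ (measurableSet_singleton k))
  have hm' : ∀ k : ℤ, MeasurableSet (rot α k '' (E ∩ τ ⁻¹' {k})) := fun k => by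
    rw [rot_image]
    exact measurable_rot α _ (hm k)
  rw [T_image_eq_iUnion]
  refine ⟨MeasurableSet.iUnion hm', ?_⟩
  have hE' : E = ⋃ k : ℤ, E ∩ τ ⁻¹' {k} := by
    ext x
    simp
  conv_rhs => rw [hE']
  rw [measure_iUnion _ hm', measure_iUnion _ hm]
  · refine tsum_congr fun k => ?_
    rw [rot_image, leb_rot_preimage α _ (hm k)]
  · intro j k hjk
    rw [Function.onFun, Set.disjoint_left]
    rintro x ⟨-, hx⟩ ⟨-, hx'⟩
    exact hjk (hx.symm.trans hx')
  · intro j k hjk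
    rw [Function.onFun, Set.disjoint_left]
    rintro _ ⟨x, ⟨hx, hxj⟩, rfl⟩ ⟨y, ⟨hy, hyk⟩, hxy⟩
    have hxj : τ x = j := hxj
    have hyk : τ y = k := hyk
    have : T α τ y = T α τ x := by
      simp only [T, hxj, hyk]
      exact hxy
    have := hinj hy hx this
    exact hjk (by rw [← hxj, ← hyk, this])

lemma measurePreserving_T {α : ℝ} {τ : I → ℤ} (hτ : Measurable τ)
    (hbij : Function.Bijective (T α τ)) : MeasurePreserving (T α τ) leb leb := by
  refine ⟨measurable_T α hτ, Measure.ext fun s hs => ?_⟩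
  rw [Measure.map_apply (measurable_T α hτ) hs,
    ← (leb_T_image hτ (measurable_T α hτ hs) hbij.injective.injOn).2,
    Set.image_preimage_eq _ hbij.surjective]

/-- A map that is injective on a set of full measure can be modified on a null set so that it
becomes a bijection. -/
lemma exists_bijective_modification {α : ℝ} {τ₀ : I → ℤ} (hτ₀ : Measurable τ₀)
    (h2 : ∀ x, 2 ≤ τ₀ x) {A : Set I} (hA : MeasurableSet A) (hA0 : leb Aᶜ = 0)
    (hinj : Set.InjOn (T α τ₀) A) :
    ∃ τ : I → ℤ, Measurable τ ∧ (∀ x, 2 ≤ τ x) ∧ (∀ᵐ x ∂leb, τ x = τ₀ x) ∧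
      Function.Bijective (T α τ) := by
  classical
  obtain ⟨hB, hBA⟩ := leb_T_image hτ₀ hA hinj
  set B := T α τ₀ '' A with hBdef
  have hB0 : leb Bᶜ = 0 := by
    rw [measure_compl hB (measure_ne_top _ _), hBA, ← measure_compl hA (measure_ne_top _ _), hA0]
  -- The exceptional null set is saturated under the rotation. On N the map is replaced by the
  -- rotation by 2α, a bijection of N; off N the original map is already a bijection of the
  -- complement.
  set N : Set I := ⋃ j : ℤ, rot α j ⁻¹' (Aᶜ ∪ Bᶜ) with hN
  have hNm : MeasurableSet N :=
    MeasurableSet.iUnion fun j => measurable_rot α j (hA.compl.union hB.compl)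
  have hN0 : leb N = 0 := by
    refine measure_iUnion_null fun j => ?_
    rw [leb_rot_preimage α j (hA.compl.union hB.compl)]
    exact measure_union_null hA0 hB0
  have hNinv : ∀ k x, rot α k x ∈ N ↔ x ∈ N := by
    intro k x
    simp only [hN, Set.mem_iUnion, Set.mem_preimage, rot_rot]
    constructor
    · rintro ⟨j, hj⟩
      exact ⟨j + k, hj⟩
    · rintro ⟨j, hj⟩
      exact ⟨j - k, by rwa [sub_add_cancel]⟩
  have hAN : ∀ x, x ∉ N → x ∈ A ∧ x ∈ B := by
    intro x hx
    by_contra h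
    refine hx (Set.mem_iUnion.2 ⟨0, ?_⟩)
    rw [Set.mem_preimage, rot_zero]
    by_cases hxA : x ∈ A
    · exact Or.inr fun hxB => h ⟨hxA, hxB⟩
    · exact Or.inl hxA
  set τ : I → ℤ := fun x => if x ∈ N then 2 else τ₀ x with hτ
  have hτN : ∀ x ∈ N, τ x = 2 := fun x hx => if_pos hx
  have hτN' : ∀ x, x ∉ N → τ x = τ₀ x := fun x hx => if_neg hx
  refine ⟨τ, Measurable.ite hNm measurable_const hτ₀, fun x => ?_, ?_, ?_, ?_⟩
  · by_cases hx : x ∈ N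
    · rw [hτN x hx]
    · rw [hτN' x hx]; exact h2 x
  · filter_upwards [measure_eq_zero_iff_ae_notMem.1 hN0] with x hx
    exact hτN' x hx
  · intro x y hxy
    have hiff : x ∈ N ↔ y ∈ N := by
      rw [← hNinv (τ x) x, ← hNinv (τ y) y]
      exact iff_of_eq (congrArg (· ∈ N) hxy)
    by_cases hx : x ∈ N
    · simp only [T, hτN x hx, hτN y (hiff.1 hx)] at hxy
      exact (rot_bijective α 2).injective hxy
    · have hy : y ∉ N := fun h => hx (hiff.2 h)
      simp only [T, hτN' x hx, hτN' y hy] at hxy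
      exact hinj (hAN x hx).1 (hAN y hy).1 hxy
  · intro y
    by_cases hy : y ∈ N
    · obtain ⟨x, rfl⟩ := (rot_bijective α 2).surjective y
      exact ⟨x, by simp only [T, hτN x ((hNinv 2 x).1 hy)]⟩
    · obtain ⟨x, -, rfl⟩ := (hAN y hy).2
      have hx : x ∉ N := fun h => hy ((hNinv _ x).2 h)
      exact ⟨x, by simp only [T, hτN' x hx]⟩

/-! ### Birkhoff sums -/

/-- The sign function: `1` on `[0,1/2)` and `-1` on `[1/2,1)`. -/
def sign (x : I) : ℤ := if (x : ℝ) < 1 / 2 then 1 else -1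

lemma rho_eq_sum (α : ℝ) {k : ℤ} (hk : 0 ≤ k) (x : I) :
    rho α k x = 1 + ∑ i ∈ Finset.Ico 0 k, sign (rot α i x) := by
  rw [rho, if_pos hk, Finset.card_filter, Finset.card_filter, add_sub_assoc]
  push_cast
  rw [← Finset.sum_sub_distrib]
  congr 1
  refine Finset.sum_congr rfl fun i _ => ?_
  unfold sign
  split_ifs with h1 h2 <;> first | rfl | linarith

lemma measurable_sign : Measurable sign :=
  Measurable.ite (measurableSet_lt measurable_subtype_coe measurable_const)
    measurable_const measurable_const

lemma rho_zero (α : ℝ) (x : I) : rho α 0 x = 1 := by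
  rw [rho_eq_sum α le_rfl]; simp

lemma rho_one (α : ℝ) (x : I) : rho α 1 x = 1 + sign x := by
  rw [rho_eq_sum α zero_le_one, show Finset.Ico (0 : ℤ) 1 = {0} by rfl, Finset.sum_singleton,
    rot_zero]

lemma measurable_rho (α : ℝ) {k : ℤ} (hk : 0 ≤ k) : Measurable (rho α k) := by
  rw [funext (rho_eq_sum α hk)]
  exact measurable_const.add
    (Finset.measurable_sum _ fun i _ => measurable_sign.comp (measurable_rot α i))

lemma measurable_rho_comp (α : ℝ) {τ : I → ℤ} (hτ : Measurable τ) (h0 : ∀ x, 0 ≤ τ x) :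
    Measurable fun x => rho α (τ x) x := by
  have h : (fun x => rho α (τ x) x) = fun x => (fun p : ℕ × I => rho α p.1 p.2) ((τ x).toNat, x) := by
    funext x
    simp only [Int.toNat_of_nonneg (h0 x)]
  rw [h]
  have h1 : Measurable fun p : ℕ × I => rho α p.1 p.2 :=
    measurable_from_prod_countable_right fun k => measurable_rho α (Int.natCast_nonneg k)
  have h2 : Measurable fun x => ((τ x).toNat, x) :=
    ((measurable_from_top (f := Int.toNat)).comp hτ).prodMk measurable_id
  exact h1.comp h2

lemma h_rot {α : ℝ} (hα : Irrational α) (k : ℤ) (x : I) :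
    h α x (rot α k x) = ((rho α k x : ℝ) : EReal) := by
  have hk : ∃ j : ℤ, rot α k x = rot α j x := ⟨k, rfl⟩
  rw [h, dif_pos hk, ← (rot_eq_rot_iff hα).1 hk.choose_spec]

lemma integral_sign : ∫ x, (sign x : ℝ) ∂leb = 0 := by
  have h1 : ∀ x : I, (sign x : ℝ) = 2 * (((↑) : I → ℝ) ⁻¹' Set.Iio (1 / 2)).indicator 1 x - 1 := by
    intro x
    unfold sign
    by_cases h : (x : ℝ) < 1 / 2
    · rw [if_pos h, Set.indicator_of_mem (show x ∈ (((↑) : I → ℝ) ⁻¹' Set.Iio (1 / 2)) from h)]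
      norm_num
    · rw [if_neg h, Set.indicator_of_notMem (show x ∉ (((↑) : I → ℝ) ⁻¹' Set.Iio (1 / 2)) from h)]
      norm_num
  have hm : MeasurableSet (((↑) : I → ℝ) ⁻¹' Set.Iio (1 / 2)) := measurable_subtype_coe measurableSet_Iio
  simp_rw [h1]
  rw [integral_sub, integral_const_mul, integral_indicator_one hm, Measure.real,
    leb_preimage_coe measurableSet_Iio]
  · have : Set.Iio (1 / 2 : ℝ) ∩ Set.Ico 0 1 = Set.Ico 0 (1 / 2) := by
      ext x
      simp only [Set.mem_inter_iff, Set.mem_Iio, Set.mem_Ico]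
      constructor
      · rintro ⟨h1, h2, h3⟩; exact ⟨h2, h1⟩
      · rintro ⟨h1, h2⟩; exact ⟨h2, h1, by linarith⟩
    rw [this]
    simp
  · exact ((integrable_const (1 : ℝ)).indicator hm).const_mul 2
  · exact integrable_const _

/-! ### The rotation number -/

/-- The rotation number, a limit of the rationals `num n / den n`. -/
def angle : ℝ := ∑' n, 1 / (den n : ℝ)

lemma den_pos_real (n : ℕ) : (0 : ℝ) < den n := by exact_mod_cast den_pos n

lemma pow_le_den (n : ℕ) : (4 : ℤ) ^ (n + 1) ≤ den n := by
  unfold den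
  exact pow_le_pow_right₀ (by norm_num) (Nat.lt_pow_self (by norm_num))

lemma den_mul_pow_le (n i : ℕ) : (den n : ℝ) * 2 ^ i ≤ den (n + i) := by
  induction i with
  | zero => simp
  | succ i ih =>
    have h1 : den (n + i) * 2 ≤ den (n + i + 1) := by
      rw [den_succ]
      have h2 : (2 : ℤ) ≤ ratio (n + i) := by
        have := Int.le_of_dvd (ratio_pos _) (den_dvd_ratio (n + i))
        linarith [four_le_den (n + i)]
      exact mul_le_mul_of_nonneg_left h2 (den_pos _).le
    have h1' : (den (n + i) : ℝ) * 2 ≤ den (n + i + 1) := by exact_mod_cast h1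
    rw [pow_succ, ← mul_assoc, ← add_assoc]
    linarith

lemma inv_den_le (n i : ℕ) : 1 / (den (n + i) : ℝ) ≤ 1 / den n * (1 / 2) ^ i := by
  rw [one_div_pow, one_div_mul_one_div]
  exact one_div_le_one_div_of_le (by have := den_pos_real n; positivity) (den_mul_pow_le n i)

lemma summable_inv_den : Summable fun n => 1 / (den n : ℝ) := by
  refine Summable.of_nonneg_of_le (fun n => by have := den_pos_real n; positivity)
    (fun n => ?_) (summable_geometric_two.mul_left (1 / (den 0 : ℝ)))
  simpa using inv_den_le 0 n

lemma tsum_inv_den_le (n : ℕ) : ∑' i, 1 / (den (i + n) : ℝ) ≤ 2 / den n := by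
  have h : ∀ i, 1 / (den (i + n) : ℝ) ≤ 1 / den n * (1 / 2) ^ i := fun i => by
    rw [add_comm]; exact inv_den_le n i
  refine (((summable_nat_add_iff n).2 summable_inv_den).tsum_le_tsum h
    (summable_geometric_two.mul_left _)).trans ?_
  rw [tsum_mul_left, tsum_geometric_two]
  apply le_of_eq
  ring

lemma sum_inv_den (n : ℕ) :
    ∑ i ∈ Finset.range (n + 1), 1 / (den i : ℝ) = num n / den n := by
  induction n with
  | zero => simp [num]
  | succ n ih =>
    have h1 := den_pos_real n
    have h2 : (0 : ℝ) < ratio n := by exact_mod_cast ratio_pos n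
    rw [Finset.sum_range_succ, ih, den_succ, num]
    push_cast
    field_simp

lemma angle_eq (n : ℕ) :
    angle = num n / den n + ∑' i, 1 / (den (i + (n + 1)) : ℝ) := by
  rw [angle, ← sum_inv_den, summable_inv_den.sum_add_tsum_nat_add]

lemma lt_angle (n : ℕ) : (num n : ℝ) / den n < angle := by
  rw [angle_eq n]
  have : 0 < ∑' i, 1 / (den (i + (n + 1)) : ℝ) :=
    ((summable_nat_add_iff (n + 1)).2 summable_inv_den).tsum_pos
      (fun i => by have := den_pos_real (i + (n + 1)); positivity) 0
      (by have := den_pos_real (0 + (n + 1)); positivity)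
  linarith

lemma angle_le (n : ℕ) : angle ≤ num n / den n + 2 / den (n + 1) := by
  rw [angle_eq n]
  have := tsum_inv_den_le (n + 1)
  linarith

lemma angle_pos : 0 < angle := by
  have := lt_angle 0
  rw [den_zero, num] at this
  norm_num at this
  linarith

lemma angle_lt_one : angle < 1 := by
  have h1 := tsum_inv_den_le 0
  rw [den_zero] at h1
  have h2 : angle ≤ 2 / 4 := by simpa [angle] using h1
  linarith

/-- If `angle` were rational with denominator d, then d `den n` (`angle` - `num n` / `den n`) would
be a positive integer, yet it is at most 2d / `ratio n`, which is less than 1 for large n. -/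
lemma irrational_angle : Irrational angle := by
  rintro ⟨r, hr⟩
  obtain ⟨n, hn⟩ := pow_unbounded_of_one_lt (2 * (r.den : ℤ)) (by norm_num : (1 : ℤ) < 4)
  have hq := den_pos_real n
  have hd : (0 : ℝ) < r.den := by exact_mod_cast r.pos
  have h1 := lt_angle n
  have h2 := angle_le n
  have hr' : angle * r.den = r.num := by
    rw [← hr]
    exact_mod_cast Rat.mul_den_eq_num r
  have h3 : (0 : ℝ) < r.num * den n - num n * r.den := by
    rw [← hr']
    rw [div_lt_iff₀ hq] at h1
    nlinarith
  have h4 : (1 : ℤ) ≤ r.num * den n - num n * r.den := by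
    have : (0 : ℤ) < r.num * den n - num n * r.den := by exact_mod_cast h3
    linarith
  have h4' : (1 : ℝ) ≤ r.num * den n - num n * r.den := by exact_mod_cast h4
  have hm : (0 : ℝ) < ratio n := by exact_mod_cast ratio_pos n
  have h5 : (r.num : ℝ) * den n - num n * r.den ≤ 2 * r.den / ratio n := by
    rw [← hr']
    have e : (num n : ℝ) / den n + 2 / den (n + 1) = (num n + 2 / ratio n) / den n := by
      rw [den_succ]; push_cast; field_simp
    rw [e, le_div_iff₀ hq] at h2
    have := mul_le_mul_of_nonneg_right h2 hd.le
    have e2 : 2 * (r.den : ℝ) / ratio n = 2 / ratio n * r.den := by ring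
    rw [e2]
    nlinarith
  have h6 : (2 * (r.den : ℝ)) < ratio n := by
    have h7 : (2 * (r.den : ℤ)) < ratio n := by
      have h8 := pow_le_den n
      have h9 := Int.le_of_dvd (ratio_pos _) (den_dvd_ratio n)
      have h10 : (4 : ℤ) ^ n ≤ 4 ^ (n + 1) := pow_le_pow_right₀ (by norm_num) (by omega)
      linarith
    exact_mod_cast h7
  have h7 : 2 * (r.den : ℝ) / ratio n < 1 := by rwa [div_lt_one hm]
  linarith

/-! ### The pieces of the unit interval -/

/-- The index of the piece of order `n` containing `x`. -/
def idx (n : ℕ) (x : I) : ℤ := ⌊(den n : ℝ) * x⌋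

lemma idx_mem (n : ℕ) (x : I) : idx n x ∈ Finset.Ico 0 (den n) := by
  have hq := den_pos_real n
  rw [Finset.mem_Ico, idx, Int.floor_lt, Int.le_floor]
  have h1 := x.2.1
  have h2 := x.2.2
  constructor
  · push_cast; positivity
  · nlinarith

lemma measurable_idx (n : ℕ) : Measurable (idx n) :=
  Int.measurable_floor.comp (measurable_subtype_coe.const_mul _)

lemma idx_succ_div (n : ℕ) (x : I) : idx (n + 1) x / ratio n = idx n x := by
  have hm : (0 : ℝ) < ratio n := by exact_mod_cast ratio_pos n
  have h1 := Int.floor_le ((den n : ℝ) * x)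
  have h2 := Int.lt_floor_add_one ((den n : ℝ) * x)
  have e : ((den (n + 1) : ℤ) : ℝ) * x = den n * x * ratio n := by
    rw [den_succ]; push_cast; ring
  have h3 : idx n x * ratio n ≤ idx (n + 1) x := by
    rw [idx, idx, Int.le_floor, e]
    push_cast
    exact mul_le_mul_of_nonneg_right h1 hm.le
  have h4 : idx (n + 1) x < (idx n x + 1) * ratio n := by
    rw [idx, idx, Int.floor_lt, e]
    push_cast
    exact mul_lt_mul_of_pos_right h2 hm
  apply le_antisymm
  · exact Int.lt_add_one_iff.1 (Int.ediv_lt_of_lt_mul (ratio_pos n) h4)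
  · exact Int.le_ediv_of_mul_le (ratio_pos n) h3

lemma sign_eq_sgn (n : ℕ) (x : I) : sign x = sgn n (idx n x) := by
  have hm := Finset.mem_Ico.1 (idx_mem n x)
  have hq := den_pos_real n
  unfold sign sgn
  rw [Int.emod_eq_of_lt hm.1 hm.2]
  have h2 : (2 : ℝ) * ((den n / 2 : ℤ) : ℝ) = den n := by exact_mod_cast two_mul_half_den n
  have : idx n x < den n / 2 ↔ (x : ℝ) < 1 / 2 := by
    rw [idx, Int.floor_lt]
    constructor <;> intro h <;> nlinarith
  simp only [this]

lemma measureReal_idx_mem (n : ℕ) (F : Finset ℤ) (hF : F ⊆ Finset.Ico 0 (den n)) :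
    leb.real {x | idx n x ∈ F} = F.card / den n := by
  have hq := den_pos_real n
  have h1 : {x | idx n x ∈ F} = ⋃ i ∈ F, {x | idx n x = i} := by ext; simp
  have hm : ∀ i, MeasurableSet {x | idx n x = i} := fun i =>
    measurable_idx n (measurableSet_singleton i)
  rw [h1, measureReal_biUnion_finset _ fun i _ => hm i]
  · have h2 : ∀ i ∈ F, leb.real {x | idx n x = i} = 1 / den n := by
      intro i hi
      have hi := Finset.mem_Ico.1 (hF hi)
      have hi0 : (0 : ℝ) ≤ i := by exact_mod_cast hi.1
      have hi1 : (i : ℝ) + 1 ≤ den n := by exact_mod_cast hi.2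
      have e : {x : I | idx n x = i}
          = ((↑) : I → ℝ) ⁻¹' Set.Ico ((i : ℝ) / den n) ((i + 1) / den n) := by
        ext x
        simp only [Set.mem_ofPred_eq, Set.mem_preimage, Set.mem_Ico, idx, Int.floor_eq_iff]
        rw [div_le_iff₀ hq, lt_div_iff₀ hq, mul_comm]
      rw [e, Measure.real, leb_preimage_coe measurableSet_Ico, Set.inter_eq_left.2,
        Real.volume_Ico, ← sub_div, add_sub_cancel_left, ENNReal.toReal_ofReal (by positivity)]
      apply Set.Ico_subset_Ico (by positivity)
      rwa [div_le_one hq]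
    rw [Finset.sum_congr rfl h2, Finset.sum_const, nsmul_eq_mul, mul_one_div]
  · intro i _ j _ hij
    rw [Function.onFun, Set.disjoint_left]
    intro x hx hx'
    exact hij (hx.symm.trans hx')

/-- The margins of the pieces of order `n`. -/
def bad (n : ℕ) : Set I := {x | ratio n - 4 * den n ≤ idx (n + 1) x % ratio n}

lemma measurableSet_bad (n : ℕ) : MeasurableSet (bad n) :=
  measurable_idx (n + 1) (MeasurableSet.of_discrete (s := {i | ratio n - 4 * den n ≤ i % ratio n}))

/-- In k ≤ 2 `den n` steps the true orbit runs ahead of the rational one by at most 4 `den n` /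
`ratio n` piece lengths. This is the width of the margin at the right end of the piece, so a point
outside it crosses no extra boundary. -/
lemma idx_rot {n : ℕ} {x : I} (hx : x ∉ bad n) {k : ℤ} (h0 : 0 ≤ k) (h1 : k ≤ 2 * den n) :
    idx n (rot angle k x) = (idx n x + num n * k) % den n := by
  have hq := den_pos_real n
  have hm : (0 : ℝ) < ratio n := by exact_mod_cast ratio_pos n
  have hx : idx (n + 1) x % ratio n < ratio n - 4 * den n := not_le.1 hx
  have h2 := Int.mul_ediv_add_emod (idx (n + 1) x) (ratio n)
  rw [idx_succ_div] at h2
  have h3 : ((den (n + 1) : ℤ) : ℝ) * x < idx (n + 1) x + 1 := Int.lt_floor_add_one _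
  have h4 : idx (n + 1) x + 1 ≤ ratio n * idx n x + ratio n - 4 * den n := by linarith
  have h4' : (idx (n + 1) x : ℝ) + 1 ≤ ratio n * idx n x + ratio n - 4 * den n := by
    exact_mod_cast h4
  have h5 : (den n : ℝ) * x + 4 * den n / ratio n < idx n x + 1 := by
    have e : (den n : ℝ) * x + 4 * den n / ratio n
        = (den (n + 1) * x + 4 * den n) / ratio n := by
      rw [den_succ]; push_cast; field_simp
    rw [e, div_lt_iff₀ hm]
    linarith
  have h6 : (idx n x : ℝ) ≤ den n * x := Int.floor_le _
  have h7 := lt_angle n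
  have h8 := angle_le n
  have hk0 : (0 : ℝ) ≤ k := by exact_mod_cast h0
  have hk1 : (k : ℝ) ≤ 2 * den n := by exact_mod_cast h1
  have h9 : (num n : ℝ) ≤ den n * angle := by
    rw [div_lt_iff₀ hq] at h7; linarith
  have h10 : (den n : ℝ) * angle ≤ num n + 2 / ratio n := by
    have e : (num n : ℝ) / den n + 2 / den (n + 1) = (num n + 2 / ratio n) / den n := by
      rw [den_succ]; push_cast; field_simp
    rw [e, le_div_iff₀ hq] at h8
    linarith
  have h11 : ⌊(den n : ℝ) * (x + k * angle)⌋ = idx n x + num n * k := by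
    rw [Int.floor_eq_iff]
    push_cast
    have e : (den n : ℝ) * (x + k * angle) = den n * x + k * (den n * angle) := by ring
    rw [e]
    have h12 := mul_le_mul_of_nonneg_left h9 hk0
    have h13 := mul_le_mul_of_nonneg_left h10 hk0
    have h14 : (k : ℝ) * (2 / ratio n) ≤ 4 * den n / ratio n := by
      rw [mul_div_assoc', div_le_div_iff_of_pos_right hm]
      linarith
    constructor <;> nlinarith
  have h12 : idx n (rot angle k x) = idx n x + num n * k - den n * ⌊(x : ℝ) + k * angle⌋ := by
    rw [idx, rot_val, Int.fract, mul_sub, ← Int.cast_mul, Int.floor_sub_intCast, h11]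
  have h13 := Finset.mem_Ico.1 (idx_mem n (rot angle k x))
  rw [← Int.emod_eq_of_lt h13.1 h13.2, h12, sub_eq_add_neg, ← mul_neg, Int.add_mul_emod_self_left]

/-- Along the orbit the sign is read off from the piece index, which moves as under the rational
rotation; the Birkhoff sum therefore telescopes. -/
lemma rho_of_notMem_bad {n : ℕ} {x : I} (hx : x ∉ bad n) {k : ℤ} (h0 : 0 ≤ k)
    (h1 : k ≤ 2 * den n) :
    rho angle k x - 1 = pot n (idx n x) - pot n (idx n (rot angle k x)) := by
  rw [idx_rot hx h0 h1, pot_emod]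
  obtain ⟨k, rfl⟩ := Int.eq_ofNat_of_zero_le h0
  rw [rho_eq_sum _ h0, add_sub_cancel_left]
  clear h0
  induction k with
  | zero => simp
  | succ k ih =>
    have h2 : (k : ℤ) ≤ 2 * den n := by push_cast at h1; linarith
    have h3 : (0 : ℤ) ≤ k := Int.natCast_nonneg k
    push_cast
    rw [← Finset.insert_Ico_right_eq_Ico_add_one h3, Finset.sum_insert Finset.right_notMem_Ico,
      ih h2, sign_eq_sgn n, idx_rot hx h3 h2,
      show idx n x + num n * ((k : ℤ) + 1) = idx n x + num n * k + num n by ring]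
    have h4 := pot_sub_pot_add_num n (idx n x + num n * k)
    have h5 : sgn n ((idx n x + num n * k) % den n) = sgn n (idx n x + num n * k) := by
      unfold sgn
      rw [Int.emod_emod_of_dvd _ dvd_rfl]
    rw [h5]
    linarith

/-- Each of the `den n` pieces contributes `4 * den n` subpieces of length 1 / `den n` ^ 8. -/
lemma measureReal_bad (n : ℕ) : leb.real (bad n) = 4 / (den n : ℝ) ^ 6 := by
  classical
  have hq := den_pos_real n
  have e : bad n = {x | idx (n + 1) x ∈ (Finset.Ico 0 (den (n + 1))).filter
      fun i => ratio n - 4 * den n ≤ i % ratio n} := by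
    ext x
    simp only [bad, Set.mem_ofPred_eq, Finset.mem_filter, idx_mem, true_and]
  have hw : 4 * den n ≤ ratio n := by
    unfold ratio
    have h4 := four_le_den n
    calc 4 * den n ≤ den n * den n := by nlinarith
      _ = den n ^ 2 := by ring
      _ ≤ den n ^ 7 := pow_le_pow_right₀ (by linarith) (by norm_num)
  have hcard : ((((Finset.Ico 0 (den (n + 1))).filter
      fun i => ratio n - 4 * den n ≤ i % ratio n).card : ℕ) : ℤ) = den n * (4 * den n) := by
    have h1 : ∀ l ∈ Finset.Ico 0 (den n), ∑ a ∈ Finset.Ico 0 (ratio n),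
        (if ratio n - 4 * den n ≤ (l * ratio n + a) % ratio n then 1 else 0)
        = (4 * den n).toNat := by
      intro l _
      have h2 : ∀ a ∈ Finset.Ico 0 (ratio n),
          (if ratio n - 4 * den n ≤ (l * ratio n + a) % ratio n then 1 else 0)
          = if ratio n - 4 * den n ≤ a then 1 else 0 := by
        intro a ha
        rw [Finset.mem_Ico] at ha
        rw [piece_mod n l ha.1 ha.2]
      rw [Finset.sum_congr rfl h2, ← Finset.card_filter]
      have h3 : (Finset.Ico 0 (ratio n)).filter (fun a => ratio n - 4 * den n ≤ a)
          = Finset.Ico (ratio n - 4 * den n) (ratio n) := by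
        ext a
        simp only [Finset.mem_filter, Finset.mem_Ico]
        constructor
        · rintro ⟨⟨_, h⟩, h'⟩; exact ⟨h', h⟩
        · rintro ⟨h, h'⟩; exact ⟨⟨by linarith, h'⟩, h⟩
      rw [h3, Int.card_Ico, sub_sub_cancel]
    rw [Finset.card_filter, sum_pieces, Finset.sum_congr rfl h1, Finset.sum_const, Int.card_Ico,
      sub_zero, smul_eq_mul, Nat.cast_mul, Int.toNat_of_nonneg (den_pos n).le,
      Int.toNat_of_nonneg (by linarith [den_pos n])]
  rw [e, measureReal_idx_mem _ _ (Finset.filter_subset _ _)]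
  have hcard' : (((Finset.Ico 0 (den (n + 1))).filter
      fun i => ratio n - 4 * den n ≤ i % ratio n).card : ℝ) = den n * (4 * den n) := by
    exact_mod_cast hcard
  rw [hcard', den_succ, ratio]
  push_cast
  field_simp

lemma leb_bad_le (n : ℕ) : leb (bad n) ≤ ENNReal.ofReal (1 / 1024 * (1 / 8) ^ n) := by
  rw [← ENNReal.ofReal_toReal (measure_ne_top leb (bad n))]
  apply ENNReal.ofReal_le_ofReal
  change leb.real (bad n) ≤ _
  rw [measureReal_bad, one_div_pow, div_mul_div_comm, one_mul,
    div_le_div_iff₀ (by have := den_pos_real n; positivity) (by positivity)]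
  have h1 : (4 : ℝ) ^ (n + 1) ≤ den n := by exact_mod_cast pow_le_den n
  have h2 : ((4 : ℝ) ^ (n + 1)) ^ 6 ≤ (den n : ℝ) ^ 6 := pow_le_pow_left₀ (by positivity) h1 6
  have h3 : ((4 : ℝ) ^ (n + 1)) ^ 6 = 4096 * 4096 ^ n := by
    rw [← pow_mul, mul_comm, pow_mul, pow_succ]; norm_num; ring
  have h4 : (8 : ℝ) ^ n ≤ 4096 ^ n := pow_le_pow_left₀ (by norm_num) (by norm_num) n
  linarith

/-! ### The limiting bijection -/

/-- A refining sequence of piece maps starting with the translation by one half. -/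
structure IsRefining (κ : ℕ → ℤ → ℤ) (U : ℕ → Finset ℤ) : Prop where
  zero : κ 0 = fun _ => 2
  res_zero : U 0 = {2}
  map : ∀ n, IsPieceMap n (κ n) (U n)
  refines : ∀ n, Refines n (κ n) (U n) (κ (n + 1)) (U (n + 1))

lemma exists_isRefining : ∃ κ U, IsRefining κ U := by
  obtain ⟨κ, U, h0, h1, h2, h3⟩ := exists_pieceMaps
  exact ⟨κ, U, h0, h1, h2, h3⟩

/-- The points that lie in no margin of order at least `n`. -/
def core (n : ℕ) : Set I := {x | ∀ j, n ≤ j → x ∉ bad j}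

/-- The points at which the piece maps are constant from the order `n` on. -/
def good (U : ℕ → Finset ℤ) (n : ℕ) : Set I := {x | idx n x ∉ U n} ∩ core n

lemma core_mono {m n : ℕ} (h : m ≤ n) : core m ⊆ core n := fun _ hx j hj => hx j (h.trans hj)

lemma core_eq_compl (n : ℕ) : (core n)ᶜ = ⋃ j, bad (j + n) := by
  ext x
  simp only [core, Set.mem_compl_iff, Set.mem_ofPred_eq, not_forall, not_not, Set.mem_iUnion]
  constructor
  · rintro ⟨j, hj, hx⟩
    exact ⟨j - n, by rwa [Nat.sub_add_cancel hj]⟩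
  · rintro ⟨j, hx⟩
    exact ⟨j + n, by omega, hx⟩

lemma measurableSet_core (n : ℕ) : MeasurableSet (core n) := by
  rw [← MeasurableSet.compl_iff, core_eq_compl]
  exact MeasurableSet.iUnion fun j => measurableSet_bad _

lemma measurableSet_good (U : ℕ → Finset ℤ) (n : ℕ) : MeasurableSet (good U n) :=
  (measurable_idx n (MeasurableSet.of_discrete (s := {i | i ∉ U n}))).inter (measurableSet_core n)

lemma leb_compl_core_le (n : ℕ) : leb (core n)ᶜ ≤ ENNReal.ofReal ((1 / 8) ^ n) := by
  rw [core_eq_compl]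
  have hs : Summable fun j : ℕ => (1 / 1024 : ℝ) * (1 / 8) ^ (j + n) := by
    simp_rw [pow_add, ← mul_assoc]
    exact ((summable_geometric_of_lt_one (by norm_num) (by norm_num)).mul_left _).mul_right _
  calc leb (⋃ j, bad (j + n)) ≤ ∑' j, leb (bad (j + n)) := measure_iUnion_le _
    _ ≤ ∑' j, ENNReal.ofReal (1 / 1024 * (1 / 8) ^ (j + n)) :=
        ENNReal.tsum_le_tsum fun j => leb_bad_le _
    _ = ENNReal.ofReal (∑' j : ℕ, 1 / 1024 * (1 / 8) ^ (j + n)) :=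
        (ENNReal.ofReal_tsum_of_nonneg (fun j => by positivity) hs).symm
    _ ≤ _ := by
        apply ENNReal.ofReal_le_ofReal
        simp_rw [pow_add, ← mul_assoc]
        rw [tsum_mul_right, tsum_mul_left, tsum_geometric_of_lt_one (by norm_num) (by norm_num)]
        have : (0 : ℝ) ≤ (1 / 8) ^ n := by positivity
        norm_num at this ⊢

section Refining

variable {κ : ℕ → ℤ → ℤ} {U : ℕ → Finset ℤ}

lemma IsRefining.idx_mem_of_succ (hr : IsRefining κ U) {n : ℕ} {x : I}
    (hx : idx (n + 1) x ∈ U (n + 1)) : idx n x ∈ U n := by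
  rw [← idx_succ_div]
  exact (hr.refines n).nested _ hx

lemma IsRefining.idx_mem_of_le (hr : IsRefining κ U) {m n : ℕ} (h : m ≤ n) {x : I}
    (hx : idx n x ∈ U n) : idx m x ∈ U m := by
  induction n, h using Nat.le_induction with
  | base => exact hx
  | succ n _ ih => exact ih (hr.idx_mem_of_succ hx)

lemma IsRefining.good_mono (hr : IsRefining κ U) {m n : ℕ} (h : m ≤ n) : good U m ⊆ good U n :=
  fun _ hx => ⟨fun hx' => hx.1 (hr.idx_mem_of_le h hx'), core_mono h hx.2⟩

lemma IsRefining.shift_eq (hr : IsRefining κ U) {m n : ℕ} (h : m ≤ n) {x : I}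
    (hx : x ∈ good U m) : κ n (idx n x) = κ m (idx m x) := by
  induction n, h using Nat.le_induction with
  | base => rfl
  | succ n hn ih =>
    have h1 := (hr.good_mono hn hx).1
    have h2 : x ∉ bad n := hx.2 n hn
    rw [← ih, (hr.refines n).core _ (idx_mem _ _) (by rwa [idx_succ_div]) (not_le.1 h2),
      idx_succ_div]

/-- The margins have summable measures, and the residual sets are nested with measures tending to
zero. -/
lemma IsRefining.ae_mem_good (hr : IsRefining κ U) : ∀ᵐ x ∂leb, ∃ n, x ∈ good U n := by
  have h1 : ∀ᵐ x ∂leb, ∃ n, x ∈ core n := by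
    have h2 : leb (⋂ n, (core n)ᶜ) = 0 := by
      refine le_antisymm (ge_of_tendsto' (?_ : Tendsto (fun n : ℕ => ENNReal.ofReal ((1 / 8) ^ n))
        atTop (𝓝 0)) fun n => (measure_mono (Set.iInter_subset _ n)).trans (leb_compl_core_le n))
        zero_le
      rw [← ENNReal.ofReal_zero]
      exact ENNReal.tendsto_ofReal
        (tendsto_pow_atTop_nhds_zero_of_lt_one (by norm_num) (by norm_num))
    filter_upwards [measure_eq_zero_iff_ae_notMem.1 h2] with x hx
    simpa using hx
  have h3 : ∀ᵐ x ∂leb, ∃ n, idx n x ∉ U n := by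
    have h4 : leb (⋂ n, {x | idx n x ∈ U n}) = 0 := by
      have h5 := ENNReal.tendsto_ofReal (tendsto_card_residual hr.res_zero hr.refines)
      rw [ENNReal.ofReal_zero] at h5
      refine le_antisymm (ge_of_tendsto' h5 fun n =>
        (measure_mono (Set.iInter_subset _ n)).trans ?_) zero_le
      rw [← measureReal_idx_mem n (U n) (hr.map n).sub, Measure.real,
        ENNReal.ofReal_toReal (measure_ne_top _ _)]
    filter_upwards [measure_eq_zero_iff_ae_notMem.1 h4] with x hx
    simpa using hx
  filter_upwards [h1, h3] with x ⟨n, hn⟩ ⟨m, hm⟩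
  exact ⟨max n m, fun h => hm (hr.idx_mem_of_le (le_max_right _ _) h),
    core_mono (le_max_left _ _) hn⟩

lemma IsRefining.exists_shift (hr : IsRefining κ U) : ∃ τ : I → ℤ, Measurable τ ∧
    (∀ x, 2 ≤ τ x) ∧ ∀ n, ∀ x ∈ good U n, τ x = κ n (idx n x) := by
  classical
  set τ : I → ℤ := fun x => if h : ∃ n, x ∈ good U n then κ (Nat.find h) (idx (Nat.find h) x) else 2
    with hτ
  have h1 : ∀ n, ∀ x ∈ good U n, τ x = κ n (idx n x) := by
    intro n x hx
    have h : ∃ n, x ∈ good U n := ⟨n, hx⟩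
    simp only [hτ, dif_pos h]
    exact (hr.shift_eq (Nat.find_min' h hx) (Nat.find_spec h)).symm
  have h2 : ∀ x, (¬ ∃ n, x ∈ good U n) → τ x = 2 := fun x hx => by simp only [hτ, dif_neg hx]
  refine ⟨τ, measurable_to_countable' fun k => ?_, fun x => ?_, h1⟩
  · have e : τ ⁻¹' {k} = (⋃ n, good U n ∩ {x | κ n (idx n x) = k}) ∪
        ((⋃ n, good U n)ᶜ ∩ {_x | 2 = k}) := by
      ext x
      simp only [Set.mem_preimage, Set.mem_singleton_iff, Set.mem_union, Set.mem_iUnion,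
        Set.mem_inter_iff, Set.mem_ofPred_eq, Set.mem_compl_iff]
      constructor
      · intro hx
        by_cases h : ∃ n, x ∈ good U n
        · obtain ⟨n, hn⟩ := h
          exact Or.inl ⟨n, hn, by rw [← h1 n x hn, hx]⟩
        · exact Or.inr ⟨h, by rw [← h2 x h, hx]⟩
      · rintro (⟨n, hn, hx⟩ | ⟨h, hx⟩)
        · rw [h1 n x hn, hx]
        · rw [h2 x h, hx]
    rw [e]
    refine (MeasurableSet.iUnion fun n => (measurableSet_good U n).inter ?_).union
      ((MeasurableSet.iUnion fun n => measurableSet_good U n).compl.inter (MeasurableSet.const _))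
    exact measurable_idx n (MeasurableSet.of_discrete (s := {i | κ n i = k}))
  · by_cases h : ∃ n, x ∈ good U n
    · obtain ⟨n, hn⟩ := h
      rw [h1 n x hn]
      exact ((hr.map n).shift_mem _ (idx_mem n x)).1
    · rw [h2 x h]

variable {τ : I → ℤ}

lemma IsRefining.shift_bounds (hr : IsRefining κ U) (n : ℕ) (x : I) :
    0 ≤ κ n (idx n x) ∧ κ n (idx n x) ≤ 2 * den n := by
  have h1 := (hr.map n).shift_mem _ (idx_mem n x)
  have h2 := four_le_den n
  constructor <;> linarith

lemma IsRefining.idx_T (hr : IsRefining κ U) {n : ℕ} {x : I} (hx : x ∈ good U n)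
    (hτ : τ x = κ n (idx n x)) :
    idx n (T angle τ x) = (idx n x + num n * κ n (idx n x)) % den n := by
  rw [T, hτ]
  exact idx_rot (hx.2 n le_rfl) (hr.shift_bounds n x).1 (hr.shift_bounds n x).2

lemma IsRefining.rho_sub_one (hr : IsRefining κ U) {n : ℕ} {x : I} (hx : x ∈ good U n)
    (hτ : τ x = κ n (idx n x)) :
    rho angle (τ x) x - 1 = pot n (idx n x) - pot n (idx n (T angle τ x)) := by
  rw [T, hτ]
  exact rho_of_notMem_bad (hx.2 n le_rfl) (hr.shift_bounds n x).1 (hr.shift_bounds n x).2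

/-- If two good points have the same image, injectivity of the piece maps puts them in the same
piece at every large order, and the piece lengths tend to zero. -/
lemma IsRefining.injOn (hr : IsRefining κ U) (hτ : ∀ n, ∀ x ∈ good U n, τ x = κ n (idx n x)) :
    Set.InjOn (T angle τ) {x | ∃ n, x ∈ good U n} := by
  rintro x ⟨a, ha⟩ y ⟨b, hb⟩ hxy
  have h1 : ∀ n, max a b ≤ n → idx n x = idx n y := by
    intro n hn
    have hx := hr.good_mono ((le_max_left _ _).trans hn) ha
    have hy := hr.good_mono ((le_max_right _ _).trans hn) hb
    have h2 := hr.idx_T hx (hτ n x hx)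
    rw [hxy, hr.idx_T hy (hτ n y hy)] at h2
    exact ((hr.map n).inj (idx_mem n y) (idx_mem n x) h2).symm
  apply Subtype.ext
  by_contra hne
  have hpos : 0 < |(x : ℝ) - y| := abs_pos.2 (sub_ne_zero.2 hne)
  obtain ⟨n, hn⟩ := pow_unbounded_of_one_lt (1 / |(x : ℝ) - y|) (by norm_num : (1 : ℝ) < 4)
  set m := max n (max a b) with hm
  have h3 : (1 : ℝ) / |(x : ℝ) - y| < den m := by
    have h4 : (4 : ℝ) ^ (m + 1) ≤ den m := by exact_mod_cast pow_le_den m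
    have h5 : (4 : ℝ) ^ n ≤ 4 ^ (m + 1) :=
      pow_le_pow_right₀ (by norm_num) ((le_max_left _ _).trans (Nat.le_succ _))
    linarith
  have h6 := Int.abs_sub_lt_one_of_floor_eq_floor (h1 m (le_max_right _ _))
  rw [← mul_sub, abs_mul, abs_of_pos (den_pos_real m)] at h6
  rw [div_lt_iff₀ hpos] at h3
  linarith

lemma idx_half_of_succ {n : ℕ} {x y : I}
    (h : idx (n + 1) y = (idx (n + 1) x + den (n + 1) / 2) % den (n + 1)) :
    idx n y = (idx n x + den n / 2) % den n := by
  obtain ⟨l, a, h0, h1, e⟩ := exists_piece n (idx (n + 1) x)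
  rw [← idx_succ_div, ← idx_succ_div n x, h, e, half_den_succ,
    show l * ratio n + a + den n / 2 * ratio n = (l + den n / 2) * ratio n + a by ring,
    piece_emod_den n _ h0 h1, piece_div n _ h0 h1, piece_div n _ h0 h1]

lemma idx_half_of_le {m n : ℕ} (hmn : m ≤ n) {x y : I}
    (h : idx n y = (idx n x + den n / 2) % den n) :
    idx m y = (idx m x + den m / 2) % den m := by
  induction n, hmn using Nat.le_induction with
  | base => exact h
  | succ n _ ih => exact ih (idx_half_of_succ h)

/-- A point of the residual set of order `k` that becomes good at the order `k + 1`. -/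
lemma IsRefining.resolved (hr : IsRefining κ U) {k : ℕ} {x : I} (hx : x ∈ good U (k + 1))
    (hτ : τ x = κ (k + 1) (idx (k + 1) x)) (hU : idx k x ∈ U k) :
    rho angle (τ x) x = 1 ∧ idx k (T angle τ x) = (idx k x + den k / 2) % den k := by
  have h1 := hr.rho_sub_one hx hτ
  have h2 := hr.idx_T hx hτ
  have hU' : idx (k + 1) x / ratio k ∈ U k := by rwa [idx_succ_div]
  constructor
  · rw [h2, pot_emod, (hr.refines k).pot_eq _ (idx_mem _ _) hU' hx.1] at h1
    linarith
  · rw [← idx_succ_div, h2, (hr.refines k).half _ (idx_mem _ _) hU' hx.1, idx_succ_div]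

/-- Points are sorted by the first order at which they become good. The two possible obstructions
one order earlier are treated differently: margins cost a small error, residual pieces are resolved
exactly. -/
lemma exists_first_good {x : I} (hx : ∃ n, x ∈ good U n) :
    x ∈ good U 0 ∨ ∃ k, x ∉ good U k ∧ x ∈ good U (k + 1) ∧ (x ∈ bad k ∨ idx k x ∈ U k) := by
  classical
  have h1 := Nat.find_spec hx
  rcases hk : Nat.find hx with _ | k
  · rw [hk] at h1
    exact Or.inl h1
  · rw [hk] at h1
    have h2 : x ∉ good U k := Nat.find_min hx (by omega)
    refine Or.inr ⟨k, h2, h1, ?_⟩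
    by_contra! h
    refine h2 ⟨h.2, fun j hj => ?_⟩
    rcases hj.eq_or_lt with rfl | hj
    · exact h.1
    · exact h1.2 j hj

end Refining

/-! ### The approximate dual potentials -/

/-- The functions `φ n` are asymptotically potentials of the cocycle `rho α - 1`: along the
rotation and along `T α τ` they are eventually exact, and the defects tend to zero. -/
structure HasPotentials (α : ℝ) (τ : I → ℤ) (φ : ℕ → I → ℝ) : Prop where
  irrational : Irrational α
  measurable_shift : Measurable τ
  two_le : ∀ x, 2 ≤ τ x
  bijective : Function.Bijective (T α τ)
  integrable_rho : Integrable (fun x => (rho α (τ x) x : ℝ)) leb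
  one_lt : 1 < ∫ x, (rho α (τ x) x : ℝ) ∂leb
  measurable : ∀ n, Measurable (φ n)
  bounded : ∀ n, ∃ C, ∀ x, |φ n x| ≤ C
  ae_rot : ∀ᵐ x ∂leb, ∀ᶠ n in atTop, φ n x - φ n (rot α 1 x) = sign x
  ae_T : ∀ᵐ x ∂leb, ∀ᶠ n in atTop, φ n x - φ n (T α τ x) = rho α (τ x) x - 1
  lim_rot : Tendsto (fun n => ∫⁻ x, ENNReal.ofReal (φ n x - φ n (rot α 1 x) - sign x) ∂leb)
    atTop (𝓝 0)
  -- Only the positive part is asked to vanish. The signed integral is -(∫ϱ_τ - 1) for every n, so a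
  -- negative part persists; it produces the singular part of the optimizers.
  lim_T : Tendsto (fun n => ∫⁻ x, ENNReal.ofReal
    (φ n x - φ n (T α τ x) - (rho α (τ x) x - 1)) ∂leb) atTop (𝓝 0)

/-- The potential of order `n` as a function on the unit interval. -/
def approx (n : ℕ) (x : I) : ℝ := pot n (idx n x)

lemma measurable_approx (n : ℕ) : Measurable (approx n) :=
  (measurable_from_top (f := fun l : ℤ => ((pot n l : ℤ) : ℝ))).comp (measurable_idx n)

lemma abs_approx_le (n : ℕ) (x : I) : |approx n x| ≤ 2 ^ n := by
  unfold approx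
  exact_mod_cast abs_pot_le n (idx n x)

lemma approx_sub_approx_rot {n : ℕ} {x : I} (hx : x ∉ bad n) :
    approx n x - approx n (rot angle 1 x) = sign x := by
  have h := rho_of_notMem_bad hx zero_le_one (by linarith [four_le_den n])
  rw [rho_one, add_sub_cancel_left] at h
  unfold approx
  exact_mod_cast h.symm

/-- A bound for the change of the potential caused by the margins. -/
def marginBound (x : I) : ℝ≥0∞ :=
  -- A point first good at order k + 1 has |ϱ_τ - 1| ≤ 2 · 2 ^ (k + 1) = 4 · 2 ^ k; the rest of the
  -- factor 6 absorbs the comparison value 2 on piece 0.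
  ∑' k : ℕ, (bad k).indicator (fun _ => ENNReal.ofReal (6 * 2 ^ k)) x

lemma le_marginBound {k : ℕ} {x : I} (hx : x ∈ bad k) :
    ENNReal.ofReal (6 * 2 ^ k) ≤ marginBound x := by
  refine le_trans ?_ (ENNReal.le_tsum k)
  rw [Set.indicator_of_mem hx]

lemma lintegral_marginBound : ∫⁻ x, marginBound x ∂leb ≤ ENNReal.ofReal (1 / 128) := by
  unfold marginBound
  rw [lintegral_tsum fun k => (measurable_const.indicator (measurableSet_bad k)).aemeasurable]
  have hs : Summable fun k : ℕ => (6 / 1024 : ℝ) * (1 / 4) ^ k :=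
    (summable_geometric_of_lt_one (by norm_num) (by norm_num)).mul_left _
  calc ∑' k : ℕ, ∫⁻ x, (bad k).indicator (fun _ => ENNReal.ofReal (6 * 2 ^ k)) x ∂leb
      ≤ ∑' k : ℕ, ENNReal.ofReal ((6 / 1024 : ℝ) * (1 / 4) ^ k) := by
        refine ENNReal.tsum_le_tsum fun k => ?_
        rw [lintegral_indicator_const (measurableSet_bad k)]
        refine (mul_le_mul_right (leb_bad_le k) _).trans (le_of_eq ?_)
        rw [← ENNReal.ofReal_mul (by positivity)]
        congr 1
        rw [show (1 / 4 : ℝ) = 2 * (1 / 8) by norm_num, mul_pow]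
        ring
    _ = ENNReal.ofReal (∑' k : ℕ, (6 / 1024 : ℝ) * (1 / 4) ^ k) :=
        (ENNReal.ofReal_tsum_of_nonneg (fun k => by positivity) hs).symm
    _ = ENNReal.ofReal (1 / 128) := by
        rw [tsum_mul_left, tsum_geometric_of_lt_one (by norm_num) (by norm_num)]
        norm_num

lemma integral_le_toReal_lintegral {Z : Type*} [MeasurableSpace Z] {μ : Measure Z} {f : Z → ℝ}
    (hf : Integrable f μ) : ∫ z, f z ∂μ ≤ (∫⁻ z, ENNReal.ofReal (f z) ∂μ).toReal := by
  rw [integral_eq_lintegral_pos_part_sub_lintegral_neg_part hf]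
  exact sub_le_self _ ENNReal.toReal_nonneg

section Refining

variable {κ : ℕ → ℤ → ℤ} {U : ℕ → Finset ℤ} {τ : I → ℤ}

/-- For a point good at order 0, ϱ_τ - 1 is exactly 2 on piece 0 and 0 on pieces 1 and 3. A point
resolved from a residual piece lies in piece 2 and has ϱ_τ = 1. The only other points become good
after leaving a margin, where the crude bound on the potential is enough. -/
lemma IsRefining.rho_bounds (hr : IsRefining κ U) {x : I} (hx : ∃ n, x ∈ good U n)
    (hτ : ∀ n, x ∈ good U n → τ x = κ n (idx n x)) :
    ENNReal.ofReal |(rho angle (τ x) x : ℝ) - 1| ≤ 2 + marginBound x ∧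
    ENNReal.ofReal ((if idx 0 x = 0 then 2 else 0) - ((rho angle (τ x) x : ℝ) - 1))
      ≤ marginBound x := by
  rcases exists_first_good hx with h | ⟨k, -, h, hk⟩
  · have h1 := hr.rho_sub_one h (hτ 0 h)
    have h2 := hr.idx_T h (hτ 0 h)
    have h3 := h.1
    have h4 := idx_mem 0 x
    rw [hr.res_zero] at h3
    rw [h2, hr.zero] at h1
    have h5 : rho angle (τ x) x - 1 = if idx 0 x = 0 then 2 else 0 := by
      rw [h1]
      simp only [Set.mem_ofPred_eq, Finset.mem_singleton] at h3
      simp only [den_zero, Finset.mem_Ico] at h4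
      generalize idx 0 x = i at *
      have : i = 0 ∨ i = 1 ∨ i = 3 := by omega
      rcases this with rfl | rfl | rfl <;> decide
    have h6 : (rho angle (τ x) x : ℝ) - 1 = if idx 0 x = 0 then 2 else 0 := by exact_mod_cast h5
    rw [h6, sub_self, ENNReal.ofReal_zero]
    refine ⟨le_trans ?_ le_self_add, zero_le⟩
    split_ifs <;> simp
  · rcases hk with hk | hk
    · have h1 := hr.rho_sub_one h (hτ _ h)
      have h2 : (rho angle (τ x) x : ℝ) - 1
          = approx (k + 1) x - approx (k + 1) (T angle τ x) := by
        unfold approx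
        exact_mod_cast h1
      have h3 := abs_approx_le (k + 1) x
      have h4 := abs_approx_le (k + 1) (T angle τ x)
      have h5 : |(rho angle (τ x) x : ℝ) - 1| ≤ 4 * 2 ^ k := by
        rw [h2]
        refine (abs_sub _ _).trans ?_
        rw [pow_succ] at h3 h4
        linarith
      have h6 : (1 : ℝ) ≤ 2 ^ k := one_le_pow₀ (by norm_num)
      constructor
      · refine le_trans ?_ le_add_self
        refine le_trans (ENNReal.ofReal_le_ofReal ?_) (le_marginBound hk)
        linarith
      · refine le_trans (ENNReal.ofReal_le_ofReal ?_) (le_marginBound hk)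
        have := (abs_le.1 h5).1
        split_ifs <;> linarith
    · have h1 := (hr.resolved h (hτ _ h) hk).1
      have h2 : idx 0 x = 2 := by
        have := hr.idx_mem_of_le (Nat.zero_le k) hk
        rwa [hr.res_zero, Finset.mem_singleton] at this
      rw [h1, h2]
      simp

/-- At good points there is equality. At a residual point, T^(τ) acts at order n as a half turn,
which flips the potential, while ϱ_τ = 1; the expression is then twice the potential, negative on
residual pieces. Hence the defect can be positive only in margins. -/
lemma IsRefining.approx_sub_le (hr : IsRefining κ U) {x : I} (hx : ∃ n, x ∈ good U n)
    (hτ : ∀ n, x ∈ good U n → τ x = κ n (idx n x)) {n : ℕ} (hn : x ∈ core n) :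
    approx n x - approx n (T angle τ x) - ((rho angle (τ x) x : ℝ) - 1) ≤ 0 := by
  by_cases hg : x ∈ good U n
  · have h1 := hr.rho_sub_one hg (hτ n hg)
    have h2 : (rho angle (τ x) x : ℝ) - 1 = approx n x - approx n (T angle τ x) := by
      unfold approx
      exact_mod_cast h1
    rw [h2, sub_self]
  · have hU : idx n x ∈ U n := by
      by_contra h
      exact hg ⟨h, hn⟩
    rcases exists_first_good hx with h | ⟨k, h', h, hk⟩
    · exact absurd (hr.good_mono (Nat.zero_le n) h) hg
    · have hnk : n ≤ k := by
        by_contra! hlt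
        exact hg (hr.good_mono hlt h)
      have hk' : idx k x ∈ U k := hk.resolve_left (hn k hnk)
      obtain ⟨h1, h2⟩ := hr.resolved h (hτ _ h) hk'
      have h3 := idx_half_of_le hnk h2
      have h4 : approx n (T angle τ x) = -approx n x := by
        unfold approx
        rw [h3, pot_emod, pot_add_half]
        push_cast
        rfl
      have h5 : approx n x < 0 := by
        unfold approx
        exact_mod_cast (hr.map n).neg _ hU
      rw [h4, h1]
      push_cast
      linarith

lemma IsRefining.hasPotentials (hr : IsRefining κ U) (hτm : Measurable τ) (h2 : ∀ x, 2 ≤ τ x)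
    (hbij : Function.Bijective (T angle τ))
    (hτ : ∀ᵐ x ∂leb, ∀ n, x ∈ good U n → τ x = κ n (idx n x)) :
    HasPotentials angle τ approx := by
  have hg := hr.ae_mem_good
  have hρm : Measurable fun x => (rho angle (τ x) x : ℝ) :=
    measurable_from_top.comp (measurable_rho_comp angle hτm fun x => by linarith [h2 x])
  have hfin : ∫⁻ x, (2 + marginBound x) ∂leb < ⊤ := by
    rw [lintegral_add_left measurable_const]
    simp only [lintegral_const, measure_univ, mul_one]
    exact ENNReal.add_lt_top.2 ⟨by simp, lintegral_marginBound.trans_lt ENNReal.ofReal_lt_top⟩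
  have hfin' : ∫⁻ x, ENNReal.ofReal |(rho angle (τ x) x : ℝ) - 1| ∂leb < ⊤ := by
    refine lt_of_le_of_lt (lintegral_mono_ae ?_) hfin
    filter_upwards [hg, hτ] with x hx hx'
    exact (hr.rho_bounds hx hx').1
  have hint' : Integrable (fun x => (rho angle (τ x) x : ℝ) - 1) leb := by
    refine ⟨(hρm.sub_const 1).aestronglyMeasurable, ?_⟩
    rw [hasFiniteIntegral_iff_norm]
    simpa only [Real.norm_eq_abs] using hfin'
  have hint : Integrable (fun x => (rho angle (τ x) x : ℝ)) leb := by
    have e : (fun x => (rho angle (τ x) x : ℝ))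
        = (fun x => (rho angle (τ x) x : ℝ) - 1) + fun _ => 1 := by
      funext x
      simp
    rw [e]
    exact hint'.add (integrable_const (1 : ℝ))
  refine ⟨irrational_angle, hτm, h2, hbij, hint, ?_, measurable_approx,
    fun n => ⟨2 ^ n, abs_approx_le n⟩, ?_, ?_, ?_, ?_⟩
  -- The comparison function is 2 on piece 0, with integral 2/4, and ϱ_τ - 1 falls short of it by at
  -- most 1/128 in the mean.
  · have hs : MeasurableSet {x | idx 0 x ∈ ({0} : Finset ℤ)} :=
      measurable_idx 0 (MeasurableSet.of_discrete (s := {i | i ∈ ({0} : Finset ℤ)}))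
    have e : (fun x => (if idx 0 x = 0 then (2 : ℝ) else 0) - ((rho angle (τ x) x : ℝ) - 1))
        = fun x => 2 * {x | idx 0 x ∈ ({0} : Finset ℤ)}.indicator 1 x
          - ((rho angle (τ x) x : ℝ) - 1) := by
      funext x
      by_cases h : idx 0 x = 0 <;> simp [Set.indicator, h]
    have hi1 : Integrable (fun x => 2 * {x | idx 0 x ∈ ({0} : Finset ℤ)}.indicator (1 : I → ℝ) x)
        leb := ((integrable_const (1 : ℝ)).indicator hs).const_mul 2
    have h3 := integral_le_toReal_lintegral (hi1.sub hint')
    have h4 : (∫⁻ x, ENNReal.ofReal ((if idx 0 x = 0 then (2 : ℝ) else 0)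
        - ((rho angle (τ x) x : ℝ) - 1)) ∂leb).toReal ≤ 1 / 128 := by
      refine ENNReal.toReal_le_of_le_ofReal (by norm_num)
        (le_trans (lintegral_mono_ae ?_) lintegral_marginBound)
      filter_upwards [hg, hτ] with x hx hx'
      exact (hr.rho_bounds hx hx').2
    simp_rw [funext_iff] at e
    simp_rw [e] at h4
    have h5 : ∫ x, (2 * {x | idx 0 x ∈ ({0} : Finset ℤ)}.indicator (1 : I → ℝ) x
        - ((rho angle (τ x) x : ℝ) - 1)) ∂leb ≤ 1 / 128 := h3.trans h4
    rw [integral_sub hi1 hint', integral_sub hint (integrable_const _), integral_const_mul,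
      integral_indicator_one hs, measureReal_idx_mem 0 {0} (by rw [den_zero]; decide)] at h5
    simp [den_zero] at h5
    norm_num at h5
    linarith
  · filter_upwards [hg] with x ⟨n, hn⟩
    filter_upwards [eventually_ge_atTop n] with m hm
    exact approx_sub_approx_rot (hn.2 m hm)
  · filter_upwards [hg, hτ] with x ⟨n, hn⟩ hx
    filter_upwards [eventually_ge_atTop n] with m hm
    have hm' := hr.good_mono hm hn
    have h1 := hr.rho_sub_one hm' (hx m hm')
    unfold approx
    exact_mod_cast h1.symm
  · have h3 : ∀ n, ∫⁻ x, ENNReal.ofReal (approx n x - approx n (rot angle 1 x) - sign x) ∂leb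
        ≤ ENNReal.ofReal (3 * (1 / 4) ^ n) := by
      intro n
      calc ∫⁻ x, ENNReal.ofReal (approx n x - approx n (rot angle 1 x) - sign x) ∂leb
          ≤ ∫⁻ x, (bad n).indicator (fun _ => ENNReal.ofReal (3 * 2 ^ n)) x ∂leb := by
            refine lintegral_mono fun x => ?_
            by_cases hx : x ∈ bad n
            · rw [Set.indicator_of_mem hx]
              apply ENNReal.ofReal_le_ofReal
              have h3 := abs_le.1 (abs_approx_le n x)
              have h4 := abs_le.1 (abs_approx_le n (rot angle 1 x))
              have h5 : (1 : ℝ) ≤ 2 ^ n := one_le_pow₀ (by norm_num)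
              have h6 : (-1 : ℝ) ≤ sign x := by
                unfold sign
                split_ifs <;> norm_num
              linarith [h3.2, h4.1]
            · rw [approx_sub_approx_rot hx, sub_self, ENNReal.ofReal_zero]
              exact zero_le
        _ ≤ ENNReal.ofReal (3 * 2 ^ n) * ENNReal.ofReal (1 / 1024 * (1 / 8) ^ n) := by
            rw [lintegral_indicator_const (measurableSet_bad n)]
            exact mul_le_mul_right (leb_bad_le n) _
        _ ≤ _ := by
            rw [← ENNReal.ofReal_mul (by positivity)]
            apply ENNReal.ofReal_le_ofReal
            rw [show (1 / 4 : ℝ) = 2 * (1 / 8) by norm_num, mul_pow]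
            have : (0 : ℝ) ≤ 2 ^ n * (1 / 8) ^ n := by positivity
            nlinarith
    refine tendsto_of_tendsto_of_tendsto_of_le_of_le tendsto_const_nhds ?_ (fun _ => zero_le) h3
    rw [← ENNReal.ofReal_zero, ← mul_zero (3 : ℝ)]
    exact ENNReal.tendsto_ofReal
      ((tendsto_pow_atTop_nhds_zero_of_lt_one (by norm_num) (by norm_num)).const_mul 3)
  · have hc0 : Tendsto (fun n => leb (core n)ᶜ) atTop (𝓝 0) := by
      refine tendsto_of_tendsto_of_tendsto_of_le_of_le tendsto_const_nhds ?_ (fun _ => zero_le)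
        leb_compl_core_le
      rw [← ENNReal.ofReal_zero]
      exact ENNReal.tendsto_ofReal
        (tendsto_pow_atTop_nhds_zero_of_lt_one (by norm_num) (by norm_num))
    -- The positive defect lives off `core n`. There the potentials contribute at most 2 · 2 ^ n · 8
    -- ^ (-n), and ϱ_τ - 1 is integrable over sets of vanishing measure.
    have h3 : ∀ n, ∫⁻ x, ENNReal.ofReal
        (approx n x - approx n (T angle τ x) - (rho angle (τ x) x - 1)) ∂leb
        ≤ ENNReal.ofReal (2 * (1 / 4) ^ n)
          + ∫⁻ x in (core n)ᶜ, ENNReal.ofReal |(rho angle (τ x) x : ℝ) - 1| ∂leb := by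
      intro n
      have hm := (measurableSet_core n).compl
      calc ∫⁻ x, ENNReal.ofReal
            (approx n x - approx n (T angle τ x) - (rho angle (τ x) x - 1)) ∂leb
          ≤ ∫⁻ x, (core n)ᶜ.indicator (fun x => ENNReal.ofReal (2 * 2 ^ n)
              + ENNReal.ofReal |(rho angle (τ x) x : ℝ) - 1|) x ∂leb := by
            refine lintegral_mono_ae ?_
            filter_upwards [hg, hτ] with x hx hx'
            by_cases hc : x ∈ core n
            · rw [ENNReal.ofReal_of_nonpos (hr.approx_sub_le hx hx' hc)]
              exact zero_le
            · rw [Set.indicator_of_mem (show x ∈ (core n)ᶜ from hc),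
                ← ENNReal.ofReal_add (by positivity) (abs_nonneg _)]
              apply ENNReal.ofReal_le_ofReal
              have h3 := abs_le.1 (abs_approx_le n x)
              have h4 := abs_le.1 (abs_approx_le n (T angle τ x))
              have h5 := neg_abs_le ((rho angle (τ x) x : ℝ) - 1)
              linarith [h3.2, h4.1]
        _ = ENNReal.ofReal (2 * 2 ^ n) * leb (core n)ᶜ
            + ∫⁻ x in (core n)ᶜ, ENNReal.ofReal |(rho angle (τ x) x : ℝ) - 1| ∂leb := by
            rw [lintegral_indicator hm, lintegral_add_left measurable_const]
            simp
        _ ≤ _ := by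
            gcongr
            refine (mul_le_mul_right (leb_compl_core_le n) _).trans (le_of_eq ?_)
            rw [← ENNReal.ofReal_mul (by positivity), mul_assoc, ← mul_pow]
            norm_num
    refine tendsto_of_tendsto_of_tendsto_of_le_of_le tendsto_const_nhds ?_ (fun _ => zero_le) h3
    rw [← add_zero (0 : ℝ≥0∞)]
    refine Tendsto.add ?_ (tendsto_setLIntegral_zero hfin'.ne hc0)
    rw [← ENNReal.ofReal_zero, ← mul_zero (2 : ℝ)]
    exact ENNReal.tendsto_ofReal
      ((tendsto_pow_atTop_nhds_zero_of_lt_one (by norm_num) (by norm_num)).const_mul 2)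

end Refining

lemma exists_hasPotentials : ∃ τ, HasPotentials angle τ approx := by
  obtain ⟨κ, U, hr⟩ := exists_isRefining
  obtain ⟨τ₀, hm₀, h2₀, hτ₀⟩ := hr.exists_shift
  have hA : MeasurableSet {x | ∃ n, x ∈ good U n} := by
    have : {x | ∃ n, x ∈ good U n} = ⋃ n, good U n := by ext; simp
    rw [this]
    exact MeasurableSet.iUnion (measurableSet_good U)
  obtain ⟨τ, hm, h2, hτ, hbij⟩ := exists_bijective_modification hm₀ h2₀ hA
    (ae_iff.1 hr.ae_mem_good) (hr.injOn hτ₀)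
  refine ⟨τ, hr.hasPotentials hm h2 hbij ?_⟩
  filter_upwards [hτ] with x hx n hn
  rw [hx, hτ₀ n x hn]

/-! ### Integration along the graphs -/

lemma measurableEmbedding_graph (α : ℝ) {σ : I → ℤ} (hσ : Measurable σ) :
    MeasurableEmbedding fun x => (x, T α σ x) :=
  (measurable_id.prodMk (measurable_T α hσ)).measurableEmbedding
    fun _ _ hxy => congrArg Prod.fst hxy

lemma lintegral_plan (α : ℝ) {σ : I → ℤ} (hσ : Measurable σ) (F : I × I → ℝ≥0∞) :
    ∫⁻ p, F p ∂(plan α σ) = ∫⁻ x, F (x, T α σ x) ∂leb :=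
  (measurableEmbedding_graph α hσ).lintegral_map F

lemma integral_plan (α : ℝ) {σ : I → ℤ} (hσ : Measurable σ) (F : I × I → ℝ) :
    ∫ p, F p ∂(plan α σ) = ∫ x, F (x, T α σ x) ∂leb :=
  (measurableEmbedding_graph α hσ).integral_map F

lemma integrable_plan_iff (α : ℝ) {σ : I → ℤ} (hσ : Measurable σ) {F : I × I → ℝ} :
    Integrable F (plan α σ) ↔ Integrable (fun x => F (x, T α σ x)) leb :=
  (measurableEmbedding_graph α hσ).integrable_map_iff

lemma ae_plan_iff (α : ℝ) {σ : I → ℤ} (hσ : Measurable σ) {P : I × I → Prop} :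
    (∀ᵐ p ∂(plan α σ), P p) ↔ ∀ᵐ x ∂leb, P (x, T α σ x) :=
  (measurableEmbedding_graph α hσ).ae_map_iff

lemma T_zero (α : ℝ) (x : I) : T α (fun _ => 0) x = x := rot_zero α x

lemma T_one (α : ℝ) (x : I) : T α (fun _ => 1) x = rot α 1 x := rfl

lemma isTransportPlan_plan {α : ℝ} {σ : I → ℤ} (hσ : Measurable σ)
    (hbij : Function.Bijective (T α σ)) : IsTransportPlan leb leb (plan α σ) := by
  have hm := (measurableEmbedding_graph α hσ).measurable
  constructor
  · rw [plan, Measure.map_map measurable_fst hm]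
    exact Measure.map_id
  · rw [plan, Measure.map_map measurable_snd hm]
    exact (measurePreserving_T hσ hbij).map_eq

lemma lintegral_refPlan (α : ℝ) {τ : I → ℤ} (hτ : Measurable τ) (F : I × I → ℝ≥0∞) :
    ∫⁻ p, F p ∂(refPlan α τ) = 3⁻¹ * (∫⁻ x, F (x, x) ∂leb + ∫⁻ x, F (x, rot α 1 x) ∂leb
      + ∫⁻ x, F (x, T α τ x) ∂leb) := by
  rw [refPlan, lintegral_smul_measure, lintegral_add_measure, lintegral_add_measure,
    lintegral_plan α measurable_const, lintegral_plan α measurable_const, lintegral_plan α hτ]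
  simp only [T_zero, T_one, smul_eq_mul]

lemma integrable_refPlan_iff (α : ℝ) {τ : I → ℤ} (hτ : Measurable τ) {F : I × I → ℝ} :
    Integrable F (refPlan α τ) ↔ Integrable (fun x => F (x, x)) leb ∧
      Integrable (fun x => F (x, rot α 1 x)) leb ∧ Integrable (fun x => F (x, T α τ x)) leb := by
  rw [refPlan, integrable_smul_measure (by norm_num) (by norm_num), integrable_add_measure,
    integrable_add_measure, integrable_plan_iff α measurable_const,
    integrable_plan_iff α measurable_const, integrable_plan_iff α hτ, and_assoc]
  simp only [T_zero, T_one]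

lemma integral_refPlan (α : ℝ) {τ : I → ℤ} (hτ : Measurable τ) {F : I × I → ℝ}
    (hF : Integrable F (refPlan α τ)) :
    ∫ p, F p ∂(refPlan α τ) = (∫ x, F (x, x) ∂leb + ∫ x, F (x, rot α 1 x) ∂leb
      + ∫ x, F (x, T α τ x) ∂leb) / 3 := by
  have h := (integrable_refPlan_iff α hτ).1 hF
  have h0 : Integrable F (plan α fun _ => 0) := by
    rw [integrable_plan_iff α measurable_const]; simpa only [T_zero] using h.1
  have h1 : Integrable F (plan α fun _ => 1) := by
    rw [integrable_plan_iff α measurable_const]; simpa only [T_one] using h.2.1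
  have h2 : Integrable F (plan α τ) := (integrable_plan_iff α hτ).2 h.2.2
  rw [refPlan, integral_smul_measure, integral_add_measure (h0.add_measure h1) h2,
    integral_add_measure h0 h1, integral_plan α measurable_const, integral_plan α measurable_const,
    integral_plan α hτ]
  simp only [T_zero, T_one, smul_eq_mul, ENNReal.toReal_inv, ENNReal.toReal_ofNat]
  ring

lemma ae_refPlan_iff (α : ℝ) {τ : I → ℤ} (hτ : Measurable τ) {P : I × I → Prop} :
    (∀ᵐ p ∂(refPlan α τ), P p) ↔ (∀ᵐ x ∂leb, P (x, x)) ∧ (∀ᵐ x ∂leb, P (x, rot α 1 x)) ∧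
      ∀ᵐ x ∂leb, P (x, T α τ x) := by
  rw [refPlan, Measure.ae_ennreal_smul_measure_iff (by norm_num), ae_add_measure_iff,
    ae_add_measure_iff, ae_plan_iff α measurable_const, ae_plan_iff α measurable_const,
    ae_plan_iff α hτ, and_assoc]
  simp only [T_zero, T_one]

lemma isProbabilityMeasure_refPlan (α : ℝ) {τ : I → ℤ} (hτ : Measurable τ) :
    IsProbabilityMeasure (refPlan α τ) := by
  refine ⟨?_⟩
  have h := lintegral_refPlan α hτ fun _ => 1
  simp only [lintegral_const, measure_univ, mul_one, one_mul] at h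
  rw [h, show (1 : ℝ≥0∞) + 1 + 1 = 3 by norm_num]
  exact ENNReal.inv_mul_cancel (by norm_num) (by norm_num)

lemma measurableSet_graph (α : ℝ) {σ : I → ℤ} (hσ : Measurable σ) :
    MeasurableSet (graph α σ) :=
  measurableSet_eq_fun measurable_snd ((measurable_T α hσ).comp measurable_fst)

/-! ### Values of h and of the cost on the three graphs. -/

namespace HasPotentials

variable {α : ℝ} {τ : I → ℤ} {φ : ℕ → I → ℝ}

lemma mem_graph_iff (α : ℝ) (σ : I → ℤ) (x y : I) : (x, y) ∈ graph α σ ↔ y = T α σ x := Iff.rfl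

lemma mem_graph_rot_iff (H : HasPotentials α τ φ) (σ : I → ℤ) (k : ℤ) (x : I) :
    (x, rot α k x) ∈ graph α σ ↔ k = σ x := by
  rw [mem_graph_iff, T, rot_eq_rot_iff H.irrational]

lemma mem_graph_diag_iff (H : HasPotentials α τ φ) (σ : I → ℤ) (x : I) :
    (x, x) ∈ graph α σ ↔ 0 = σ x := by
  rw [← H.mem_graph_rot_iff, rot_zero]

lemma mem_graph_T_iff (H : HasPotentials α τ φ) (σ : I → ℤ) (x : I) :
    (x, T α τ x) ∈ graph α σ ↔ τ x = σ x := H.mem_graph_rot_iff σ (τ x) x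

lemma shift_ne_zero (H : HasPotentials α τ φ) (x : I) : 0 ≠ τ x := by
  have := H.two_le x
  omega

lemma shift_ne_one (H : HasPotentials α τ φ) (x : I) : 1 ≠ τ x := by
  have := H.two_le x
  omega

lemma h_diag (H : HasPotentials α τ φ) (x : I) : h α x x = ((1 : ℝ) : EReal) := by
  have := h_rot H.irrational 0 x
  rwa [rot_zero, rho_zero, Int.cast_one] at this

lemma h_rot_one (H : HasPotentials α τ φ) (x : I) :
    h α x (rot α 1 x) = ((1 + sign x : ℝ) : EReal) := by
  rw [h_rot H.irrational, rho_one]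
  push_cast
  rfl

lemma h_T (H : HasPotentials α τ φ) (x : I) :
    h α x (T α τ x) = ((rho α (τ x) x : ℝ) : EReal) := h_rot H.irrational _ x

lemma cost_of_mem {x y : I}
    (hy : (x, y) ∈ graph α (fun _ => 0) ∪ graph α (fun _ => 1) ∪ graph α τ) :
    cost α τ x y = (h α x y).toENNReal := if_pos hy

lemma cost_diag (H : HasPotentials α τ φ) (x : I) : cost α τ x x = 1 := by
  rw [cost_of_mem (Or.inl (Or.inl (rot_zero α x).symm)), H.h_diag, EReal.real_coe_toENNReal,
    ENNReal.ofReal_one]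

lemma cost_rot_one (H : HasPotentials α τ φ) (x : I) :
    cost α τ x (rot α 1 x) = ENNReal.ofReal (1 + sign x) := by
  rw [cost_of_mem (x := x) (y := rot α 1 x) (Or.inl (Or.inr ((mem_graph_iff _ _ _ _).2 rfl))),
    H.h_rot_one, EReal.real_coe_toENNReal]

lemma cost_T (H : HasPotentials α τ φ) (x : I) :
    cost α τ x (T α τ x) = ENNReal.ofReal (rho α (τ x) x) := by
  rw [cost_of_mem (Or.inr ((mem_graph_iff _ _ _ _).2 rfl)), H.h_T, EReal.real_coe_toENNReal]

lemma cost_cases {P : I → I → Prop} (h0 : ∀ x, P x x) (h1 : ∀ x, P x (rot α 1 x))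
    (h2 : ∀ x, P x (T α τ x)) (h3 : ∀ x y, cost α τ x y = ⊤ → P x y) (x y : I) : P x y := by
  by_cases h : (x, y) ∈ graph α (fun _ => 0) ∪ graph α (fun _ => 1) ∪ graph α τ
  · rcases h with (h | h) | h
    · rw [mem_graph_iff, T_zero] at h
      rw [h]; exact h0 x
    · rw [mem_graph_iff, T_one] at h
      rw [h]; exact h1 x
    · rw [mem_graph_iff] at h
      rw [h]; exact h2 x
  · exact h3 x y (if_neg h)

lemma measurable_rho_shift (H : HasPotentials α τ φ) :
    Measurable fun x => (rho α (τ x) x : ℝ) :=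
  measurable_from_top.comp
    (measurable_rho_comp α H.measurable_shift fun x => by linarith [H.two_le x])

lemma measurable_sign_real : Measurable fun x => (sign x : ℝ) :=
  measurable_from_top.comp measurable_sign

lemma integrable_sign : Integrable (fun x => (sign x : ℝ)) leb := by
  refine Integrable.of_bound measurable_sign_real.aestronglyMeasurable 1 (ae_of_all _ fun x => ?_)
  unfold sign
  split_ifs <;> simp

lemma integrable_one_add_sign : Integrable (fun x => (1 + sign x : ℝ)) leb :=
  (integrable_const _).add integrable_sign

lemma neg_one_le_sign (x : I) : (-1 : ℝ) ≤ sign x := by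
  unfold sign
  split_ifs <;> norm_num

lemma integral_one_add_sign : ∫ x, (1 + sign x : ℝ) ∂leb = 1 := by
  rw [integral_add (integrable_const _) integrable_sign, integral_sign]
  simp

/-- The cost as a real-valued function. -/
def realCost (α : ℝ) (τ : I → ℤ) (p : I × I) : ℝ := (cost α τ p.1 p.2).toReal

/-- The function `h` as a real-valued function. -/
def realH (α : ℝ) (p : I × I) : ℝ := (h α p.1 p.2).toReal

lemma realH_diag (H : HasPotentials α τ φ) (x : I) : realH α (x, x) = 1 := by
  rw [realH, H.h_diag, EReal.toReal_coe]

lemma realH_rot_one (H : HasPotentials α τ φ) (x : I) :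
    realH α (x, rot α 1 x) = 1 + sign x := by
  rw [realH, H.h_rot_one, EReal.toReal_coe]

lemma realH_T (H : HasPotentials α τ φ) (x : I) : realH α (x, T α τ x) = rho α (τ x) x := by
  rw [realH, H.h_T, EReal.toReal_coe]

lemma realCost_diag (H : HasPotentials α τ φ) (x : I) : realCost α τ (x, x) = 1 := by
  rw [realCost, H.cost_diag, ENNReal.toReal_one]

lemma realCost_rot_one (H : HasPotentials α τ φ) (x : I) :
    realCost α τ (x, rot α 1 x) = 1 + sign x := by
  rw [realCost, H.cost_rot_one, ENNReal.toReal_ofReal (by linarith [neg_one_le_sign x])]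

lemma realCost_T (H : HasPotentials α τ φ) (x : I) :
    realCost α τ (x, T α τ x) = max (rho α (τ x) x : ℝ) 0 := by
  rw [realCost, H.cost_T, ENNReal.toReal_ofReal']

lemma integrable_realH (H : HasPotentials α τ φ) : Integrable (realH α) (refPlan α τ) := by
  rw [integrable_refPlan_iff α H.measurable_shift]
  simp only [H.realH_diag, H.realH_rot_one, H.realH_T]
  exact ⟨integrable_const _, integrable_one_add_sign, H.integrable_rho⟩

lemma integrable_realCost (H : HasPotentials α τ φ) :
    Integrable (realCost α τ) (refPlan α τ) := by
  rw [integrable_refPlan_iff α H.measurable_shift]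
  simp only [H.realCost_diag, H.realCost_rot_one, H.realCost_T]
  exact ⟨integrable_const _, integrable_one_add_sign,
    H.integrable_rho.pos_part⟩

lemma cost_eq_ofReal (H : HasPotentials α τ φ) :
    ∀ᵐ p ∂(refPlan α τ), cost α τ p.1 p.2 = ENNReal.ofReal (realCost α τ p) := by
  rw [ae_refPlan_iff α H.measurable_shift]
  refine ⟨ae_of_all _ fun x => ?_, ae_of_all _ fun x => ?_, ae_of_all _ fun x => ?_⟩
  · rw [H.realCost_diag, H.cost_diag, ENNReal.ofReal_one]
  · rw [H.realCost_rot_one, H.cost_rot_one]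
  · rw [H.realCost_T, H.cost_T, ENNReal.ofReal_max, ENNReal.ofReal_zero, max_eq_left zero_le]

lemma realCost_nonneg (p : I × I) : 0 ≤ realCost α τ p := ENNReal.toReal_nonneg

lemma integral_realH_plan (H : HasPotentials α τ φ) :
    ∫ p, realH α p ∂(plan α τ) = ∫ x, (rho α (τ x) x : ℝ) ∂leb := by
  rw [integral_plan α H.measurable_shift]
  simp only [H.realH_T]

lemma lintegral_cost_zero (H : HasPotentials α τ φ) :
    ∫⁻ p, cost α τ p.1 p.2 ∂(plan α fun _ => 0) = 1 := by
  rw [lintegral_plan α measurable_const]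
  simp only [T_zero, H.cost_diag]
  simp

lemma lintegral_cost_one (H : HasPotentials α τ φ) :
    ∫⁻ p, cost α τ p.1 p.2 ∂(plan α fun _ => 1) = 1 := by
  rw [lintegral_plan α measurable_const]
  simp only [T_one, H.cost_rot_one]
  rw [← ofReal_integral_eq_lintegral_ofReal integrable_one_add_sign
    (ae_of_all _ fun x => by
      have := neg_one_le_sign x
      simp only [Pi.zero_apply]
      linarith), integral_one_add_sign, ENNReal.ofReal_one]

lemma lintegral_cost_refPlan (H : HasPotentials α τ φ) :
    ∫⁻ p, cost α τ p.1 p.2 ∂(refPlan α τ) < ⊤ := by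
  rw [lintegral_congr_ae H.cost_eq_ofReal]
  exact H.integrable_realCost.lintegral_lt_top

lemma le_lintegral_cost (H : HasPotentials α τ φ) :
    ENNReal.ofReal (∫ p, realH α p ∂(plan α τ)) ≤ ∫⁻ p, cost α τ p.1 p.2 ∂(plan α τ) := by
  rw [lintegral_plan α H.measurable_shift, H.integral_realH_plan]
  simp only [H.cost_T]
  exact (ENNReal.ofReal_le_ofReal (integral_le_toReal_lintegral H.integrable_rho)).trans
    ENNReal.ofReal_toReal_le

end HasPotentials

/-! ### Admissible dual functions -/

/-- Bounded admissible dual functions whose values tend to one and whose sums tend to `h`. -/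
structure IsDualSequence (α : ℝ) (τ : I → ℤ) (φ ψ : ℕ → I → ℝ) : Prop where
  bounded : ∀ n, Measurable (φ n) ∧ Measurable (ψ n) ∧ ∃ C : ℝ, ∀ x, |φ n x| ≤ C ∧ |ψ n x| ≤ C
  le_cost : ∀ n x y, ((φ n x + ψ n y : ℝ) : EReal) ≤ ((cost α τ x y : ENNReal) : EReal)
  value : Tendsto (fun n => (∫ x, φ n x ∂leb) + ∫ y, ψ n y ∂leb) atTop (𝓝 1)
  ae_tendsto : ∀ᵐ p ∂(refPlan α τ),
    Tendsto (fun n => ((φ n p.1 + ψ n p.2 : ℝ) : EReal)) atTop (𝓝 (h α p.1 p.2))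

lemma integrable_of_bdd {f : I → ℝ} (hf : Measurable f) {C : ℝ} (hC : ∀ x, |f x| ≤ C) :
    Integrable f leb :=
  Integrable.of_bound hf.aestronglyMeasurable C (ae_of_all _ hC)

namespace HasPotentials

variable {α : ℝ} {τ : I → ℤ} {φ : ℕ → I → ℝ}

/-- The inverse of the bijection `T α τ`. -/
def inverse (H : HasPotentials α τ φ) : I → I := (Equiv.ofBijective _ H.bijective).symm

lemma inverse_T (H : HasPotentials α τ φ) (x : I) : H.inverse (T α τ x) = x :=
  (Equiv.ofBijective _ H.bijective).symm_apply_apply x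

lemma measurable_inverse (H : HasPotentials α τ φ) : Measurable H.inverse := by
  intro s hs
  have : H.inverse ⁻¹' s = T α τ '' s :=
    (Equiv.ofBijective _ H.bijective).image_eq_preimage_symm s |>.symm
  rw [this]
  exact (leb_T_image H.measurable_shift hs H.bijective.injective.injOn).1

lemma measurePreserving (H : HasPotentials α τ φ) : MeasurePreserving (T α τ) leb leb :=
  measurePreserving_T H.measurable_shift H.bijective

lemma measurePreserving_inverse (H : HasPotentials α τ φ) :
    MeasurePreserving H.inverse leb leb := by
  refine ⟨H.measurable_inverse, ?_⟩
  conv_lhs => rw [← H.measurePreserving.map_eq]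
  rw [Measure.map_map H.measurable_inverse H.measurePreserving.measurable]
  convert Measure.map_id
  funext x
  exact H.inverse_T x

/-- The defect along the rotation. -/
def defectRot (α : ℝ) (φ : ℕ → I → ℝ) (n : ℕ) (x : I) : ℝ :=
  max (φ n x - φ n (rot α 1 x) - sign x) 0

/-- The defect along `T α τ`. -/
def defectT (α : ℝ) (τ : I → ℤ) (φ : ℕ → I → ℝ) (n : ℕ) (x : I) : ℝ :=
  max (φ n x - φ n (T α τ x) - (max (rho α (τ x) x : ℝ) 0 - 1)) 0

/-- The second component of the admissible dual functions. -/
def second (H : HasPotentials α τ φ) (n : ℕ) (y : I) : ℝ :=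
  -- The defects are the positive excesses of φ_n ⊕ (1 - φ_n) over the cost on Γ_1 and Γ_τ, read at
  -- the preimages of y. Both are subtracted, so that a single function serves all three graphs.
  1 - φ n y - (defectRot α φ n (rot α (-1) y) + defectT α τ φ n (H.inverse y))

lemma measurable_defectRot (H : HasPotentials α τ φ) (n : ℕ) : Measurable (defectRot α φ n) :=
  (((H.measurable n).sub ((H.measurable n).comp (measurable_rot α 1))).sub
    measurable_sign_real).max measurable_const

lemma measurable_defectT (H : HasPotentials α τ φ) (n : ℕ) : Measurable (defectT α τ φ n) :=
  (((H.measurable n).sub ((H.measurable n).comp (measurable_T α H.measurable_shift))).sub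
    ((H.measurable_rho_shift.max measurable_const).sub_const 1)).max measurable_const

lemma defectRot_bounds {n : ℕ} {C : ℝ} (hC : ∀ x, |φ n x| ≤ C) (x : I) :
    |defectRot α φ n x| ≤ 2 * C + 1 := by
  have h1 := abs_le.1 (hC x)
  have h2 := abs_le.1 (hC (rot α 1 x))
  have h3 := neg_one_le_sign x
  rw [defectRot, abs_of_nonneg (le_max_right _ _)]
  exact max_le (by linarith) (by linarith)

lemma defectT_bounds {n : ℕ} {C : ℝ} (hC : ∀ x, |φ n x| ≤ C) (x : I) :
    |defectT α τ φ n x| ≤ 2 * C + 1 := by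
  have h1 := abs_le.1 (hC x)
  have h2 := abs_le.1 (hC (T α τ x))
  have h3 := le_max_right (rho α (τ x) x : ℝ) 0
  rw [defectT, abs_of_nonneg (le_max_right _ _)]
  exact max_le (by linarith) (by linarith)

lemma tendsto_integral_of_lintegral {f : ℕ → I → ℝ} (hm : ∀ n, Measurable (f n))
    (h0 : ∀ n x, 0 ≤ f n x) (h : Tendsto (fun n => ∫⁻ x, ENNReal.ofReal (f n x) ∂leb) atTop (𝓝 0)) :
    Tendsto (fun n => ∫ x, f n x ∂leb) atTop (𝓝 0) := by
  have e : ∀ n, ∫ x, f n x ∂leb = (∫⁻ x, ENNReal.ofReal (f n x) ∂leb).toReal := fun n =>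
    integral_eq_lintegral_of_nonneg_ae (ae_of_all _ (h0 n)) (hm n).aestronglyMeasurable
  simp_rw [e]
  exact (ENNReal.tendsto_toReal ENNReal.zero_ne_top).comp h

lemma tendsto_defectRot (H : HasPotentials α τ φ) :
    Tendsto (fun n => ∫ x, defectRot α φ n x ∂leb) atTop (𝓝 0) := by
  refine tendsto_integral_of_lintegral H.measurable_defectRot (fun n x => le_max_right _ _) ?_
  simp only [defectRot, ENNReal.ofReal_max, ENNReal.ofReal_zero, zero_le, sup_of_le_left]
  exact H.lim_rot

lemma tendsto_defectT (H : HasPotentials α τ φ) :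
    Tendsto (fun n => ∫ x, defectT α τ φ n x ∂leb) atTop (𝓝 0) := by
  refine tendsto_integral_of_lintegral H.measurable_defectT (fun n x => le_max_right _ _) ?_
  simp only [defectT, ENNReal.ofReal_max, ENNReal.ofReal_zero, zero_le, sup_of_le_left]
  refine tendsto_of_tendsto_of_tendsto_of_le_of_le tendsto_const_nhds H.lim_T (fun _ => zero_le)
    fun n => lintegral_mono fun x => ENNReal.ofReal_le_ofReal ?_
  have := le_max_left (rho α (τ x) x : ℝ) 0
  linarith

/-- On the diagonal φ_n + (1 - φ_n) is exactly the cost 1; on the other graphs the subtracted defect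
restores admissibility. The inverse maps preserve measure, so the value is 1 minus the integrals of
the defects, which tend to zero. Almost everywhere the defects vanish eventually, and the sums then
equal h. -/
lemma isDualSequence (H : HasPotentials α τ φ) : IsDualSequence α τ φ H.second := by
  have hsm : ∀ n, Measurable (H.second n) := fun n =>
    ((H.measurable n).const_sub 1).sub (((H.measurable_defectRot n).comp (measurable_rot α _)).add
      ((H.measurable_defectT n).comp H.measurable_inverse))
  have hd : ∀ n y, 0 ≤ defectRot α φ n (rot α (-1) y) ∧ 0 ≤ defectT α τ φ n (H.inverse y) :=
    fun n y => ⟨le_max_right _ _, le_max_right _ _⟩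
  refine ⟨fun n => ?_, fun n => ?_, ?_, ?_⟩
  · obtain ⟨C, hC⟩ := H.bounded n
    refine ⟨H.measurable n, hsm n, 5 * C + 3, fun x => ?_⟩
    have h0 : 0 ≤ C := (abs_nonneg _).trans (hC x)
    have h1 := abs_le.1 (hC x)
    have h2 := abs_le.1 (defectRot_bounds (α := α) hC (rot α (-1) x))
    have h3 := abs_le.1 (defectT_bounds (α := α) (τ := τ) hC (H.inverse x))
    constructor
    · exact (hC x).trans (by linarith)
    · rw [abs_le, second]
      constructor <;> linarith [h1.1, h1.2, h2.1, h2.2, h3.1, h3.2]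
  · refine cost_cases (α := α) (τ := τ) (fun x => ?_) (fun x => ?_) (fun x => ?_) fun x y hxy => ?_
    · rw [H.cost_diag, EReal.coe_ennreal_one, ← EReal.coe_one, EReal.coe_le_coe_iff, second]
      linarith [hd n x]
    · rw [H.cost_rot_one, EReal.coe_ennreal_ofReal, EReal.coe_le_coe_iff]
      refine le_max_of_le_left ?_
      have h1 := hd n (rot α 1 x)
      rw [second, rot_neg_rot] at *
      have h2 : φ n x - φ n (rot α 1 x) - sign x ≤ defectRot α φ n x := le_max_left _ _
      linarith
    · rw [H.cost_T, EReal.coe_ennreal_ofReal, EReal.coe_le_coe_iff]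
      have h1 := hd n (T α τ x)
      rw [second, H.inverse_T] at *
      have h2 : φ n x - φ n (T α τ x) - (max (rho α (τ x) x : ℝ) 0 - 1) ≤ defectT α τ φ n x :=
        le_max_left _ _
      linarith
    · rw [hxy]
      exact le_top
  · have h1 : ∀ n, (∫ x, φ n x ∂leb) + ∫ y, H.second n y ∂leb
        = 1 - (∫ x, defectRot α φ n x ∂leb + ∫ x, defectT α τ φ n x ∂leb) := by
      intro n
      obtain ⟨C, hC⟩ := H.bounded n
      have i1 := integrable_of_bdd (H.measurable n) hC
      have i2 := integrable_of_bdd (H.measurable_defectRot n) (defectRot_bounds hC)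
      have i3 := integrable_of_bdd (H.measurable_defectT n) (defectT_bounds hC)
      have m2 := measurePreserving_rot α (-1)
      have m3 := H.measurePreserving_inverse
      have i2' : Integrable (fun y => defectRot α φ n (rot α (-1) y)) leb :=
        (m2.integrable_comp i2.aestronglyMeasurable).2 i2
      have i3' : Integrable (fun y => defectT α τ φ n (H.inverse y)) leb :=
        (m3.integrable_comp i3.aestronglyMeasurable).2 i3
      have e2 : ∫ y, defectRot α φ n (rot α (-1) y) ∂leb = ∫ x, defectRot α φ n x ∂leb := by
        conv_rhs => rw [← m2.map_eq]
        rw [integral_map m2.measurable.aemeasurable]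
        rw [m2.map_eq]; exact i2.aestronglyMeasurable
      have e3 : ∫ y, defectT α τ φ n (H.inverse y) ∂leb = ∫ x, defectT α τ φ n x ∂leb := by
        conv_rhs => rw [← m3.map_eq]
        rw [integral_map m3.measurable.aemeasurable]
        rw [m3.map_eq]; exact i3.aestronglyMeasurable
      have e4 : ∫ y, H.second n y ∂leb = 1 - ∫ x, φ n x ∂leb
          - (∫ x, defectRot α φ n x ∂leb + ∫ x, defectT α τ φ n x ∂leb) := by
        rw [← e2, ← e3, ← integral_add i2' i3']
        have e5 : (1 : ℝ) - ∫ x, φ n x ∂leb = ∫ x, (1 - φ n x) ∂leb := by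
          rw [integral_sub (integrable_const _) i1]; simp
        rw [e5]
        exact integral_sub ((integrable_const _).sub i1) (i2'.add i3')
      rw [e4]
      ring
    simp_rw [h1]
    simpa using (H.tendsto_defectRot.add H.tendsto_defectT).const_sub 1
  · have hrot : ∀ᵐ x ∂leb, ∀ᶠ n in atTop, defectRot α φ n x = 0 := by
      filter_upwards [H.ae_rot] with x hx
      filter_upwards [hx] with n hn
      rw [defectRot, hn, sub_self, max_self]
    have hT : ∀ᵐ x ∂leb, ∀ᶠ n in atTop, defectT α τ φ n x = 0 := by
      filter_upwards [H.ae_T] with x hx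
      filter_upwards [hx] with n hn
      rw [defectT, hn]
      apply max_eq_right
      linarith [le_max_left (rho α (τ x) x : ℝ) 0]
    have hboth : ∀ᵐ y ∂leb, ∀ᶠ n in atTop, H.second n y = 1 - φ n y := by
      filter_upwards [(measurePreserving_rot α (-1)).quasiMeasurePreserving.ae hrot,
        H.measurePreserving_inverse.quasiMeasurePreserving.ae hT] with y h1 h2
      filter_upwards [h1, h2] with n h1 h2
      rw [second, h1, h2, add_zero, sub_zero]
    rw [ae_refPlan_iff α H.measurable_shift]
    refine ⟨?_, ?_, ?_⟩
    · filter_upwards [hboth] with x hx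
      rw [H.h_diag]
      refine tendsto_const_nhds.congr' ?_
      filter_upwards [hx] with n hn
      simp only [hn, add_sub_cancel]
    · filter_upwards [(measurePreserving_rot α 1).quasiMeasurePreserving.ae hboth, H.ae_rot]
        with x hx hx'
      rw [H.h_rot_one]
      refine tendsto_const_nhds.congr' ?_
      filter_upwards [hx, hx'] with n hn hn'
      simp only [hn]
      congr 1
      linarith
    · filter_upwards [H.measurePreserving.quasiMeasurePreserving.ae hboth, H.ae_T]
        with x hx hx'
      rw [H.h_T]
      refine tendsto_const_nhds.congr' ?_
      filter_upwards [hx, hx'] with n hn hn'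
      simp only [hn]
      congr 1
      linarith

/-- Weak duality along the admissible sequence. -/
lemma one_le_lintegral_cost (H : HasPotentials α τ φ) {ρ : Measure (I × I)}
    (hρ : IsTransportPlan leb leb ρ) : 1 ≤ ∫⁻ p, cost α τ p.1 p.2 ∂ρ := by
  have D := H.isDualSequence
  have h1 := (ENNReal.tendsto_ofReal D.value)
  rw [ENNReal.ofReal_one] at h1
  refine le_of_tendsto' h1 fun n => ?_
  obtain ⟨hm1, hm2, C, hC⟩ := D.bounded n
  have mp1 : MeasurePreserving Prod.fst ρ leb := ⟨measurable_fst, hρ.1⟩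
  have mp2 : MeasurePreserving Prod.snd ρ leb := ⟨measurable_snd, hρ.2⟩
  have i1 := integrable_of_bdd hm1 fun x => (hC x).1
  have i2 := integrable_of_bdd hm2 fun x => (hC x).2
  have e1 : ∫ x, φ n x ∂leb = ∫ p, φ n p.1 ∂ρ := by
    rw [← mp1.map_eq, integral_map mp1.measurable.aemeasurable hm1.aestronglyMeasurable]
  have e2 : ∫ x, H.second n x ∂leb = ∫ p, H.second n p.2 ∂ρ := by
    rw [← mp2.map_eq, integral_map mp2.measurable.aemeasurable hm2.aestronglyMeasurable]
  have j1 : Integrable (fun p : I × I => φ n p.1) ρ :=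
    (mp1.integrable_comp hm1.aestronglyMeasurable).2 i1
  have j2 : Integrable (fun p : I × I => H.second n p.2) ρ :=
    (mp2.integrable_comp hm2.aestronglyMeasurable).2 i2
  rw [e1, e2, ← integral_add j1 j2]
  have j : Integrable (fun p : I × I => φ n p.1 + H.second n p.2) ρ := j1.add j2
  refine (ENNReal.ofReal_le_ofReal (integral_le_toReal_lintegral j)).trans
    (ENNReal.ofReal_toReal_le.trans (lintegral_mono fun p => ?_))
  have h2 := EReal.toENNReal_le_toENNReal (D.le_cost n p.1 p.2)
  rwa [EReal.real_coe_toENNReal, EReal.toENNReal_coe] at h2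

end HasPotentials

/-! ### Functionals on `L^∞` -/

section Functionals

variable {Z : Type*} [MeasurableSpace Z] {π : Measure Z}

/-- The functional on `L^∞` defined by an integrable function. -/
def pairing (r : Lp ℝ 1 π) : L1Bidual π :=
  (ContinuousLinearMap.mul ℝ ℝ).lpPairing π 1 ∞ r

lemma pairing_apply (r : Lp ℝ 1 π) (f : Lp ℝ ∞ π) : pairing r f = ∫ z, r z * f z ∂π :=
  ContinuousLinearMap.lpPairing_eq_integral _ _ _

/-- Bounded measurable functions. -/
def IsTest (F : Z → ℝ) : Prop := Measurable F ∧ ∃ C, ∀ z, |F z| ≤ C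

lemma IsTest.const (C : ℝ) : IsTest fun _ : Z => C := ⟨measurable_const, |C|, fun _ => le_rfl⟩

lemma IsTest.add {F G : Z → ℝ} (hF : IsTest F) (hG : IsTest G) : IsTest fun z => F z + G z := by
  obtain ⟨C, hC⟩ := hF.2
  obtain ⟨D, hD⟩ := hG.2
  exact ⟨hF.1.add hG.1, C + D, fun z => (abs_add_le _ _).trans (add_le_add (hC z) (hD z))⟩

lemma IsTest.const_mul {F : Z → ℝ} (hF : IsTest F) (c : ℝ) : IsTest fun z => c * F z := by
  obtain ⟨C, hC⟩ := hF.2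
  exact ⟨hF.1.const_mul c, |c| * C, fun z => by
    rw [abs_mul]; exact mul_le_mul_of_nonneg_left (hC z) (abs_nonneg c)⟩

lemma IsTest.indicator {F : Z → ℝ} (hF : IsTest F) {A : Set Z} (hA : MeasurableSet A) :
    IsTest (A.indicator F) := by
  obtain ⟨C, hC⟩ := hF.2
  refine ⟨hF.1.indicator hA, C, fun z => ?_⟩
  by_cases hz : z ∈ A
  · rw [Set.indicator_of_mem hz]; exact hC z
  · rw [Set.indicator_of_notMem hz, abs_zero]; exact (abs_nonneg _).trans (hC z)

lemma IsTest.comp {Y : Type*} [MeasurableSpace Y] {F : Z → ℝ} (hF : IsTest F) {g : Y → Z}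
    (hg : Measurable g) : IsTest fun y => F (g y) :=
  ⟨hF.1.comp hg, hF.2.imp fun _ hC y => hC (g y)⟩

lemma IsTest.sum {ι : Type*} (s : Finset ι) {F : ι → Z → ℝ} (hF : ∀ i ∈ s, IsTest (F i)) :
    IsTest fun z => ∑ i ∈ s, F i z := by
  classical
  induction s using Finset.induction_on with
  | empty => simpa using IsTest.const (Z := Z) 0
  | insert i s hi ih =>
    simp only [Finset.sum_insert hi]
    exact (hF i (Finset.mem_insert_self _ _)).add
      (ih fun j hj => hF j (Finset.mem_insert_of_mem hj))

lemma IsTest.memLp {F : Z → ℝ} (hF : IsTest F) : MemLp F ∞ π := by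
  obtain ⟨C, hC⟩ := hF.2
  exact memLp_top_of_bound hF.1.aestronglyMeasurable C (ae_of_all _ hC)

lemma IsTest.integrable_mul {F K : Z → ℝ} (hF : IsTest F) (hK : Integrable K π) :
    Integrable (fun z => K z * F z) π := by
  obtain ⟨C, hC⟩ := hF.2
  exact hK.mul_bdd hF.1.aestronglyMeasurable (ae_of_all _ hC)

variable (π) in
open Classical in
/-- The class of a bounded measurable function in `L^∞`. -/
def toLinf (F : Z → ℝ) : Lp ℝ ∞ π := if hF : MemLp F ∞ π then hF.toLp F else 0

lemma IsTest.coeFn_toLinf {F : Z → ℝ} (hF : IsTest F) : toLinf π F =ᵐ[π] F := by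
  rw [toLinf, dif_pos hF.memLp]
  exact hF.memLp.coeFn_toLp

lemma toLinf_congr {F G : Z → ℝ} (hF : IsTest F) (hG : IsTest G) (hFG : F =ᵐ[π] G) :
    toLinf π F = toLinf π G :=
  Lp.ext (hF.coeFn_toLinf.trans (hFG.trans hG.coeFn_toLinf.symm))

lemma toLinf_eq {F : Z → ℝ} (hF : IsTest F) {f : Lp ℝ ∞ π} (h : f =ᵐ[π] F) : f = toLinf π F :=
  Lp.ext (h.trans hF.coeFn_toLinf.symm)

lemma toLinf_add {F G : Z → ℝ} (hF : IsTest F) (hG : IsTest G) :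
    toLinf π (fun z => F z + G z) = toLinf π F + toLinf π G := by
  symm
  apply toLinf_eq (hF.add hG)
  filter_upwards [Lp.coeFn_add (toLinf π F) (toLinf π G), hF.coeFn_toLinf (π := π),
    hG.coeFn_toLinf (π := π)] with z h1 h2 h3
  rw [h1, Pi.add_apply, h2, h3]

lemma toLinf_const_mul {F : Z → ℝ} (hF : IsTest F) (c : ℝ) :
    toLinf π (fun z => c * F z) = c • toLinf π F := by
  symm
  apply toLinf_eq (hF.const_mul c)
  filter_upwards [Lp.coeFn_smul c (toLinf π F), hF.coeFn_toLinf (π := π)] with z h1 h2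
  rw [h1, Pi.smul_apply, h2, smul_eq_mul]

/-- Truncation at the norm gives a representative bounded at every point, so that later arguments
can be pointwise. -/
lemma exists_isTest (f : Lp ℝ ∞ π) : ∃ F : Z → ℝ, IsTest F ∧ (∀ z, |F z| ≤ ‖f‖) ∧
    f = toLinf π F := by
  have hm : Measurable f := (Lp.stronglyMeasurable f).measurable
  have hb : ∀ z, |max (-‖f‖) (min ‖f‖ (f z))| ≤ ‖f‖ := fun z => by
    have := norm_nonneg f
    rw [abs_le]
    exact ⟨le_max_left _ _, max_le (by linarith) (min_le_left _ _)⟩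
  have ht : IsTest fun z => max (-‖f‖) (min ‖f‖ (f z)) :=
    ⟨measurable_const.max (measurable_const.min hm), ‖f‖, hb⟩
  refine ⟨_, ht, hb, toLinf_eq ht ?_⟩
  filter_upwards [enorm_ae_le_eLpNormEssSup f π] with z hz
  rw [← eLpNorm_exponent_top, ← Lp.enorm_def, enorm_le_iff_norm_le] at hz
  rw [Real.norm_eq_abs, abs_le] at hz
  rw [min_eq_right hz.2, max_eq_right hz.1]

lemma IsTest.pairing_toLinf {F K : Z → ℝ} (hF : IsTest F) (hK : Integrable K π) :
    pairing (hK.toL1 K) (toLinf π F) = ∫ z, K z * F z ∂π := by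
  rw [pairing_apply]
  refine integral_congr_ae ?_
  filter_upwards [hK.coeFn_toL1, hF.coeFn_toLinf (π := π)] with z h1 h2
  rw [h1, h2]

lemma PurelySingular.sub {s t : L1Bidual π} (hs : PurelySingular s) (ht : PurelySingular t) :
    PurelySingular (s - t) := by
  intro ε hε
  obtain ⟨A, hA, hA', hsA⟩ := hs (ε / 2) (ENNReal.half_pos hε.ne')
  obtain ⟨B, hB, hB', htB⟩ := ht (ε / 2) (ENNReal.half_pos hε.ne')
  refine ⟨A ∪ B, hA.union hB, ?_, fun f hf => ?_⟩
  · refine (measure_union_le A B).trans_lt ?_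
    calc π A + π B < ε / 2 + ε / 2 := ENNReal.add_lt_add hA' hB'
      _ = ε := ENNReal.add_halves ε
  · change s f - t f = 0
    rw [hsA f (hf.mono fun z hz h => hz (Or.inl h)), htB f (hf.mono fun z hz h => hz (Or.inr h)),
      sub_zero]

/-- Take A smaller in measure than {r ≠ 0} and test with the sign of r off A: then r vanishes off A,
so {r ≠ 0} is contained in A up to a null set, a contradiction. -/
lemma eq_zero_of_purelySingular {r : Lp ℝ 1 π} (hr : PurelySingular (pairing r)) : r = 0 := by
  have hm : Measurable r := (Lp.stronglyMeasurable r).measurable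
  have hi : Integrable r π := L1.integrable_coeFn r
  rw [Lp.eq_zero_iff_ae_eq_zero]
  have h0 : π {z | r z ≠ 0} = 0 := by
    by_contra hne
    obtain ⟨A, hA, hlt, hA0⟩ := hr _ (pos_iff_ne_zero.2 hne)
    have hS : IsTest fun z => if 0 ≤ r z then (1 : ℝ) else -1 := by
      refine ⟨Measurable.ite (measurableSet_le measurable_const hm) measurable_const
        measurable_const, 1, fun z => ?_⟩
      dsimp only
      split_ifs <;> simp
    have hT := hS.indicator hA.compl
    have h1 := hA0 (toLinf π _) (by
      filter_upwards [hT.coeFn_toLinf (π := π)] with z hz hzA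
      rw [hz, Set.indicator_of_notMem (show z ∉ Aᶜ from fun h => h hzA)])
    rw [pairing_apply] at h1
    have h2 : ∫ z, Aᶜ.indicator (fun z => |r z|) z ∂π = 0 := by
      rw [← h1]
      refine integral_congr_ae ?_
      filter_upwards [hT.coeFn_toLinf (π := π)] with z hz
      rw [hz]
      by_cases hzA : z ∈ Aᶜ
      · rw [Set.indicator_of_mem hzA, Set.indicator_of_mem hzA]
        split_ifs with h
        · rw [abs_of_nonneg h, mul_one]
        · rw [abs_of_neg (not_le.1 h), mul_neg_one]
      · rw [Set.indicator_of_notMem hzA, Set.indicator_of_notMem hzA, mul_zero]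
    rw [integral_eq_zero_iff_of_nonneg (Set.indicator_nonneg fun z _ => abs_nonneg _)
      (hi.abs.indicator hA.compl)] at h2
    refine hlt.not_ge (measure_mono_ae ?_)
    filter_upwards [h2] with z hz hrz
    by_contra hzA
    rw [Set.indicator_of_mem (show z ∈ Aᶜ from hzA)] at hz
    exact hrz (abs_eq_zero.1 hz)
  exact measure_eq_zero_iff_ae_notMem.1 h0 |>.mono fun z hz => not_not.1 hz

lemma IsDecomposition.unique {ξ : L1Bidual π} {r r' : Lp ℝ 1 π} {s s' : L1Bidual π}
    (h : IsDecomposition ξ r s) (h' : IsDecomposition ξ r' s') : r = r' ∧ s = s' := by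
  have e : ∀ {r s}, IsDecomposition ξ r s → ξ = pairing r + s := fun {r s} h => by
    ext f
    rw [h.2 f, ← pairing_apply]
    rfl
  have h1 : pairing (r - r') = s' - s := by
    have h2 : pairing (r - r') = pairing r - pairing r' := map_sub _ r r'
    have h3 := (e h).symm.trans (e h')
    rw [h2, sub_eq_sub_iff_add_eq_add, h3, add_comm]
  have h4 : r - r' = 0 := eq_zero_of_purelySingular (by rw [h1]; exact h'.1.sub h.1)
  refine ⟨sub_eq_zero.1 h4, ?_⟩
  have h5 : pairing (r - r') = 0 := by rw [h4]; exact map_zero _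
  rw [h1] at h5
  exact (sub_eq_zero.1 h5).symm

end Functionals

lemma integral_mul_eq_zero_of_mem_sumSpace {X Y : Type*} [MeasurableSpace X] [MeasurableSpace Y]
    {μ : Measure X} {ν : Measure Y} {π : Measure (X × Y)} {f : Lp ℝ ∞ π}
    (hf : ∀ (φ : X → ℝ) (ψ : Y → ℝ), Integrable φ μ → Integrable ψ ν →
      ∫ p, (φ p.1 + ψ p.2) * f p ∂π = 0) {g : Lp ℝ 1 π} (hg : g ∈ sumSpace μ ν π) :
    ∫ p, g p * f p ∂π = 0 := by
  set L : Lp ℝ 1 π →L[ℝ] ℝ := ((ContinuousLinearMap.mul ℝ ℝ).lpPairing π 1 ∞).flip f with hL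
  have hLg : ∀ g, L g = ∫ p, g p * f p ∂π := fun g => pairing_apply g f
  have hle : sumSpace μ ν π ≤ LinearMap.ker L.toLinearMap := by
    refine Submodule.topologicalClosure_minimal _ ?_ L.isClosed_ker
    rw [Submodule.span_le]
    rintro g ⟨φ, ψ, hφ, hψ, hg⟩
    change L g = 0
    rw [hLg, ← hf φ ψ hφ hψ]
    refine integral_congr_ae ?_
    filter_upwards [hg] with p hp
    rw [hp]
  rw [← hLg]
  exact hle hg

namespace HasPotentials

variable {α : ℝ} {τ : I → ℤ} {φ : ℕ → I → ℝ}

/-! ### The dual value -/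

/-- The diagonal alone suffices: it has weight 1/3 in π and cost 1, so a total excess of at most ε
bounds the dual value by 1 + 3ε. -/
lemma dualValue_le_one (H : HasPotentials α τ φ) :
    dualValue (cost α τ) leb leb (refPlan α τ) ≤ 1 := by
  have key : ∀ z : ℝ, ((1 : ℝ) : EReal) < z → dualValue (cost α τ) leb leb (refPlan α τ) ≤ z := by
    intro z hz
    have hz1 : 1 < z := EReal.coe_lt_coe_iff.1 hz
    refine (iInf₂_le ((z - 1) / 3) (by linarith)).trans (sSup_le ?_)
    rintro v ⟨f, g, hf, hg, hfg, rfl⟩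
    rw [EReal.coe_le_coe_iff]
    rw [lintegral_refPlan α H.measurable_shift] at hfg
    have hd : ∀ x, (((f x + g x : ℝ) : EReal) - ((cost α τ x x : ℝ≥0∞) : EReal)).toENNReal
        = ENNReal.ofReal (f x + g x - 1) := fun x => by
      rw [H.cost_diag, EReal.coe_ennreal_one, ← EReal.coe_one, ← EReal.coe_sub,
        EReal.real_coe_toENNReal]
    simp only [hd] at hfg
    have h1 : ∫⁻ x, ENNReal.ofReal (f x + g x - 1) ∂leb ≤ ENNReal.ofReal (z - 1) := by
      have h2 := (mul_le_mul_right (le_self_add.trans le_self_add) (3⁻¹ : ℝ≥0∞)).trans hfg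
      rw [ENNReal.inv_mul_le_iff (by norm_num) (by norm_num)] at h2
      refine h2.trans_eq ?_
      rw [show (3 : ℝ≥0∞) = ENNReal.ofReal 3 by simp, ← ENNReal.ofReal_mul (by norm_num)]
      congr 1
      ring
    have hi : Integrable (fun x => f x + g x - 1) leb := (hf.add hg).sub (integrable_const _)
    have h3 := (integral_le_toReal_lintegral hi).trans
      (ENNReal.toReal_le_of_le_ofReal (by linarith) h1)
    have h4 : ∫ x, (f x + g x - 1) ∂leb = ∫ x, f x ∂leb + ∫ x, g x ∂leb - 1 := by
      rw [integral_sub (f := fun x => f x + g x) (hf.add hg) (integrable_const _),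
        integral_add hf hg]
      simp
    linarith
  have := EReal.le_of_forall_lt_iff_le.1 key
  rwa [EReal.coe_one] at this

lemma one_le_dualValue (H : HasPotentials α τ φ) :
    1 ≤ dualValue (cost α τ) leb leb (refPlan α τ) := by
  have D := H.isDualSequence
  refine le_iInf₂ fun ε hε => ?_
  have hv := (continuous_coe_real_ereal.tendsto 1).comp D.value
  rw [EReal.coe_one] at hv
  refine le_of_tendsto' hv fun n => le_sSup ?_
  obtain ⟨hm1, hm2, C, hC⟩ := D.bounded n
  refine ⟨φ n, H.second n, integrable_of_bdd hm1 fun x => (hC x).1,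
    integrable_of_bdd hm2 fun x => (hC x).2, ?_, rfl⟩
  refine le_of_eq_of_le ?_ zero_le
  rw [← lintegral_zero (μ := refPlan α τ)]
  exact lintegral_congr fun p =>
    EReal.toENNReal_of_nonpos (EReal.sub_nonpos.2 (D.le_cost n p.1 p.2))

lemma dualValue_eq_one (H : HasPotentials α τ φ) :
    dualValue (cost α τ) leb leb (refPlan α τ) = 1 :=
  le_antisymm H.dualValue_le_one H.one_le_dualValue

/-! ### Functions on the union of the three graphs -/

/-- The function on `I × I` which is `u`, `v`, `w` as a function of the first variable on the
graphs of `T^(0)`, `T^(1)`, `T^(τ)`, and `0` elsewhere. -/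
def glue (α : ℝ) (τ : I → ℤ) (u v w : I → ℝ) (p : I × I) : ℝ :=
  (graph α fun _ => 0).indicator (fun p => u p.1) p +
    (graph α fun _ => 1).indicator (fun p => v p.1) p +
    (graph α τ).indicator (fun p => w p.1) p

lemma isTest_glue (H : HasPotentials α τ φ) {u v w : I → ℝ} (hu : IsTest u) (hv : IsTest v)
    (hw : IsTest w) : IsTest (glue α τ u v w) :=
  (((hu.comp measurable_fst).indicator (measurableSet_graph α measurable_const)).add
    ((hv.comp measurable_fst).indicator (measurableSet_graph α measurable_const))).add
    ((hw.comp measurable_fst).indicator (measurableSet_graph α H.measurable_shift))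

lemma glue_diag (H : HasPotentials α τ φ) (u v w : I → ℝ) (x : I) :
    glue α τ u v w (x, x) = u x := by
  rw [glue, Set.indicator_of_mem ((H.mem_graph_diag_iff _ x).2 rfl),
    Set.indicator_of_notMem (mt (H.mem_graph_diag_iff _ x).1 (by norm_num)),
    Set.indicator_of_notMem (mt (H.mem_graph_diag_iff _ x).1 (H.shift_ne_zero x)), add_zero,
    add_zero]

lemma glue_rot_one (H : HasPotentials α τ φ) (u v w : I → ℝ) (x : I) :
    glue α τ u v w (x, rot α 1 x) = v x := by
  rw [glue, Set.indicator_of_notMem (mt (H.mem_graph_rot_iff _ 1 x).1 (by norm_num)),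
    Set.indicator_of_mem ((H.mem_graph_rot_iff _ 1 x).2 rfl),
    Set.indicator_of_notMem (mt (H.mem_graph_rot_iff _ 1 x).1 (H.shift_ne_one x)), zero_add,
    add_zero]

lemma glue_T (H : HasPotentials α τ φ) (u v w : I → ℝ) (x : I) :
    glue α τ u v w (x, T α τ x) = w x := by
  rw [glue, Set.indicator_of_notMem (mt (H.mem_graph_T_iff _ x).1 (H.shift_ne_zero x).symm),
    Set.indicator_of_notMem (mt (H.mem_graph_T_iff _ x).1 (H.shift_ne_one x).symm),
    Set.indicator_of_mem ((H.mem_graph_T_iff _ x).2 rfl), zero_add, zero_add]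

lemma toLinf_eq_glue (H : HasPotentials α τ φ) {F : I × I → ℝ} (hF : IsTest F) :
    toLinf (refPlan α τ) F = toLinf (refPlan α τ)
      (glue α τ (fun x => F (x, x)) (fun x => F (x, rot α 1 x)) fun x => F (x, T α τ x)) := by
  refine toLinf_congr hF (H.isTest_glue (hF.comp (measurable_id.prodMk measurable_id))
    (hF.comp (measurable_id.prodMk (measurable_rot α 1)))
    (hF.comp (measurable_id.prodMk (measurable_T α H.measurable_shift)))) ?_
  refine (ae_refPlan_iff α H.measurable_shift).2
    ⟨ae_of_all _ fun x => ?_, ae_of_all _ fun x => ?_, ae_of_all _ fun x => ?_⟩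
  · rw [H.glue_diag]
  · rw [H.glue_rot_one]
  · rw [H.glue_T]

lemma toLinf_glue_add (H : HasPotentials α τ φ) {u v w u' v' w' : I → ℝ} (hu : IsTest u)
    (hv : IsTest v) (hw : IsTest w) (hu' : IsTest u') (hv' : IsTest v') (hw' : IsTest w') :
    toLinf (refPlan α τ) (glue α τ (fun x => u x + u' x) (fun x => v x + v' x)
      fun x => w x + w' x) =
    toLinf (refPlan α τ) (glue α τ u v w) + toLinf (refPlan α τ) (glue α τ u' v' w') := by
  rw [← toLinf_add (H.isTest_glue hu hv hw) (H.isTest_glue hu' hv' hw')]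
  congr 1
  funext p
  simp only [glue, Set.indicator]
  split_ifs <;> ring

lemma toLinf_glue_const_mul (H : HasPotentials α τ φ) {u v w : I → ℝ} (hu : IsTest u)
    (hv : IsTest v) (hw : IsTest w) (c : ℝ) :
    toLinf (refPlan α τ) (glue α τ (fun x => c * u x) (fun x => c * v x) fun x => c * w x) =
    c • toLinf (refPlan α τ) (glue α τ u v w) := by
  rw [← toLinf_const_mul (H.isTest_glue hu hv hw)]
  congr 1
  funext p
  simp only [glue, Set.indicator]
  split_ifs <;> ring

lemma integral_mul_glue (H : HasPotentials α τ φ) {u v w : I → ℝ} (hu : IsTest u) (hv : IsTest v)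
    (hw : IsTest w) {K : I × I → ℝ} (hK : Integrable K (refPlan α τ)) :
    ∫ p, K p * glue α τ u v w p ∂(refPlan α τ) = (∫ x, K (x, x) * u x ∂leb
      + ∫ x, K (x, rot α 1 x) * v x ∂leb + ∫ x, K (x, T α τ x) * w x ∂leb) / 3 := by
  rw [integral_refPlan α H.measurable_shift ((H.isTest_glue hu hv hw).integrable_mul hK)]
  simp only [H.glue_diag, H.glue_rot_one, H.glue_T]

/-! ### Dual optimizers -/

/-- A functional minus the functional induced by `h`. -/
def residual (H : HasPotentials α τ φ) (ξ : L1Bidual (refPlan α τ)) : L1Bidual (refPlan α τ) :=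
  ξ - pairing (H.integrable_realH.toL1 _)

lemma residual_apply (H : HasPotentials α τ φ) (ξ : L1Bidual (refPlan α τ)) {F : I × I → ℝ}
    (hF : IsTest F) : H.residual ξ (toLinf _ F) =
      ξ (toLinf _ F) - ∫ p, realH α p * F p ∂(refPlan α τ) := by
  rw [← hF.pairing_toLinf H.integrable_realH]
  rfl

lemma integrable_sum (H : HasPotentials α τ φ) {f g : I → ℝ} (hf : Integrable f leb)
    (hg : Integrable g leb) : Integrable (fun p => f p.1 + g p.2) (refPlan α τ) := by
  rw [integrable_refPlan_iff α H.measurable_shift]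
  exact ⟨hf.add hg, hf.add ((measurePreserving_rot α 1).integrable_comp_of_integrable hg),
    hf.add (H.measurePreserving.integrable_comp_of_integrable hg)⟩

section Optimizer

variable {ξ : L1Bidual (refPlan α τ)}

lemma apply_glue_eq_zero (H : HasPotentials α τ φ)
    (hξ : IsDualOptimizer (cost α τ) leb leb (refPlan α τ) ξ) {u v w : I → ℝ} (hu : IsTest u)
    (hv : IsTest v) (hw : IsTest w)
    (hann : ∀ f g : I → ℝ, Integrable f leb → Integrable g leb →
      ∫ x, (f x + g x) * u x ∂leb + ∫ x, (f x + g (rot α 1 x)) * v x ∂leb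
        + ∫ x, (f x + g (T α τ x)) * w x ∂leb = 0) :
    ξ (toLinf _ (glue α τ u v w)) = 0 := by
  refine hξ.mem_bidual _ fun g hg => integral_mul_eq_zero_of_mem_sumSpace ?_ hg
  intro f g hf hg
  have h1 := H.integral_mul_glue hu hv hw (H.integrable_sum hf hg)
  rw [hann f g hf hg, zero_div] at h1
  refine Eq.trans (integral_congr_ae ?_) h1
  filter_upwards [(H.isTest_glue hu hv hw).coeFn_toLinf (π := refPlan α τ)] with p hp
  rw [hp]

/-- All three plans give f ⊕ g the same integral, so a combination of them with total weight zero
annihilates every such function. -/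
lemma apply_glue_const_eq_zero (H : HasPotentials α τ φ)
    (hξ : IsDualOptimizer (cost α τ) leb leb (refPlan α τ) ξ) {a b c : ℝ} (habc : a + b + c = 0) :
    ξ (toLinf _ (glue α τ (fun _ => a) (fun _ => b) fun _ => c)) = 0 := by
  refine H.apply_glue_eq_zero hξ (.const a) (.const b) (.const c) fun f g hf hg => ?_
  have h1 : Integrable (fun x => g (rot α 1 x)) leb :=
    (measurePreserving_rot α 1).integrable_comp_of_integrable hg
  have h2 : Integrable (fun x => g (T α τ x)) leb :=
    H.measurePreserving.integrable_comp_of_integrable hg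
  have i1 : ∫ x, g (rot α 1 x) ∂leb = ∫ x, g x ∂leb :=
    (measurePreserving_rot α 1).integral_comp
      ((measurable_rot α 1).measurableEmbedding (rot_bijective α 1).injective) g
  have i2 : ∫ x, g (T α τ x) ∂leb = ∫ x, g x ∂leb :=
    H.measurePreserving.integral_comp
      (H.measurePreserving.measurable.measurableEmbedding H.bijective.injective) g
  simp only [integral_mul_const]
  rw [integral_add hf hg, integral_add hf h1, integral_add hf h2, i1, i2]
  rw [← mul_add, ← mul_add, habc, mul_zero]

lemma apply_toLinf_one (H : HasPotentials α τ φ)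
    (hξ : IsDualOptimizer (cost α τ) leb leb (refPlan α τ) ξ) :
    ξ (toLinf _ fun _ => 1) = 1 := by
  obtain ⟨a, ⟨f, hf, rfl⟩, ha⟩ := hξ.value
  rw [H.dualValue_eq_one, ← EReal.coe_one, EReal.coe_eq_coe_iff] at ha
  rwa [toLinf_eq (.const 1) hf] at ha

/-- A dual optimizer takes the value `(a + b + c) / 3` at the function equal to `a`, `b`, `c` on the
three graphs. -/
lemma apply_glue_const (H : HasPotentials α τ φ)
    (hξ : IsDualOptimizer (cost α τ) leb leb (refPlan α τ) ξ) (a b c : ℝ) :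
    ξ (toLinf _ (glue α τ (fun _ => a) (fun _ => b) fun _ => c)) = (a + b + c) / 3 := by
  have h1 := H.apply_toLinf_one hξ
  rw [H.toLinf_eq_glue (.const 1)] at h1
  set m := (a + b + c) / 3 with hm
  have h2 := H.apply_glue_const_eq_zero hξ (a := a - m) (b := b - m) (c := c - m)
    (by rw [hm]; ring)
  have h3 := H.toLinf_glue_add (.const (a - m)) (.const (b - m)) (.const (c - m))
    ((IsTest.const 1).const_mul m) ((IsTest.const 1).const_mul m) ((IsTest.const 1).const_mul m)
  rw [H.toLinf_glue_const_mul (.const 1) (.const 1) (.const 1)] at h3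
  have h4 := congrArg ξ h3
  rw [map_add, map_smul, h1, h2, zero_add, smul_eq_mul, mul_one] at h4
  rw [← h4]
  simp

lemma lintegral_ofReal_mul_cost (H : HasPotentials α τ φ) {F : I × I → ℝ} (hF : IsTest F)
    (h0 : ∀ᵐ p ∂(refPlan α τ), 0 ≤ F p) :
    ∫⁻ p, ENNReal.ofReal (toLinf (refPlan α τ) F p) * cost α τ p.1 p.2 ∂(refPlan α τ) =
      ENNReal.ofReal (∫ p, realCost α τ p * F p ∂(refPlan α τ)) := by
  rw [ofReal_integral_eq_lintegral_ofReal (hF.integrable_mul H.integrable_realCost)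
    (h0.mono fun p hp => mul_nonneg (realCost_nonneg p) hp)]
  refine lintegral_congr_ae ?_
  filter_upwards [hF.coeFn_toLinf (π := refPlan α τ), H.cost_eq_ofReal] with p hp hp'
  rw [hp, hp', ENNReal.ofReal_mul (realCost_nonneg p), mul_comm]

lemma apply_le_integral (H : HasPotentials α τ φ)
    (hξ : IsDualOptimizer (cost α τ) leb leb (refPlan α τ) ξ) {F : I × I → ℝ} (hF : IsTest F)
    (h0 : ∀ p, 0 ≤ F p) :
    ξ (toLinf _ F) ≤ ∫ p, realCost α τ p * F p ∂(refPlan α τ) := by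
  have h1 := hξ.le_cost (toLinf _ F) ((Lp.coeFn_nonneg _).1 (by
    filter_upwards [hF.coeFn_toLinf (π := refPlan α τ)] with p hp
    rw [hp]
    exact h0 p))
  rw [H.lintegral_ofReal_mul_cost hF (ae_of_all _ h0), EReal.coe_ennreal_ofReal, max_eq_left
    (integral_nonneg fun p => mul_nonneg (realCost_nonneg p) (h0 p)), EReal.coe_le_coe_iff] at h1
  exact h1

/-- This is ξ ≤ c with h subtracted: c = h on Γ_0 and Γ_1, and c - h = h_+ - h remains on Γ_τ. -/
lemma residual_glue_le (H : HasPotentials α τ φ)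
    (hξ : IsDualOptimizer (cost α τ) leb leb (refPlan α τ) ξ) {u v w : I → ℝ} (hu : IsTest u)
    (hv : IsTest v) (hw : IsTest w) (hu0 : ∀ x, 0 ≤ u x) (hv0 : ∀ x, 0 ≤ v x)
    (hw0 : ∀ x, 0 ≤ w x) :
    H.residual ξ (toLinf _ (glue α τ u v w)) ≤
      (∫ x, (max (rho α (τ x) x : ℝ) 0 - rho α (τ x) x) * w x ∂leb) / 3 := by
  have ht := H.isTest_glue hu hv hw
  have h1 := H.apply_le_integral hξ ht fun p => by
    unfold glue
    exact add_nonneg (add_nonneg (Set.indicator_nonneg (fun p _ => hu0 p.1) p)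
      (Set.indicator_nonneg (fun p _ => hv0 p.1) p)) (Set.indicator_nonneg (fun p _ => hw0 p.1) p)
  rw [H.residual_apply ξ ht]
  rw [H.integral_mul_glue hu hv hw H.integrable_realCost] at h1
  rw [H.integral_mul_glue hu hv hw H.integrable_realH]
  simp only [H.realCost_diag, H.realCost_rot_one, H.realCost_T] at h1
  simp only [H.realH_diag, H.realH_rot_one, H.realH_T, sub_mul]
  rw [integral_sub (hw.integrable_mul H.integrable_rho.pos_part)
    (hw.integrable_mul H.integrable_rho)]
  linarith

/-- An optimizer assigns total 1 to each of the three plans. So does h for the first two, while it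
assigns ∫ϱ_τ to the third. -/
lemma residual_glue_const (H : HasPotentials α τ φ)
    (hξ : IsDualOptimizer (cost α τ) leb leb (refPlan α τ) ξ) (a b c : ℝ) :
    H.residual ξ (toLinf _ (glue α τ (fun _ => a) (fun _ => b) fun _ => c)) =
      -(c * (∫ x, (rho α (τ x) x : ℝ) ∂leb - 1) / 3) := by
  rw [H.residual_apply ξ (H.isTest_glue (.const a) (.const b) (.const c)),
    H.apply_glue_const hξ, H.integral_mul_glue (.const a) (.const b) (.const c) H.integrable_realH]
  simp only [H.realH_diag, H.realH_rot_one, H.realH_T, integral_mul_const, integral_one_add_sign]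
  simp
  ring

/-- For functions supported on Γ_0 and Γ_1, the residual is nonpositive at nonnegative ones and zero
at constants on each graph. Adding constants removes the sign condition, and negation gives
equality. -/
lemma residual_glue_left (H : HasPotentials α τ φ)
    (hξ : IsDualOptimizer (cost α τ) leb leb (refPlan α τ) ξ) {u v : I → ℝ} (hu : IsTest u)
    (hv : IsTest v) : H.residual ξ (toLinf _ (glue α τ u v fun _ => 0)) = 0 := by
  have key : ∀ {u v : I → ℝ}, IsTest u → IsTest v →
      H.residual ξ (toLinf _ (glue α τ u v fun _ => 0)) ≤ 0 := by
    intro u v hu hv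
    obtain ⟨C, hC⟩ := hu.2
    obtain ⟨D, hD⟩ := hv.2
    have h1 := H.residual_glue_le hξ (hu.add (.const C)) (hv.add (.const D))
      ((IsTest.const 0).add (.const 0)) (fun x => by linarith [(abs_le.1 (hC x)).1])
      (fun x => by linarith [(abs_le.1 (hD x)).1]) (fun x => by simp)
    rw [H.toLinf_glue_add hu hv (.const 0) (.const C) (.const D) (.const 0), map_add,
      H.residual_glue_const hξ] at h1
    simpa using h1
  refine le_antisymm (key hu hv) ?_
  have h2 := key (hu.const_mul (-1)) (hv.const_mul (-1))
  have h3 := congrArg (H.residual ξ) (H.toLinf_glue_const_mul hu hv (.const 0) (-1))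
  rw [mul_zero, map_smul, smul_eq_mul] at h3
  rw [h3] at h2
  linarith

lemma residual_glue (H : HasPotentials α τ φ)
    (hξ : IsDualOptimizer (cost α τ) leb leb (refPlan α τ) ξ) {u v w : I → ℝ} (hu : IsTest u)
    (hv : IsTest v) (hw : IsTest w) :
    H.residual ξ (toLinf _ (glue α τ u v w)) =
      H.residual ξ (toLinf _ (glue α τ (fun _ => 0) (fun _ => 0) w)) := by
  have h1 := H.toLinf_glue_add hu hv (.const 0) (.const 0) (.const 0) hw
  simp only [add_zero, zero_add] at h1
  rw [h1, map_add, H.residual_glue_left hξ hu hv, zero_add]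

end Optimizer

end HasPotentials

/-! ### Exchanging Γ_τ for Γ_1 and Γ_0 along orbits. -/

lemma integral_rot (α : ℝ) (k : ℤ) (f : I → ℝ) : ∫ x, f (rot α k x) ∂leb = ∫ x, f x ∂leb :=
  (measurePreserving_rot α k).integral_comp
    ((measurable_rot α k).measurableEmbedding (rot_bijective α k).injective) f

/-- The pair (x_0, x_k) is the sum of the k pairs (x_i, x_{i+1}) minus the k - 1 diagonal pairs at
the intermediate points. -/
lemma sum_Ico_telescope {a b : ℤ → ℝ} {k : ℤ} (hk : 1 ≤ k) :
    ∑ i ∈ Finset.Ico 0 k, (a i + b (i + 1)) - ∑ i ∈ Finset.Ico 1 k, (a i + b i) = a 0 + b k := by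
  induction k, hk using Int.leInduction with
  | base => rw [show Finset.Ico (0 : ℤ) 1 = {0} by rfl]; simp
  | succ k hk ih =>
    have e : ∀ j : ℤ, j ≤ k → Finset.Ico j (k + 1) = insert k (Finset.Ico j k) := fun j hj => by
      ext i
      simp only [Finset.mem_Ico, Finset.mem_insert]
      omega
    rw [e 0 (by omega), e 1 hk, Finset.sum_insert (by simp), Finset.sum_insert (by simp)]
    linarith

namespace HasPotentials

variable {α : ℝ} {τ : I → ℤ} {φ : ℕ → I → ℝ}

/-- The integral of a function on the graph of `T^(τ)` is transported to the graphs of `T^(0)` and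
`T^(1)` along the orbits of the rotation. -/
lemma integral_orbit_eq_zero {p q r u : I → ℝ} {k : ℤ} (hu : IsTest u) (hp : Integrable p leb)
    (hq : Integrable q leb)
    (h : ∀ x, r x * u x = (∑ i ∈ Finset.Ico 0 k, q (rot α i x)
      - ∑ i ∈ Finset.Ico 1 k, p (rot α i x)) * u x) :
    ∫ x, p x * ∑ i ∈ Finset.Ico 1 k, u (rot α (-i) x) ∂leb
      + ∫ x, q x * (-1 * ∑ i ∈ Finset.Ico 0 k, u (rot α (-i) x)) ∂leb
      + ∫ x, r x * u x ∂leb = 0 := by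
  have shift : ∀ {f : I → ℝ}, Integrable f leb → ∀ s : Finset ℤ,
      Integrable (fun x => (∑ i ∈ s, f (rot α i x)) * u x) leb ∧
      ∫ x, f x * ∑ i ∈ s, u (rot α (-i) x) ∂leb = ∫ x, (∑ i ∈ s, f (rot α i x)) * u x ∂leb := by
    intro f hf s
    have i1 : ∀ i ∈ s, Integrable (fun x => f x * u (rot α (-i) x)) leb := fun i _ =>
      (hu.comp (measurable_rot α (-i))).integrable_mul hf
    have i2 : ∀ i ∈ s, Integrable (fun x => f (rot α i x) * u x) leb := fun i _ =>
      hu.integrable_mul ((measurePreserving_rot α i).integrable_comp_of_integrable hf)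
    simp only [Finset.mul_sum, Finset.sum_mul]
    refine ⟨integrable_finsetSum s i2, ?_⟩
    rw [integral_finsetSum s i1, integral_finsetSum s i2]
    refine Finset.sum_congr rfl fun i _ => ?_
    rw [← integral_rot α i fun x => f x * u (rot α (-i) x)]
    simp only [rot_neg_rot]
  have e1 := shift hp (Finset.Ico 1 k)
  have e2 := shift hq (Finset.Ico 0 k)
  have e3 : ∫ x, q x * (-1 * ∑ i ∈ Finset.Ico 0 k, u (rot α (-i) x)) ∂leb =
      -∫ x, (∑ i ∈ Finset.Ico 0 k, q (rot α i x)) * u x ∂leb := by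
    rw [← e2.2, ← integral_neg]
    refine integral_congr_ae (ae_of_all _ fun x => ?_)
    dsimp only
    ring
  rw [e1.2, e3]
  simp only [h, sub_mul]
  rw [integral_sub e2.1 e1.1]
  ring

variable {ξ : L1Bidual (refPlan α τ)}

/-- Mass on Γ_τ over {τ = k} is balanced by mass on Γ_1 and Γ_0 along the orbit segment. The
resulting signed combination annihilates all f ⊕ g, hence ξ vanishes on it. The pairing with h
vanishes as well, and the residual ignores what lies on Γ_0 and Γ_1. -/
lemma residual_glue_of_shift_eq (H : HasPotentials α τ φ)
    (hξ : IsDualOptimizer (cost α τ) leb leb (refPlan α τ) ξ) {u : I → ℝ} (hu : IsTest u) {k : ℤ}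
    (hk : 1 ≤ k) (huk : ∀ x, τ x ≠ k → u x = 0) :
    H.residual ξ (toLinf _ (glue α τ (fun _ => 0) (fun _ => 0) u)) = 0 := by
  have hA : IsTest fun x => ∑ i ∈ Finset.Ico 1 k, u (rot α (-i) x) :=
    IsTest.sum _ fun i _ => hu.comp (measurable_rot α (-i))
  have hB : IsTest fun x => -1 * ∑ i ∈ Finset.Ico 0 k, u (rot α (-i) x) :=
    (IsTest.sum _ fun i _ => hu.comp (measurable_rot α (-i))).const_mul (-1)
  rw [← H.residual_glue hξ hA hB hu, H.residual_apply ξ (H.isTest_glue hA hB hu),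
    H.integral_mul_glue hA hB hu H.integrable_realH, H.apply_glue_eq_zero hξ hA hB hu]
  · simp only [H.realH_diag, H.realH_rot_one, H.realH_T]
    rw [integral_orbit_eq_zero hu (integrable_const _) integrable_one_add_sign]
    · simp
    · intro x
      by_cases hx : τ x = k
      -- ϱ_k is the sum of k values 1 + sign, those of h on Γ_1, minus k - 1 values 1, those of h on
      -- Γ_0.
      · rw [hx, rho_eq_sum α (by omega), Finset.sum_add_distrib]
        simp only [Finset.sum_const, Int.card_Ico, nsmul_eq_mul, mul_one]
        have e1 : (((k - 0).toNat : ℕ) : ℝ) = k := by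
          rw [sub_zero]; exact_mod_cast Int.toNat_of_nonneg (by omega : 0 ≤ k)
        have e2 : (((k - 1).toNat : ℕ) : ℝ) = k - 1 := by
          exact_mod_cast Int.toNat_of_nonneg (by omega : 0 ≤ k - 1)
        rw [e1, e2]
        push_cast
        ring
      · rw [huk x hx, mul_zero, mul_zero]
  · intro f g hf hg
    refine integral_orbit_eq_zero (p := fun x => f x + g x) (q := fun x => f x + g (rot α 1 x)) hu
      (hf.add hg)
      (hf.add ((measurePreserving_rot α 1).integrable_comp_of_integrable hg)) fun x => ?_
    by_cases hx : τ x = k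
    · have := sum_Ico_telescope (a := fun i => f (rot α i x)) (b := fun i => g (rot α i x)) hk
      simp only [rot_rot, add_comm (1 : ℤ)]
      rw [this, rot_zero, T, hx]
    · rw [huk x hx, mul_zero, mul_zero]

/-! ### Sign, singularity and norm of the residual. -/

lemma measurableSet_lt_shift (H : HasPotentials α τ φ) (K : ℤ) : MeasurableSet {x | K < τ x} :=
  H.measurable_shift measurableSet_Ioi

/-- The level sets of `τ` are removed one at a time. The residual is only finitely additive, so it
may keep its mass on every tail although the tails shrink to the empty set. -/
lemma residual_glue_tail (H : HasPotentials α τ φ)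
    (hξ : IsDualOptimizer (cost α τ) leb leb (refPlan α τ) ξ) {w : I → ℝ} (hw : IsTest w) (K : ℕ) :
    H.residual ξ (toLinf _ (glue α τ (fun _ => 0) (fun _ => 0) w)) =
      H.residual ξ (toLinf _ (glue α τ (fun _ => 0) (fun _ => 0)
        ({x | (K : ℤ) < τ x}.indicator w))) := by
  induction K with
  | zero =>
    rw [Set.indicator_eq_self.2 fun x _ => ?_]
    have := H.two_le x
    simp only [Set.mem_ofPred_eq]
    omega
  | succ K ih =>
    rw [ih]
    have hm : MeasurableSet {x | τ x = K + 1} :=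
      H.measurable_shift (measurableSet_singleton ((K : ℤ) + 1))
    have h1 := H.toLinf_glue_add (.const 0) (.const 0) (hw.indicator (H.measurableSet_lt_shift (K + 1)))
      (.const 0) (.const 0) (hw.indicator hm)
    have h2 : (fun x => {x | (K : ℤ) + 1 < τ x}.indicator w x + {x | τ x = K + 1}.indicator w x) =
        {x | (K : ℤ) < τ x}.indicator w := by
      funext x
      simp only [Set.indicator, Set.mem_ofPred_eq]
      rcases lt_trichotomy ((K : ℤ) + 1) (τ x) with h | h | h
      · rw [if_pos h, if_neg h.ne', if_pos (by omega), add_zero]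
      · rw [if_neg (by omega), if_pos h.symm, if_pos (by omega), zero_add]
      · rw [if_neg (by omega), if_neg (by omega), if_neg (by omega), zero_add]
    simp only [add_zero] at h1
    rw [h2] at h1
    rw [h1, map_add, H.residual_glue_of_shift_eq hξ (hw.indicator hm) (k := K + 1) (by omega)
      fun x hx => Set.indicator_of_notMem (show x ∉ {x | τ x = K + 1} from hx) w, add_zero]
    push_cast
    rfl

/-- The value depends only on the tail {τ > K}, where it is at most a third of the integral of (h_+
- h) w; by dominated convergence these bounds tend to zero. -/
lemma residual_glue_nonpos (H : HasPotentials α τ φ)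
    (hξ : IsDualOptimizer (cost α τ) leb leb (refPlan α τ) ξ) {w : I → ℝ} (hw : IsTest w)
    (hw0 : ∀ x, 0 ≤ w x) :
    H.residual ξ (toLinf _ (glue α τ (fun _ => 0) (fun _ => 0) w)) ≤ 0 := by
  have hi : Integrable (fun x => max (rho α (τ x) x : ℝ) 0 - rho α (τ x) x) leb :=
    H.integrable_rho.pos_part.sub H.integrable_rho
  have hl : Tendsto (fun K : ℕ => ∫ x, (max (rho α (τ x) x : ℝ) 0 - rho α (τ x) x) *
      {x | (K : ℤ) < τ x}.indicator w x ∂leb) atTop (𝓝 (∫ _, (0 : ℝ) ∂leb)) := by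
    refine tendsto_integral_of_dominated_convergence
      (fun x => ‖(max (rho α (τ x) x : ℝ) 0 - rho α (τ x) x) * w x‖)
      (fun K => ((hw.indicator (H.measurableSet_lt_shift K)).integrable_mul hi).1)
      (hw.integrable_mul hi).norm (fun K => ae_of_all _ fun x => ?_) (ae_of_all _ fun x => ?_)
    · rw [norm_mul, norm_mul]
      exact mul_le_mul_of_nonneg_left (norm_indicator_le_norm_self w x) (norm_nonneg _)
    · refine tendsto_const_nhds.congr' ?_
      filter_upwards [eventually_ge_atTop (τ x).toNat] with K hK
      rw [Set.indicator_of_notMem, mul_zero]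
      simp only [Set.mem_ofPred_eq]
      omega
  rw [integral_zero] at hl
  have hl3 := hl.div_const 3
  rw [zero_div] at hl3
  refine ge_of_tendsto' hl3 fun K => ?_
  rw [H.residual_glue_tail hξ hw K]
  exact H.residual_glue_le hξ (.const 0) (.const 0) (hw.indicator (H.measurableSet_lt_shift K))
    (fun _ => le_rfl) (fun _ => le_rfl) (Set.indicator_nonneg fun x _ => hw0 x)

lemma isTest_comp_T (H : HasPotentials α τ φ) {F : I × I → ℝ} (hF : IsTest F) :
    IsTest fun x => F (x, T α τ x) :=
  hF.comp (measurable_id.prodMk (measurable_T α H.measurable_shift))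

lemma residual_toLinf (H : HasPotentials α τ φ)
    (hξ : IsDualOptimizer (cost α τ) leb leb (refPlan α τ) ξ) {F : I × I → ℝ} (hF : IsTest F) :
    H.residual ξ (toLinf _ F) = H.residual ξ
      (toLinf _ (glue α τ (fun _ => 0) (fun _ => 0) fun x => F (x, T α τ x))) := by
  rw [H.toLinf_eq_glue hF]
  exact H.residual_glue hξ (hF.comp (measurable_id.prodMk measurable_id))
    (hF.comp (measurable_id.prodMk (measurable_rot α 1))) (H.isTest_comp_T hF)

lemma residual_nonpos (H : HasPotentials α τ φ)
    (hξ : IsDualOptimizer (cost α τ) leb leb (refPlan α τ) ξ) {F : I × I → ℝ} (hF : IsTest F)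
    (h0 : ∀ p, 0 ≤ F p) : H.residual ξ (toLinf _ F) ≤ 0 := by
  rw [H.residual_toLinf hξ hF]
  exact H.residual_glue_nonpos hξ (H.isTest_comp_T hF) fun x => h0 _

lemma residual_const (H : HasPotentials α τ φ)
    (hξ : IsDualOptimizer (cost α τ) leb leb (refPlan α τ) ξ) (c : ℝ) :
    H.residual ξ (toLinf _ fun _ => c) = -(c * (∫ x, (rho α (τ x) x : ℝ) ∂leb - 1) / 3) := by
  rw [H.toLinf_eq_glue (.const c), H.residual_glue_const hξ]

lemma residual_eq_zero_of_ae (H : HasPotentials α τ φ)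
    (hξ : IsDualOptimizer (cost α τ) leb leb (refPlan α τ) ξ) {F : I × I → ℝ} (hF : IsTest F)
    {K : ℕ} (h : ∀ᵐ x ∂leb, (K : ℤ) < τ x → F (x, T α τ x) = 0) :
    H.residual ξ (toLinf _ F) = 0 := by
  have ht := (H.isTest_comp_T hF).indicator (H.measurableSet_lt_shift K)
  rw [H.residual_toLinf hξ hF, H.residual_glue_tail hξ (H.isTest_comp_T hF) K]
  have h1 : toLinf (refPlan α τ) (glue α τ (fun _ => 0) (fun _ => 0)
      ({x | (K : ℤ) < τ x}.indicator fun x => F (x, T α τ x))) = toLinf _ fun _ => 0 * 0 := by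
    refine toLinf_congr (H.isTest_glue (.const 0) (.const 0) ht) (.const _) ?_
    refine (ae_refPlan_iff α H.measurable_shift).2
      ⟨ae_of_all _ fun x => ?_, ae_of_all _ fun x => ?_, h.mono fun x hx => ?_⟩
    · rw [H.glue_diag, zero_mul]
    · rw [H.glue_rot_one, zero_mul]
    · rw [H.glue_T, zero_mul]
      exact Set.indicator_apply_eq_zero.2 hx
  rw [h1, toLinf_const_mul (.const 0), zero_smul, map_zero]

/-- Each set {τ > K} carries the residual, and these sets decrease to the empty set. -/
lemma purelySingular_residual (H : HasPotentials α τ φ)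
    (hξ : IsDualOptimizer (cost α τ) leb leb (refPlan α τ) ξ) :
    PurelySingular (H.residual ξ) := by
  have := isProbabilityMeasure_refPlan α H.measurable_shift
  intro ε hε
  have hm : ∀ K : ℕ, MeasurableSet {p : I × I | (K : ℤ) < τ p.1} := fun K =>
    measurable_fst (H.measurableSet_lt_shift K)
  have hl := tendsto_measure_iInter_atTop (μ := refPlan α τ) (fun K => (hm K).nullMeasurableSet)
    (fun i j hij p (hp : (j : ℤ) < τ p.1) => show (i : ℤ) < τ p.1 by omega)
    ⟨0, measure_ne_top _ _⟩
  have h0 : ⋂ K : ℕ, {p : I × I | (K : ℤ) < τ p.1} = ∅ := by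
    refine Set.eq_empty_of_forall_notMem fun p hp => ?_
    have := Set.mem_iInter.1 hp (τ p.1).toNat
    simp only [Set.mem_ofPred_eq] at this
    omega
  rw [h0, measure_empty] at hl
  obtain ⟨K, hK⟩ := (hl.eventually (gt_mem_nhds hε)).exists
  refine ⟨_, hm K, hK, fun f hf => ?_⟩
  obtain ⟨F, hF, -, rfl⟩ := exists_isTest f
  refine H.residual_eq_zero_of_ae hξ hF (K := K) ?_
  have h1 : ∀ᵐ p ∂(refPlan α τ), (K : ℤ) < τ p.1 → F p = 0 := by
    filter_upwards [hf, hF.coeFn_toLinf (π := refPlan α τ)] with p hp hp' hpK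
    rw [← hp']
    exact hp hpK
  exact ((ae_refPlan_iff α H.measurable_shift).1 h1).2.2

lemma supportedBy_residual (H : HasPotentials α τ φ)
    (hξ : IsDualOptimizer (cost α τ) leb leb (refPlan α τ) ξ) :
    SupportedBy (H.residual ξ) (graph α τ) := by
  intro f hf
  obtain ⟨F, hF, -, rfl⟩ := exists_isTest f
  have h1 : ∀ᵐ p ∂(refPlan α τ), p ∈ graph α τ → F p = 0 := by
    filter_upwards [hf, hF.coeFn_toLinf (π := refPlan α τ)] with p hp hp' hpK
    rw [← hp']
    exact hp hpK
  exact H.residual_eq_zero_of_ae hξ hF (K := 0)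
    (((ae_refPlan_iff α H.measurable_shift).1 h1).2.2.mono fun x hx _ => hx rfl)

/-- The negative of the residual is a positive functional, so its norm is its value at 1. -/
lemma norm_residual (H : HasPotentials α τ φ)
    (hξ : IsDualOptimizer (cost α τ) leb leb (refPlan α τ) ξ) :
    ‖H.residual ξ‖ = (∫ x, (rho α (τ x) x : ℝ) ∂leb - 1) / 3 := by
  have := isProbabilityMeasure_refPlan α H.measurable_shift
  have hpos := H.one_lt
  refine le_antisymm (ContinuousLinearMap.opNorm_le_bound _ (by linarith) fun f => ?_) ?_
  · obtain ⟨F, hF, hb, hf⟩ := exists_isTest f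
    have h1 := H.residual_nonpos hξ (hF.add (.const ‖f‖))
      fun p => by linarith [(abs_le.1 (hb p)).1]
    have h2 := H.residual_nonpos hξ ((hF.const_mul (-1)).add (.const ‖f‖))
      fun p => by linarith [(abs_le.1 (hb p)).2]
    rw [toLinf_add hF (.const _), map_add, H.residual_const hξ, ← hf] at h1
    rw [toLinf_add (hF.const_mul (-1)) (.const _), map_add, toLinf_const_mul hF, map_smul,
      H.residual_const hξ, ← hf, smul_eq_mul] at h2
    rw [Real.norm_eq_abs, abs_le]
    constructor <;> linarith
  · have h1 := (H.residual ξ).le_opNorm (toLinf _ fun _ => 1)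
    rw [H.residual_const hξ] at h1
    have h2 : ‖toLinf (refPlan α τ) fun _ => (1 : ℝ)‖ ≤ 1 := by
      rw [toLinf, dif_pos (IsTest.const 1).memLp, Lp.norm_toLp]
      refine ENNReal.toReal_le_of_le_ofReal zero_le_one ?_
      rw [eLpNorm_exponent_top]
      refine (eLpNormEssSup_le_of_ae_bound (ae_of_all _ fun _ => ?_))
      simp
    rw [Real.norm_eq_abs, abs_neg, abs_of_nonneg (by linarith)] at h1
    have h3 := mul_le_mul_of_nonneg_left h2 (norm_nonneg (H.residual ξ))
    linarith

lemma hasPairing_residual_graphs (H : HasPotentials α τ φ)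
    (hξ : IsDualOptimizer (cost α τ) leb leb (refPlan α τ) ξ) :
    HasPairing (H.residual ξ) (fun p => (graph α (fun _ => 0)).indicator (fun _ => (1 : ℝ)) p +
      (graph α (fun _ => 1)).indicator (fun _ => (1 : ℝ)) p) 0 := by
  have e : (fun p => (graph α (fun _ => 0)).indicator (fun _ => (1 : ℝ)) p +
      (graph α (fun _ => 1)).indicator (fun _ => (1 : ℝ)) p) =
      glue α τ (fun _ => 1) (fun _ => 1) fun _ => 0 := by
    funext p
    simp [glue]
  rw [e]
  exact ⟨_, (H.isTest_glue (.const 1) (.const 1) (.const 0)).coeFn_toLinf,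
    H.residual_glue_left hξ (.const 1) (.const 1)⟩

/-- The three graphs are disjoint because `τ` is at least 2 and the rotation is irrational, and π
restricts to π_τ / 3 on Γ_τ. -/
lemma plan_eq_withDensity (H : HasPotentials α τ φ) :
    plan α τ = (refPlan α τ).withDensity ((graph α τ).indicator fun _ => 3) := by
  ext s hs
  have hg := measurableSet_graph α H.measurable_shift
  rw [withDensity_apply _ hs, ← lintegral_indicator hs, lintegral_refPlan α H.measurable_shift,
    ← lintegral_indicator_one hs, lintegral_plan α H.measurable_shift]
  simp only [Set.indicator, H.mem_graph_diag_iff, H.mem_graph_rot_iff, H.mem_graph_T_iff,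
    H.shift_ne_zero, H.shift_ne_one, if_true, if_false, ite_self, lintegral_zero, zero_add]
  rw [← lintegral_const_mul' _ _ (by simp)]
  refine lintegral_congr fun x => ?_
  split_ifs
  · simp [ENNReal.inv_mul_cancel]
  · simp

lemma hasPairing_residual_rnDeriv (H : HasPotentials α τ φ)
    (hξ : IsDualOptimizer (cost α τ) leb leb (refPlan α τ) ξ) :
    HasPairing (H.residual ξ) (fun p => ((plan α τ).rnDeriv (refPlan α τ) p).toReal)
      (-(∫ x, (rho α (τ x) x : ℝ) ∂leb - 1)) := by
  have := isProbabilityMeasure_refPlan α H.measurable_shift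
  have hg := measurableSet_graph α H.measurable_shift
  have h1 := Measure.rnDeriv_withDensity (refPlan α τ)
    ((measurable_const (a := (3 : ℝ≥0∞))).indicator hg)
  rw [← H.plan_eq_withDensity] at h1
  refine ⟨toLinf _ (glue α τ (fun _ => 0) (fun _ => 0) fun _ => 3), ?_, ?_⟩
  · filter_upwards [h1, (H.isTest_glue (.const 0) (.const 0) (.const 3)).coeFn_toLinf
      (π := refPlan α τ)] with p hp hp'
    rw [hp, hp', glue]
    by_cases hpg : p ∈ graph α τ
    · simp [Set.indicator_of_mem hpg]
    · simp [Set.indicator_of_notMem hpg]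
  · rw [H.residual_glue_const hξ]
    ring

lemma isDecomposition_residual (H : HasPotentials α τ φ)
    (hξ : IsDualOptimizer (cost α τ) leb leb (refPlan α τ) ξ) :
    IsDecomposition ξ (H.integrable_realH.toL1 _) (H.residual ξ) := by
  refine ⟨H.purelySingular_residual hξ, fun f => ?_⟩
  rw [← pairing_apply]
  exact (add_sub_cancel _ _).symm

end HasPotentials

/-! ### Existence of dual optimizers. -/

lemma norm_pairing_le {Z : Type*} [MeasurableSpace Z] {π : Measure Z} (r : Lp ℝ 1 π) :
    ‖pairing r‖ ≤ ∫ z, ‖r z‖ ∂π := by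
  refine ContinuousLinearMap.opNorm_le_bound _ (integral_nonneg fun z => norm_nonneg _) fun f => ?_
  obtain ⟨F, hF, hb, hf⟩ := exists_isTest f
  rw [pairing_apply, ← integral_mul_const]
  refine norm_integral_le_of_norm_le ((L1.integrable_coeFn r).norm.mul_const _) ?_
  filter_upwards [hF.coeFn_toLinf (π := π)] with z hz
  rw [norm_mul, hf, hz, ← hf]
  exact mul_le_mul_of_nonneg_left (hb z) (norm_nonneg _)

/-- A bounded sequence of functionals has a weak-star cluster point. -/
lemma exists_tendsto_hyperfilter {E : Type*} [NormedAddCommGroup E] [NormedSpace ℝ E]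
    (L : ℕ → StrongDual ℝ E) {M : ℝ} (hM : ∀ n, ‖L n‖ ≤ M) :
    ∃ ξ : StrongDual ℝ E, ∀ f, Tendsto (fun n => L n f) (hyperfilter ℕ : Filter ℕ) (𝓝 (ξ f)) := by
  have hc := WeakDual.isCompact_closedBall (𝕜 := ℝ) (0 : StrongDual ℝ E) M
  obtain ⟨ξ, -, hξ⟩ := hc.ultrafilter_le_nhds
    ((hyperfilter ℕ).map fun n => StrongDual.toWeakDual (L n)) (by
      rw [le_principal_iff]
      refine Filter.mem_map.2 (Filter.univ_mem' fun n => ?_)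
      simp only [Set.mem_preimage, Metric.mem_closedBall, dist_zero_right]
      exact hM n)
  refine ⟨WeakDual.toStrongDual ξ, fun f => ?_⟩
  exact ((WeakDual.eval_continuous f).tendsto ξ).comp hξ

namespace HasPotentials

variable {α : ℝ} {τ : I → ℤ} {φ : ℕ → I → ℝ}

lemma integral_sum (H : HasPotentials α τ φ) {f g : I → ℝ} (hf : Integrable f leb)
    (hg : Integrable g leb) :
    ∫ p, (f p.1 + g p.2) ∂(refPlan α τ) = ∫ x, f x ∂leb + ∫ x, g x ∂leb := by
  have h1 : Integrable (fun x => g (rot α 1 x)) leb :=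
    (measurePreserving_rot α 1).integrable_comp_of_integrable hg
  have h2 : Integrable (fun x => g (T α τ x)) leb :=
    H.measurePreserving.integrable_comp_of_integrable hg
  have i2 : ∫ x, g (T α τ x) ∂leb = ∫ x, g x ∂leb :=
    H.measurePreserving.integral_comp
      (H.measurePreserving.measurable.measurableEmbedding H.bijective.injective) g
  rw [integral_refPlan α H.measurable_shift (H.integrable_sum hf hg)]
  dsimp only
  rw [integral_add hf hg, integral_add hf h1, integral_add hf h2, integral_rot, i2]
  ring

lemma le_realCost (H : HasPotentials α τ φ) {f g : I → ℝ}
    (h : ∀ x y, ((f x + g y : ℝ) : EReal) ≤ ((cost α τ x y : ENNReal) : EReal)) :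
    ∀ᵐ p ∂(refPlan α τ), f p.1 + g p.2 ≤ realCost α τ p := by
  filter_upwards [H.cost_eq_ofReal] with p hp
  have h1 := h p.1 p.2
  rwa [hp, EReal.coe_ennreal_ofReal, max_eq_left (realCost_nonneg p), EReal.coe_le_coe_iff] at h1

/-- The admissible functions φ_n ⊕ ψ_n are bounded in L¹(π), since they lie below the integrable
cost and their integrals are bounded below. A weak-star limit along an ultrafilter inherits the
annihilation property, the bound by c and the limit value 1. -/
theorem exists_isDualOptimizer (H : HasPotentials α τ φ) :
    ∃ ξ : L1Bidual (refPlan α τ), IsDualOptimizer (cost α τ) leb leb (refPlan α τ) ξ := by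
  have D := H.isDualSequence
  have hf : ∀ n, Integrable (φ n) leb := fun n => by
    obtain ⟨h1, -, C, hC⟩ := D.bounded n
    exact integrable_of_bdd h1 fun x => (hC x).1
  have hg : ∀ n, Integrable (H.second n) leb := fun n => by
    obtain ⟨-, h2, C, hC⟩ := D.bounded n
    exact integrable_of_bdd h2 fun x => (hC x).2
  have hi := fun n => H.integrable_sum (hf n) (hg n)
  have hle := fun n => H.le_realCost (D.le_cost n)
  obtain ⟨m, hm⟩ := D.value.bddBelow_range
  obtain ⟨ξ, hξ⟩ := exists_tendsto_hyperfilter (fun n => pairing ((hi n).toL1 _))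
    (M := 2 * ∫ p, realCost α τ p ∂(refPlan α τ) - m) fun n => by
      refine (norm_pairing_le _).trans ?_
      -- From f ≤ c and c ≥ 0 it follows that |f| ≤ 2c - f, whose integral is 2∫c minus the dual
      -- value of f.
      have h1 : ∫ p, ‖(hi n).toL1 _ p‖ ∂(refPlan α τ) ≤
          ∫ p, (2 * realCost α τ p - (φ n p.1 + H.second n p.2)) ∂(refPlan α τ) := by
        refine integral_mono_ae (L1.integrable_coeFn _).norm
          ((H.integrable_realCost.const_mul 2).sub (hi n)) ?_
        filter_upwards [(hi n).coeFn_toL1, hle n] with p hp hp'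
        have := realCost_nonneg (α := α) (τ := τ) p
        rw [hp, Real.norm_eq_abs, abs_le]
        constructor <;> linarith
      rw [integral_sub (H.integrable_realCost.const_mul 2) (hi n), integral_const_mul,
        H.integral_sum (hf n) (hg n)] at h1
      have := hm ⟨n, rfl⟩
      dsimp only at this
      linarith
  refine ⟨ξ, ?_, ?_, ?_⟩
  · intro f hfs
    refine tendsto_nhds_unique (hξ f) ?_
    have : ∀ n, pairing ((hi n).toL1 _) f = 0 := fun n => by
      rw [pairing_apply]
      exact hfs _ (Submodule.le_topologicalClosure _
        (Submodule.subset_span ⟨φ n, H.second n, hf n, hg n, (hi n).coeFn_toL1⟩))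
    simp only [this]
    exact tendsto_const_nhds
  · intro f hf0
    obtain ⟨F, hF, -, rfl⟩ := exists_isTest f
    have h0 : ∀ᵐ p ∂(refPlan α τ), 0 ≤ F p := by
      filter_upwards [(Lp.coeFn_nonneg _).2 hf0, hF.coeFn_toLinf (π := refPlan α τ)] with p hp hp'
      rw [← hp']
      exact hp
    rw [H.lintegral_ofReal_mul_cost hF h0, EReal.coe_ennreal_ofReal, EReal.coe_le_coe_iff]
    refine le_max_of_le_left (le_of_tendsto' (hξ _) fun n => ?_)
    rw [hF.pairing_toLinf (hi n)]
    refine integral_mono_ae (hF.integrable_mul (hi n)) (hF.integrable_mul H.integrable_realCost) ?_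
    filter_upwards [h0, hle n] with p hp hp'
    exact mul_le_mul_of_nonneg_right hp' hp
  · refine ⟨1, ⟨toLinf _ fun _ => 1, (IsTest.const 1).coeFn_toLinf, ?_⟩, ?_⟩
    · refine tendsto_nhds_unique (hξ _) ?_
      simp only [(IsTest.const 1).pairing_toLinf (hi _), mul_one, H.integral_sum (hf _) (hg _)]
      exact D.value.mono_left Nat.hyperfilter_le_atTop
    · rw [H.dualValue_eq_one, EReal.coe_one]

/-! ### Optimality of the plans and the main theorem. -/

lemma isOptimalPlan_of_lintegral_eq_one (H : HasPotentials α τ φ) {ρ : Measure (I × I)}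
    (hρ : IsTransportPlan leb leb ρ) (h1 : ∫⁻ p, cost α τ p.1 p.2 ∂ρ = 1) :
    IsOptimalPlan (cost α τ) leb leb ρ :=
  ⟨hρ, fun _ h => h1.trans_le (H.one_le_lintegral_cost h)⟩

lemma isTransportPlan_of_mem (H : HasPotentials α τ φ) {σ : I → ℤ}
    (hσ : σ ∈ ({(fun _ => 0), (fun _ => 1), τ} : Set (I → ℤ))) :
    Function.Bijective (T α σ) ∧ MeasurePreserving (T α σ) leb leb ∧
      IsTransportPlan leb leb (plan α σ) := by
  have h : Measurable σ ∧ Function.Bijective (T α σ) := by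
    rcases hσ with rfl | rfl | rfl
    · exact ⟨measurable_const, rot_bijective α 0⟩
    · exact ⟨measurable_const, rot_bijective α 1⟩
    · exact ⟨H.measurable_shift, H.bijective⟩
  exact ⟨h.2, measurePreserving_T h.1 h.2, isTransportPlan_plan h.1 h.2⟩

lemma not_isOptimalPlan (H : HasPotentials α τ φ) :
    ¬ IsOptimalPlan (cost α τ) leb leb (plan α τ) := fun h => by
  have h1 := H.le_lintegral_cost.trans
    (h.2 _ (H.isTransportPlan_of_mem (σ := fun _ => 0) (Or.inl rfl)).2.2)
  rw [H.lintegral_cost_zero, ENNReal.ofReal_le_one, H.integral_realH_plan] at h1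
  exact h1.not_gt H.one_lt

end HasPotentials

end SingularDual
end

open SingularDual in
theorem mainTheorem2 :
    ∃ (α : ℝ) (τ : I → ℤ),
      Irrational α ∧ 0 ≤ α ∧ α < 1 ∧ Measurable τ ∧
      -- the three maps are measure preserving bijections, inducing transport plans
      (∀ σ ∈ ({(fun _ => 0), (fun _ => 1), τ} : Set (I → ℤ)),
        Function.Bijective (T α σ) ∧
        MeasurePreserving (T α σ) leb leb ∧
        IsTransportPlan leb leb (plan α σ)) ∧
      -- optimality of the first two plans, non-optimality of the third
      IsOptimalPlan (cost α τ) leb leb (plan α fun _ => 0) ∧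
      IsOptimalPlan (cost α τ) leb leb (plan α fun _ => 1) ∧
      ¬ IsOptimalPlan (cost α τ) leb leb (plan α τ) ∧
      ∫⁻ p, cost α τ p.1 p.2 ∂(plan α fun _ => 0) = 1 ∧
      ∫⁻ p, cost α τ p.1 p.2 ∂(plan α fun _ => 1) = 1 ∧
      ∫⁻ p, cost α τ p.1 p.2 ∂(refPlan α τ) < ⊤ ∧
      Integrable (fun p : I × I => (h α p.1 p.2).toReal) (refPlan α τ) ∧
      ENNReal.ofReal (∫ p, (h α p.1 p.2).toReal ∂(plan α τ)) ≤
        ∫⁻ p, cost α τ p.1 p.2 ∂(plan α τ) ∧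
      1 < ∫ p, (h α p.1 p.2).toReal ∂(plan α τ) ∧
      -- bounded dual approximants
      (∃ φ ψ : ℕ → I → ℝ,
        (∀ n, Measurable (φ n) ∧ Measurable (ψ n) ∧
          ∃ C : ℝ, ∀ x, |φ n x| ≤ C ∧ |ψ n x| ≤ C) ∧
        (∀ n x y, ((φ n x + ψ n y : ℝ) : EReal) ≤ ((cost α τ x y : ENNReal) : EReal)) ∧
        Tendsto (fun n => (∫ x, φ n x ∂leb) + ∫ y, ψ n y ∂leb) atTop (𝓝 1) ∧
        ∀ᵐ p ∂(refPlan α τ),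
          Tendsto (fun n => ((φ n p.1 + ψ n p.2 : ℝ) : EReal)) atTop (𝓝 (h α p.1 p.2))) ∧
      -- the dual optimizers
      (∃ ξ : L1Bidual (refPlan α τ),
        IsDualOptimizer (cost α τ) leb leb (refPlan α τ) ξ) ∧
      ∀ ξ : L1Bidual (refPlan α τ),
        IsDualOptimizer (cost α τ) leb leb (refPlan α τ) ξ →
        (∃! rs : Lp ℝ 1 (refPlan α τ) × L1Bidual (refPlan α τ),
          IsDecomposition ξ rs.1 rs.2) ∧
        ∀ (r : Lp ℝ 1 (refPlan α τ)) (s : L1Bidual (refPlan α τ)), IsDecomposition ξ r s →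
          (r =ᵐ[refPlan α τ] fun p => (h α p.1 p.2).toReal) ∧
          s ≠ 0 ∧
          ‖s‖ = ((∫ p, (h α p.1 p.2).toReal ∂(plan α τ)) - 1) / 3 ∧
          HasPairing s (fun p => ((plan α τ).rnDeriv (refPlan α τ) p).toReal)
            (-((∫ p, (h α p.1 p.2).toReal ∂(plan α τ)) - 1)) ∧
          SupportedBy s (graph α τ) ∧
          HasPairing s
            (fun p => (graph α (fun _ => 0)).indicator (fun _ => (1 : ℝ)) p +
              (graph α (fun _ => 1)).indicator (fun _ => (1 : ℝ)) p) 0 := by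
  obtain ⟨τ, H⟩ := exists_hasPotentials
  refine ⟨angle, τ, H.irrational, angle_pos.le, angle_lt_one, H.measurable_shift,
    fun σ hσ => H.isTransportPlan_of_mem hσ,
    H.isOptimalPlan_of_lintegral_eq_one (H.isTransportPlan_of_mem (Or.inl rfl)).2.2
      H.lintegral_cost_zero,
    H.isOptimalPlan_of_lintegral_eq_one (H.isTransportPlan_of_mem (Or.inr (Or.inl rfl))).2.2
      H.lintegral_cost_one,
    H.not_isOptimalPlan, H.lintegral_cost_zero, H.lintegral_cost_one, H.lintegral_cost_refPlan,
    H.integrable_realH, H.le_lintegral_cost, H.one_lt.trans_eq H.integral_realH_plan.symm, ?_,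
    H.exists_isDualOptimizer, fun ξ hξ => ?_⟩
  · have D := H.isDualSequence
    exact ⟨approx, H.second, D.bounded, D.le_cost, D.value, D.ae_tendsto⟩
  · have hd := H.isDecomposition_residual hξ
    have e := H.integral_realH_plan
    unfold HasPotentials.realH at e
    refine ⟨⟨(_, H.residual ξ), hd, fun rs hrs => Prod.ext (hrs.unique hd).1 (hrs.unique hd).2⟩,
      fun r s hrs => ?_⟩
    obtain ⟨rfl, rfl⟩ := hrs.unique hd
    have hn := H.norm_residual hξ
    rw [e]
    refine ⟨H.integrable_realH.coeFn_toL1, fun h0 => ?_, hn, H.hasPairing_residual_rnDeriv hξ,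
      H.supportedBy_residual hξ, H.hasPairing_residual_graphs hξ⟩
    rw [h0, norm_zero] at hn
    linarith [H.one_lt]
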